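/- There is a deterministic polynomial-time algorithm with the following property. Its input consists of an integer $d\ge 0$, rational vectors $v_1,\dots,v_n\in\mathbb{Q}^d$ (repetitions allowed), and a partition of $\{1,\dots,n\}$ into $d$ nonempty parts $\mathcal{P}_1,\dots,\mathcal{P}_d$. Call $S\subseteq\{1,\dots,n\}$ feasible if $|S\cap\mathcal{P}_i|=1$ for every $i=1,\dots,d$ (that is, $S$ is a basis of the partition matroid), and let $OPT$ be a feasible set maximizing $\det\bigl(\sum_{i\in S}v_iv_i^\top\bigr)$ over all feasible sets $S$. The algorithm outputs a feasible set $S$ with $$\det\Bigl(\sum_{i\in S}v_iv_i^\top\Bigr)\;\ge\;e^{-10\,d\log d}\cdot\det\Bigl(\sum_{i\in OPT}v_iv_i^\top\Bigr).$$ Here $\log$ is the natural logarithm (with $0\log 0=0$), and the running time, measured in bit operations (a random access machine with logarithmic cost), is bounded by a fixed polynomial in the binary encoding length of the input $(d,n,\text{the partition},v_1,\dots,v_n)$, the coordinates being given as fractions in lowest terms. -/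

import Mathlib

/-! ### Deterministic random access machines with logarithmic cost

Programs are structured (assignments, branching, loops).  The memory consists of finitely many
arrays per program, each an integer-addressed store of integers; scalar variables are cells with
a constant address.  Every operation is charged the bit lengths of its operands, of its result
and of the addresses it uses, so that running time is polynomially related to that of a Turing
machine. -/

namespace RAM

/-- The binary length of an integer (the bits of its absolute value, plus one for the sign). -/
def bitLen (z : ℤ) : ℕ := Nat.size z.natAbs + 1

/-- Memory: `s a i` is the content of cell `i` of array `a`. -/
abbrev State : Type := ℕ → ℤ → ℤ

/-- Memory after writing `v` to cell `i` of array `a`. -/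
def State.write (s : State) (a : ℕ) (i v : ℤ) : State :=
  fun b j => if b = a ∧ j = i then v else s b j

/-- The primitive operations on integers. -/
inductive Op : Type
  | add | sub | mul | div | lt | eq

/-- Meaning of the operations: `div` is integer division (with value `0` for divisor `0`),
and the tests `lt` and `eq` return `1` or `0`. -/
def Op.eval : Op → ℤ → ℤ → ℤ
  | .add, x, y => x + y
  | .sub, x, y => x - y
  | .mul, x, y => x * y
  | .div, x, y => x / y
  | .lt, x, y => if x < y then 1 else 0
  | .eq, x, y => if x = y then 1 else 0

/-- Expressions: constants, the content of the cell of array `a` at a computed address,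
and operations. -/
inductive Expr : Type
  | const (z : ℤ)
  | read (a : ℕ) (i : Expr)
  | op (o : Op) (e f : Expr)

/-- Value of an expression. -/
def Expr.eval (s : State) : Expr → ℤ
  | .const z => z
  | .read a i => s a (i.eval s)
  | .op o e f => o.eval (e.eval s) (f.eval s)

/-- Cost of evaluating an expression: the total bit length of the values of all its
subexpressions (thus of all addresses, operands and results). -/
def Expr.cost (s : State) : Expr → ℕ
  | .const z => bitLen z
  | .read a i => i.cost s + bitLen ((Expr.read a i).eval s)
  | .op o e f => e.cost s + f.cost s + bitLen ((Expr.op o e f).eval s)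

/-- Programs.  A test succeeds if its value is nonzero. -/
inductive Prog : Type
  | skip
  | assign (a : ℕ) (i e : Expr)
  | seq (p q : Prog)
  | ite (b : Expr) (p q : Prog)
  | while (b : Expr) (p : Prog)

/-- `Exec p s s' t`: started in memory `s`, the program `p` halts in memory `s'` after time `t`. -/
inductive Exec : Prog → State → State → ℕ → Prop
  | skip (s : State) : Exec .skip s s 1
  | assign (a : ℕ) (i e : Expr) (s : State) :
      Exec (.assign a i e) s (s.write a (i.eval s) (e.eval s)) (i.cost s + e.cost s)
  | seq {p q : Prog} {s s' s'' : State} {t t' : ℕ} :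
      Exec p s s' t → Exec q s' s'' t' → Exec (.seq p q) s s'' (t + t')
  | ite_true {b : Expr} {p q : Prog} {s s' : State} {t : ℕ} :
      b.eval s ≠ 0 → Exec p s s' t → Exec (.ite b p q) s s' (b.cost s + t)
  | ite_false {b : Expr} {p q : Prog} {s s' : State} {t : ℕ} :
      b.eval s = 0 → Exec q s s' t → Exec (.ite b p q) s s' (b.cost s + t)
  | while_true {b : Expr} {p : Prog} {s s' s'' : State} {t t' : ℕ} :
      b.eval s ≠ 0 → Exec p s s' t → Exec (.while b p) s' s'' t' →
        Exec (.while b p) s s'' (b.cost s + t + t')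
  | while_false {b : Expr} {p : Prog} {s : State} :
      b.eval s = 0 → Exec (.while b p) s s (b.cost s)

/-- Programs are deterministic: the final memory and the running time are determined by the
initial memory. -/
theorem Exec.deterministic {p : Prog} {s s₁ s₂ : State} {t₁ t₂ : ℕ}
    (h₁ : Exec p s s₁ t₁) (h₂ : Exec p s s₂ t₂) : s₁ = s₂ ∧ t₁ = t₂ := by
  induction h₁ generalizing s₂ t₂ with
  | skip s => cases h₂; exact ⟨rfl, rfl⟩
  | assign a i e s => cases h₂; exact ⟨rfl, rfl⟩
  | seq _ _ ih ih' =>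
    cases h₂ with
    | seq k k' =>
      obtain ⟨rfl, rfl⟩ := ih k
      obtain ⟨rfl, rfl⟩ := ih' k'
      exact ⟨rfl, rfl⟩
  | ite_true hb _ ih =>
    cases h₂ with
    | ite_true _ k => obtain ⟨rfl, rfl⟩ := ih k; exact ⟨rfl, rfl⟩
    | ite_false hb' _ => exact absurd hb' hb
  | ite_false hb _ ih =>
    cases h₂ with
    | ite_true hb' _ => exact absurd hb hb'
    | ite_false _ k => obtain ⟨rfl, rfl⟩ := ih k; exact ⟨rfl, rfl⟩
  | while_true hb _ _ ih ih' =>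
    cases h₂ with
    | while_true _ k k' =>
      obtain ⟨rfl, rfl⟩ := ih k
      obtain ⟨rfl, rfl⟩ := ih' k'
      exact ⟨rfl, rfl⟩
    | while_false hb' => exact absurd hb' hb
  | while_false hb =>
    cases h₂ with
    | while_true hb' _ _ => exact absurd hb hb'
    | while_false _ => exact ⟨rfl, rfl⟩

/-- Initial memory on input `L`: the input is in the cells `0, 1, 2, …` of array `0`, all other
cells contain `0`. -/
def State.init (L : List ℤ) : State :=
  fun a i => if a = 0 ∧ 0 ≤ i then L.getD i.toNat 0 else 0

/-- Encoding length of an input. -/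
def inputSize (L : List ℤ) : ℕ := (L.map bitLen).sum

end RAM

/-! ### Determinant maximization over a partition matroid -/

/-- `n` rational vectors `v₁, …, vₙ` in dimension `d` (repetitions allowed), whose indices are
partitioned into `d` nonempty parts `part ⁻¹' {i}`. -/
structure PartitionInstance : Type where
  d : ℕ
  n : ℕ
  vec : Fin n → Fin d → ℚ
  part : Fin n → Fin d
  part_surjective : Function.Surjective part

namespace PartitionInstance

/-- Feasible sets, i.e. bases of the partition matroid: exactly one element of each part. -/
def IsFeasible (I : PartitionInstance) (S : Finset (Fin I.n)) : Prop :=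
  ∀ i : Fin I.d, (S.filter fun e => I.part e = i).card = 1

/-- The objective `det (∑_{e ∈ S} v_e v_eᵀ)`. -/
def objective (I : PartitionInstance) (S : Finset (Fin I.n)) : ℚ :=
  (∑ e ∈ S, Matrix.vecMulVec (I.vec e) (I.vec e)).det

/-- `OPT` is an optimal solution. -/
def IsOptimal (I : PartitionInstance) (OPT : Finset (Fin I.n)) : Prop :=
  I.IsFeasible OPT ∧ ∀ T : Finset (Fin I.n), I.IsFeasible T → I.objective T ≤ I.objective OPT

/-- The input sequence: `d`, `n`, the part of each element, and then, vector after vector, the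
numerators and (again vector after vector) the denominators of all coordinates in lowest terms. -/
def encode (I : PartitionInstance) : List ℤ :=
  [(I.d : ℤ), (I.n : ℤ)]
    ++ List.ofFn (fun e : Fin I.n => ((I.part e : ℕ) : ℤ))
    ++ List.ofFn (fun k : Fin (I.n * I.d) => (I.vec k.divNat k.modNat).num)
    ++ List.ofFn (fun k : Fin (I.n * I.d) => ((I.vec k.divNat k.modNat).den : ℤ))

/-- The output set: the elements `e` such that cell `e` of array `1` contains `1`. -/
def output (I : PartitionInstance) (s : RAM.State) : Finset (Fin I.n) :=
  Finset.univ.filter fun e => s 1 ((e : ℕ) : ℤ) = 1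

end PartitionInstance

/-! ### Reasoning about programs -/

namespace RAM

/-! The algorithm is a local search by exchanges along cycles. For a basis `b` of integer vectors
put `N = |bdet X b|`, and let `tab X b s e` be the determinant after `e` has replaced row `s`. The
exchange graph has the rows as vertices. An edge from `r` to `s` means that row `s` receives an
element from the part of `b r`; its weight `wgt` is the largest possible `|tab X b s e|`. An
exchange along a simple cycle only permutes the parts among the rows. The search stops when no
closed walk of a length `l ≤ d` weighs more than `thr = (d l³ N)^l`.

Local optima are good: let `c` choose its row `r` from the part of `b r`. By Cramer's rule, `N^d
|det c|` is `N` times the determinant of the matrix of tableau entries. In its Leibniz expansion the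
term of a permutation splits into cycles, each bounded by `(d⁴ N)^l`. There are at most `d^d` terms,
so `|det c| ≤ d^(5d) N` (`prod_perm_le`, `LocallyOptimal.natAbs_bdet_le`). The objective is the
square of a determinant, which turns this into the factor `d^(10d) = e^(10 d log d)`.

Violations give progress: take a shortest closed walk above its threshold, of length `l`. It is a
simple cycle, since otherwise it splits into two shorter closed walks obeying their thresholds, and
`thr a * thr c ≤ thr (a + c)`. A chord of the cycle closes a shorter closed walk, which also obeys
its threshold. Conjugate the minor of the tableau on the cycle by partial products of the edge
weights, normalized by their geometric mean, which exceeds `d l³ N`. Relative to the diagonal, the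
entries at cyclic distance `a` are then at most `(a/l)^(3a) ≤ (l-a+1)^(-3)`, and these add up to at
most `1/2`. By Gershgorin the minor is at least `2^(-l)` times its diagonal product (`minor_ge`), so
for `l ≥ 2` the determinant grows by a factor `(d l³/2)^l ≥ 2`; loops are treated directly
(`Violation.improves`). The same estimate for initial segments of the cycle shows that all
intermediate bases are nonsingular, so the exchange can be carried out as a sequence of single
pivots with exact integer division.

Start and output: denominators are cleared, every part receives an artificial unit vector, and the
input vectors are multiplied by a large integer `K`. The unit vectors are a starting basis of
determinant one. If some feasible set has nonzero determinant, its scaled determinant is at least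
`K^d`, whereas a basis with an artificial vector reaches at most `K^(d-1) d! M^d`, where `M` bounds
the coordinates. `K` is chosen so that even the factor `d^(5d)` cannot bridge this gap, hence a
local optimum consists of input vectors. If all feasible determinants vanish, any transversal will
do.

Time: nonzero integer determinants lie between one and `2^L` with `L` polynomial in the input size,
so doubling bounds the number of rounds. In a round, the heaviest walks are found by max-product
dynamic programming. The search stores determinants, walk weights, powers of thresholds and indices,
all of at most `L` bits up to sign. The predicate `Runs` is a Hoare triple that also carries a
polynomial time bound, a uniform bound on all memory cells, and the list of untouched arrays. -/

/-- Every memory cell has absolute value at most `2 ^ b`. -/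
def Bdd (b : ℕ) (s : State) : Prop := ∀ a i, |s a i| ≤ 2 ^ b

theorem bitLen_le {z : ℤ} {b : ℕ} (h : |z| ≤ 2 ^ b) : bitLen z ≤ b + 2 := by
  have h1 : z.natAbs ≤ 2 ^ b := by
    zify
    simpa using h
  have h2 : Nat.size z.natAbs ≤ b + 1 :=
    Nat.size_le.2 (lt_of_le_of_lt h1 (Nat.pow_lt_pow_right (by norm_num) (by omega)))
  unfold bitLen
  omega

theorem Op.abs_eval_le (o : Op) {x y : ℤ} {A B : ℕ} (hx : |x| ≤ 2 ^ A) (hy : |y| ≤ 2 ^ B) :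
    |o.eval x y| ≤ 2 ^ (A + B + 1) := by
  have hA : (1 : ℤ) ≤ 2 ^ A := one_le_pow₀ (by norm_num)
  have hB : (1 : ℤ) ≤ 2 ^ B := one_le_pow₀ (by norm_num)
  have e : (2 : ℤ) ^ (A + B + 1) = 2 * (2 ^ A * 2 ^ B) := by ring
  rw [e]
  have h1 : (2 : ℤ) ^ A ≤ 2 ^ A * 2 ^ B := by nlinarith
  have h2 : (2 : ℤ) ^ B ≤ 2 ^ A * 2 ^ B := by nlinarith
  cases o with
  | add => exact (abs_add_le x y).trans (by linarith)
  | sub => exact (abs_sub x y).trans (by linarith)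
  | mul =>
    have : |x * y| ≤ 2 ^ A * 2 ^ B := by
      rw [abs_mul]
      exact mul_le_mul hx hy (abs_nonneg _) (by positivity)
    simp only [Op.eval]
    linarith
  | div =>
    simp only [Op.eval]
    exact (Int.abs_ediv_le_abs x y).trans (by linarith)
  | lt =>
    simp only [Op.eval]
    split_ifs
    · rw [abs_one]
      linarith
    · rw [abs_zero]
      linarith
  | eq =>
    simp only [Op.eval]
    split_ifs
    · rw [abs_one]
      linarith
    · rw [abs_zero]
      linarith

/-- Each operation at most adds the exponents of its operands plus one, so for a fixed expression
exponent and cost are linear in `b + 1`, with a constant depending only on the expression. -/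
theorem Expr.exists_bound (e : Expr) : ∃ C : ℕ, ∀ b s, Bdd b s →
    |e.eval s| ≤ 2 ^ (C * (b + 1)) ∧ e.cost s ≤ C * (b + 1) := by
  induction e with
  | const z =>
    refine ⟨z.natAbs + 2, fun b s _ => ?_⟩
    have h : |z| ≤ 2 ^ z.natAbs := by
      rw [Int.abs_eq_natAbs]
      exact_mod_cast Nat.lt_two_pow_self.le
    have h2 : z.natAbs + 2 ≤ (z.natAbs + 2) * (b + 1) := Nat.le_mul_of_pos_right _ (by omega)
    exact ⟨h.trans (pow_le_pow_right₀ (by norm_num) (by omega)), (bitLen_le h).trans h2⟩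
  | read a i ih =>
    obtain ⟨C, hC⟩ := ih
    refine ⟨C + 2, fun b s hs => ?_⟩
    have h := hs a (i.eval s)
    refine ⟨h.trans (pow_le_pow_right₀ (by norm_num) (by nlinarith)), ?_⟩
    have h1 := (hC b s hs).2
    have h2 := bitLen_le h
    simp only [Expr.cost, Expr.eval]
    nlinarith
  | op o e f ihe ihf =>
    obtain ⟨C, hC⟩ := ihe
    obtain ⟨C', hC'⟩ := ihf
    refine ⟨2 * C + 2 * C' + 3, fun b s hs => ?_⟩
    have h := o.abs_eval_le (hC b s hs).1 (hC' b s hs).1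
    refine ⟨h.trans (pow_le_pow_right₀ (by norm_num) (by nlinarith)), ?_⟩
    have h1 := (hC b s hs).2
    have h1' := (hC' b s hs).2
    have h2 := bitLen_le h
    simp only [Expr.cost, Expr.eval]
    nlinarith

/-- Programs without loops. -/
def Prog.LoopFree : Prog → Prop
  | .skip => True
  | .assign _ _ _ => True
  | .seq p q => p.LoopFree ∧ q.LoopFree
  | .ite _ p q => p.LoopFree ∧ q.LoopFree
  | .while _ _ => False

/-- The effect of a program without loops. -/
def Prog.run : Prog → State → State
  | .skip, s => s
  | .assign a i e, s => s.write a (i.eval s) (e.eval s)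
  | .seq p q, s => q.run (p.run s)
  | .ite b p q, s => if b.eval s = 0 then q.run s else p.run s
  | .while _ _, s => s

theorem Bdd.mono {b b' : ℕ} {s : State} (h : Bdd b s) (hb : b ≤ b') : Bdd b' s :=
  fun a i => (h a i).trans (pow_le_pow_right₀ (by norm_num) hb)

theorem Bdd.write {b : ℕ} {s : State} (h : Bdd b s) (a : ℕ) (i : ℤ) {v : ℤ} (hv : |v| ≤ 2 ^ b) :
    Bdd b (s.write a i v) := by
  intro a' i'
  unfold State.write
  split_ifs
  · exact hv
  · exact h a' i'

/-- Composition of linear bounds is linear. The bound on the resulting memory is worse by the factor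
`C` and would explode under iteration; this is why `Runs` demands that the original bound be
restored by a semantic argument. -/
theorem Prog.LoopFree.exec {p : Prog} (hp : p.LoopFree) : ∃ C : ℕ, ∀ b s, Bdd b s →
    ∃ t, Exec p s (p.run s) t ∧ t ≤ C * (b + 1) ∧ Bdd (C * (b + 1)) (p.run s) := by
  induction p with
  | skip => exact ⟨1, fun b s hs => ⟨1, .skip s, by omega, hs.mono (by omega)⟩⟩
  | assign a i e =>
    obtain ⟨C, hC⟩ := i.exists_bound
    obtain ⟨C', hC'⟩ := e.exists_bound
    refine ⟨C + C' + 1, fun b s hs => ⟨_, .assign a i e s, ?_, ?_⟩⟩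
    · have h1 := (hC b s hs).2
      have h2 := (hC' b s hs).2
      nlinarith
    · exact (hs.mono (by nlinarith)).write _ _ ((hC' b s hs).1.trans
        (pow_le_pow_right₀ (by norm_num) (by nlinarith)))
  | seq p q ihp ihq =>
    obtain ⟨C, hC⟩ := ihp hp.1
    obtain ⟨C', hC'⟩ := ihq hp.2
    refine ⟨C + C' * (C + 1), fun b s hs => ?_⟩
    obtain ⟨t, h1, h2, h3⟩ := hC b s hs
    obtain ⟨t', h1', h2', h3'⟩ := hC' _ _ h3
    have hle : C' * (C * (b + 1) + 1) ≤ C' * (C + 1) * (b + 1) := by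
      rw [mul_assoc]
      exact Nat.mul_le_mul_left _ (by nlinarith)
    exact ⟨_, .seq h1 h1', by nlinarith, h3'.mono (by nlinarith)⟩
  | ite c p q ihp ihq =>
    obtain ⟨C, hC⟩ := ihp hp.1
    obtain ⟨C', hC'⟩ := ihq hp.2
    obtain ⟨D, hD⟩ := c.exists_bound
    refine ⟨C + C' + D, fun b s hs => ?_⟩
    have hc := (hD b s hs).2
    by_cases h0 : c.eval s = 0
    · obtain ⟨t, h1, h2, h3⟩ := hC' b s hs
      simp only [Prog.run, h0, if_true]
      exact ⟨_, .ite_false h0 h1, by nlinarith, h3.mono (by nlinarith)⟩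
    · obtain ⟨t, h1, h2, h3⟩ := hC b s hs
      simp only [Prog.run, h0, if_false]
      exact ⟨_, .ite_true h0 h1, by nlinarith, h3.mono (by nlinarith)⟩
  | _ => exact hp.elim

/-- The arrays a program may change. -/
def Prog.writes : Prog → List ℕ
  | .skip => []
  | .assign a _ _ => [a]
  | .seq p q => p.writes ++ q.writes
  | .ite _ p q => p.writes ++ q.writes
  | .while _ p => p.writes

/-- Reduces all questions about untouched arrays to membership in explicit lists of numbers, which
`decide` settles for concrete programs. -/
theorem Exec.frame {p : Prog} {s s' : State} {t : ℕ} (h : Exec p s s' t) :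
    ∀ a, a ∉ p.writes → s' a = s a := by
  induction h with
  | skip s => exact fun _ _ => rfl
  | assign a i e s =>
    intro b hb
    simp only [Prog.writes, List.mem_singleton] at hb
    funext j
    simp [State.write, hb]
  | seq _ _ ih ih' =>
    intro b hb
    simp only [Prog.writes, List.mem_append, not_or] at hb
    rw [ih' b hb.2, ih b hb.1]
  | ite_true _ _ ih =>
    intro b hb
    simp only [Prog.writes, List.mem_append, not_or] at hb
    exact ih b hb.1
  | ite_false _ _ ih =>
    intro b hb
    simp only [Prog.writes, List.mem_append, not_or] at hb
    exact ih b hb.2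
  | while_true _ _ _ ih ih' =>
    intro b hb
    rw [ih' b hb, ih b hb]
  | while_false _ => exact fun _ _ => rfl

/-- `Runs sz P p Q`: started in a memory `s` with `P i s` and cells bounded by `2 ^ sz i`, the
program `p` halts, in time polynomial in `sz i`, in a memory `s'` with `Q i s s'` and cells
bounded by `2 ^ sz i`; arrays that are not assigned to are unchanged. -/
def Runs {ι : Type} (sz : ι → ℕ) (P : ι → State → Prop) (p : Prog)
    (Q : ι → State → State → Prop) : Prop :=
  ∃ N : Polynomial ℕ, ∀ i s, P i s → Bdd (sz i) s → ∃ s' t, Exec p s s' t ∧ t ≤ N.eval (sz i) ∧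
    Q i s s' ∧ Bdd (sz i) s' ∧ ∀ a, a ∉ p.writes → s' a = s a

variable {ι : Type} {sz : ι → ℕ}

theorem Runs.conseq {P P' : ι → State → Prop} {p : Prog} {Q Q' : ι → State → State → Prop}
    (h : Runs sz P p Q) (hP : ∀ i s, P' i s → P i s)
    (hQ : ∀ i s s', P' i s → Q i s s' → (∀ a, a ∉ p.writes → s' a = s a) → Bdd (sz i) s' →
      Q' i s s') :
    Runs sz P' p Q' := by
  obtain ⟨N, hN⟩ := h
  refine ⟨N, fun i s hi hs => ?_⟩
  obtain ⟨s', t, h1, h2, h3, h4, h5⟩ := hN i s (hP i s hi) hs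
  exact ⟨s', t, h1, h2, hQ i s s' hi h3 h5 h4, h4, h5⟩

theorem Runs.pre {P P' : ι → State → Prop} {p : Prog} {Q : ι → State → State → Prop}
    (h : Runs sz P p Q) (hP : ∀ i s, P' i s → P i s) : Runs sz P' p Q :=
  h.conseq hP fun _ _ _ _ h _ _ => h

/-- Change of the index type. -/
theorem Runs.comap {κ : Type} (f : κ → ι) {P : ι → State → Prop} {p : Prog}
    {Q : ι → State → State → Prop} (h : Runs sz P p Q) :
    Runs (fun k => sz (f k)) (fun k => P (f k)) p (fun k => Q (f k)) := by
  obtain ⟨N, hN⟩ := h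
  exact ⟨N, fun k s => hN (f k) s⟩

/-- The index may depend on the initial memory. -/
theorem Runs.choose_index {κ : Type} {sz' : κ → ℕ} {P : ι → State → Prop} {p : Prog}
    {Q : ι → State → State → Prop} (h : Runs sz P p Q) {P' : κ → State → Prop}
    {Q' : κ → State → State → Prop}
    (hP : ∀ k s, P' k s → ∃ i, sz i = sz' k ∧ P i s ∧
      ∀ s', Q i s s' → (∀ a, a ∉ p.writes → s' a = s a) → Bdd (sz i) s' → Q' k s s') :
    Runs sz' P' p Q' := by
  obtain ⟨N, hN⟩ := h
  refine ⟨N, fun k s hk hs => ?_⟩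
  obtain ⟨i, h1, h2, h3⟩ := hP k s hk
  rw [← h1] at hs ⊢
  obtain ⟨s', t, a1, a2, a3, a4, a5⟩ := hN i s h2 hs
  exact ⟨s', t, a1, a2, h3 s' a3 a5 a4, a4, a5⟩

/-- Execution, time and frame are automatic; what remains is the effect computed by `Prog.run`,
including the proof that the new contents still fit into `sz i` bits. -/
theorem Runs.straight {P : ι → State → Prop} {p : Prog} {Q : ι → State → State → Prop}
    (hp : p.LoopFree)
    (h : ∀ i s, P i s → Bdd (sz i) s → Q i s (p.run s) ∧ Bdd (sz i) (p.run s)) :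
    Runs sz P p Q := by
  obtain ⟨C, hC⟩ := hp.exec
  refine ⟨Polynomial.C C * (Polynomial.X + 1), fun i s hi hs => ?_⟩
  obtain ⟨t, h1, h2, _⟩ := hC _ s hs
  exact ⟨_, t, h1, by simpa using h2, (h i s hi hs).1, (h i s hi hs).2, h1.frame⟩

theorem Runs.seq {P R : ι → State → Prop} {p q : Prog} {Q Q' : ι → State → State → Prop}
    (hp : Runs sz P p Q) (hq : Runs sz R q Q')
    (h : ∀ i s s', P i s → Q i s s' → (∀ a, a ∉ p.writes → s' a = s a) → Bdd (sz i) s' → R i s') :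
    Runs sz P (.seq p q) (fun i s s'' => ∃ s', Q i s s' ∧ (∀ a, a ∉ p.writes → s' a = s a) ∧
      Q' i s' s'' ∧ (∀ a, a ∉ q.writes → s'' a = s' a)) := by
  obtain ⟨N, hN⟩ := hp
  obtain ⟨N', hN'⟩ := hq
  refine ⟨N + N', fun i s hi hs => ?_⟩
  obtain ⟨s', t, h1, h2, h3, h4, h5⟩ := hN i s hi hs
  obtain ⟨s'', t', h1', h2', h3', h4', h5'⟩ := hN' i s' (h i s s' hi h3 h5 h4) h4
  refine ⟨s'', t + t', .seq h1 h1', by simpa using Nat.add_le_add h2 h2', ⟨s', h3, h5, h3', h5'⟩,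
    h4', ?_⟩
  exact (Exec.seq h1 h1').frame

/-- Loops with a bound `k ≤ sz i` on the number of iterations. -/
theorem Runs.while {P : ι → State → Prop} {Inv : ι → State → ℕ → State → Prop} {c : Expr}
    {body : Prog} {Q : ι → State → State → Prop}
    (hinit : ∀ i s, P i s → Bdd (sz i) s → ∃ k ≤ sz i, Inv i s k s)
    (hbody : Runs (fun j : ι × State × ℕ => sz j.1)
      (fun j s => P j.1 j.2.1 ∧ Inv j.1 j.2.1 j.2.2 s ∧ c.eval s ≠ 0) body
      (fun j _ s' => ∃ k' < j.2.2, Inv j.1 j.2.1 k' s'))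
    (hQ : ∀ i s k s', P i s → Inv i s k s' → c.eval s' = 0 → Q i s s') :
    Runs sz P (.while c body) Q := by
  obtain ⟨N, hN⟩ := hbody
  obtain ⟨C, hC⟩ := c.exists_bound
  -- The natural number `k` in the invariant strictly decreases, hence bounds the number of
  -- remaining iterations; each costs at most one test and one execution of the body.
  have key : ∀ i s, P i s → ∀ k s', Inv i s k s' → Bdd (sz i) s' → ∃ s'' t,
      Exec (.while c body) s' s'' t ∧ t ≤ (k + 1) * (C * (sz i + 1) + N.eval (sz i)) ∧
      (∃ k', Inv i s k' s'') ∧ c.eval s'' = 0 ∧ Bdd (sz i) s'' := by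
    intro i s hi k
    induction k using Nat.strong_induction_on with
    | _ k ih =>
      intro s' hI hb
      have hc := (hC _ _ hb).2
      by_cases h0 : c.eval s' = 0
      · exact ⟨s', _, .while_false h0, by nlinarith, ⟨k, hI⟩, h0, hb⟩
      · obtain ⟨s₁, t₁, e₁, l₁, ⟨k', hk', I₁⟩, b₁, _⟩ := hN (i, s, k) s' ⟨hi, hI, h0⟩ hb
        obtain ⟨s₂, t₂, e₂, l₂, I₂, z₂, b₂⟩ := ih k' hk' s₁ I₁ b₁
        refine ⟨s₂, _, .while_true h0 e₁ e₂, ?_, I₂, z₂, b₂⟩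
        have : (k' + 1) * (C * (sz i + 1) + N.eval (sz i))
            ≤ k * (C * (sz i + 1) + N.eval (sz i)) := Nat.mul_le_mul_right _ hk'
        simp only at l₁
        linarith
  refine ⟨(Polynomial.X + 1) * (Polynomial.C C * (Polynomial.X + 1) + N), fun i s hi hs => ?_⟩
  obtain ⟨k, hk, hI⟩ := hinit i s hi hs
  obtain ⟨s', t, h1, h2, ⟨k', h3⟩, h4, h5⟩ := key i s hi k s hI hs
  refine ⟨s', t, h1, ?_, hQ i s k' s' hi h3 h4, h5, h1.frame⟩
  simp only [Polynomial.eval_mul, Polynomial.eval_add, Polynomial.eval_X, Polynomial.eval_one,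
    Polynomial.eval_C]
  exact h2.trans (Nat.mul_le_mul_right _ (by omega))

/-! ### Notation for expressions and programs -/

instance : Add Expr := ⟨.op .add⟩
instance : Sub Expr := ⟨.op .sub⟩
instance : Mul Expr := ⟨.op .mul⟩
instance : Div Expr := ⟨.op .div⟩

/-- The scalar variable stored in cell `0` of array `a`. -/
def Expr.var (a : ℕ) : Expr := .read a (.const 0)

/-- The absolute value of an expression. -/
def Expr.abs (e : Expr) : Expr := e - .const 2 * e * .op .lt e (.const 0)

/-- Assignment to a scalar variable. -/
def Prog.set (a : ℕ) (e : Expr) : Prog := .assign a (.const 0) e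

/-- `for c = 0, …, e - 1 do body` -/
def Prog.for (c : ℕ) (e : Expr) (body : Prog) : Prog :=
  .seq (.set c (.const 0))
    (.while (.op .lt (.var c) e) (.seq body (.set c (.var c + .const 1))))

section eval
variable (s : State) (e f : Expr)

@[simp] theorem Expr.eval_add : (e + f).eval s = e.eval s + f.eval s := rfl
@[simp] theorem Expr.eval_sub : (e - f).eval s = e.eval s - f.eval s := rfl
@[simp] theorem Expr.eval_mul : (e * f).eval s = e.eval s * f.eval s := rfl
@[simp] theorem Expr.eval_div : (e / f).eval s = e.eval s / f.eval s := rfl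
@[simp] theorem Expr.eval_const (z : ℤ) : (Expr.const z).eval s = z := rfl
@[simp] theorem Expr.eval_var (a : ℕ) : (Expr.var a).eval s = s a 0 := rfl
@[simp] theorem Expr.eval_read (a : ℕ) : (Expr.read a e).eval s = s a (e.eval s) := rfl
@[simp] theorem Expr.eval_op (o : Op) : (Expr.op o e f).eval s = o.eval (e.eval s) (f.eval s) :=
  rfl
@[simp] theorem Op.eval_lt_eq_zero (x y : ℤ) : Op.eval .lt x y = 0 ↔ y ≤ x := by
  simp [Op.eval]
@[simp] theorem Op.eval_eq_eq_zero (x y : ℤ) : Op.eval .eq x y = 0 ↔ x ≠ y := by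
  simp [Op.eval]
@[simp] theorem Expr.eval_abs : e.abs.eval s = |e.eval s| := by
  simp only [Expr.abs, eval_sub, eval_mul, eval_const, eval_op]
  rcases lt_or_ge (e.eval s) 0 with h | h
  · rw [abs_of_neg h, Op.eval, if_pos h]
    ring
  · rw [abs_of_nonneg h, Op.eval, if_neg (not_lt.2 h)]
    ring

end eval

@[simp] theorem Prog.run_skip (s : State) : Prog.skip.run s = s := rfl
@[simp] theorem Prog.run_assign (a : ℕ) (i e : Expr) (s : State) :
    (Prog.assign a i e).run s = s.write a (i.eval s) (e.eval s) := rfl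
@[simp] theorem Prog.run_set (a : ℕ) (e : Expr) (s : State) :
    (Prog.set a e).run s = s.write a 0 (e.eval s) := rfl
@[simp] theorem Prog.run_seq (p q : Prog) (s : State) : (Prog.seq p q).run s = q.run (p.run s) :=
  rfl
@[simp] theorem Prog.run_ite (b : Expr) (p q : Prog) (s : State) :
    (Prog.ite b p q).run s = if b.eval s = 0 then q.run s else p.run s := rfl

theorem Prog.run_ite_zero {b : Expr} {s : State} (h : b.eval s = 0) (p q : Prog) :
    (Prog.ite b p q).run s = q.run s := if_pos h

theorem Prog.run_ite_ne {b : Expr} {s : State} (h : b.eval s ≠ 0) (p q : Prog) :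
    (Prog.ite b p q).run s = p.run s := if_neg h

theorem State.write_apply (s : State) (a : ℕ) (i v : ℤ) (b : ℕ) (j : ℤ) :
    s.write a i v b j = if b = a ∧ j = i then v else s b j := rfl

theorem State.write_of_ne (s : State) {a b : ℕ} (i v : ℤ) (h : b ≠ a) :
    s.write a i v b = s b := by
  funext j
  simp [State.write, h]

@[simp] theorem State.write_same (s : State) (a : ℕ) (i v : ℤ) : s.write a i v a i = v := by
  simp [State.write]

/-- Counting loops.  The invariant may not depend on the counter itself. -/
theorem Runs.for {P : ι → State → Prop} {Inv : ι → State → ℕ → State → Prop}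
    {Q : ι → State → State → Prop} (N : ι → State → ℕ) {c : ℕ} {e : Expr} {body : Prog}
    (hN : ∀ i s, P i s → Bdd (sz i) s → N i s ≤ sz i)
    (hinit : ∀ i s s', P i s → (∀ a, a ≠ c → s' a = s a) → s' c 0 = 0 → Inv i s 0 s')
    (hcong : ∀ i s k s₁ s₂, P i s → (∀ a, a ≠ c → s₂ a = s₁ a) → Inv i s k s₁ → Inv i s k s₂)
    (he : ∀ i s k s', P i s → Inv i s k s' → k ≤ N i s → s' c 0 = k → e.eval s' = N i s)
    (hbody : Runs (fun j : ι × State × ℕ => sz j.1)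
      (fun j s => P j.1 j.2.1 ∧ Inv j.1 j.2.1 j.2.2 s ∧ s c 0 = j.2.2 ∧ j.2.2 < N j.1 j.2.1) body
      (fun j _ s' => Inv j.1 j.2.1 (j.2.2 + 1) s' ∧ s' c 0 = j.2.2))
    (hQ : ∀ i s s', P i s → Inv i s (N i s) s' → Q i s s') :
    Runs sz P (.for c e body) Q := by
  have h1 : Runs sz P (.set c (.const 0)) (fun i s s' => s' = s.write c 0 0) := by
    refine Runs.straight trivial fun i s _ hs => ⟨rfl, hs.write _ _ ?_⟩
    simp
  have hcnt : ∀ {j : ι × State × ℕ}, j.2.2 < N j.1 j.2.1 → N j.1 j.2.1 ≤ sz j.1 →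
      |((j.2.2 + 1 : ℕ) : ℤ)| ≤ 2 ^ sz j.1 := by
    intro j h h'
    rw [abs_of_nonneg (by positivity)]
    exact_mod_cast (show j.2.2 + 1 ≤ sz j.1 by omega).trans Nat.lt_two_pow_self.le
  have h2 : Runs (fun j : ι × State × ℕ => sz j.1)
      (fun j s => P j.1 j.2.1 ∧ N j.1 j.2.1 ≤ sz j.1 ∧ Inv j.1 j.2.1 j.2.2 s ∧ s c 0 = j.2.2 ∧
        j.2.2 < N j.1 j.2.1)
      (.seq body (.set c (.var c + .const 1)))
      (fun j _ s' => Inv j.1 j.2.1 (j.2.2 + 1) s' ∧ s' c 0 = (j.2.2 + 1 : ℕ)) := by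
    have hb : Runs (fun j : ι × State × ℕ => sz j.1)
        (fun j s => P j.1 j.2.1 ∧ N j.1 j.2.1 ≤ sz j.1 ∧ Inv j.1 j.2.1 j.2.2 s ∧ s c 0 = j.2.2 ∧
          j.2.2 < N j.1 j.2.1) body
        (fun j _ s' => Inv j.1 j.2.1 (j.2.2 + 1) s' ∧ s' c 0 = j.2.2) :=
      hbody.conseq (fun i s h => ⟨h.1, h.2.2⟩) (fun i s s' _ h _ _ => h)
    have hi : Runs (fun j : ι × State × ℕ => sz j.1)
        (fun j s => P j.1 j.2.1 ∧ N j.1 j.2.1 ≤ sz j.1 ∧ j.2.2 < N j.1 j.2.1 ∧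
          Inv j.1 j.2.1 (j.2.2 + 1) s ∧ s c 0 = j.2.2)
        (.set c (.var c + .const 1))
        (fun j _ s' => Inv j.1 j.2.1 (j.2.2 + 1) s' ∧ s' c 0 = (j.2.2 + 1 : ℕ)) := by
      refine Runs.straight trivial fun j s h hs => ?_
      obtain ⟨hP, hN', hlt, hI, hc⟩ := h
      simp only [Prog.run_set, Expr.eval_add, Expr.eval_var, Expr.eval_const, hc]
      refine ⟨⟨hcong _ _ _ _ _ hP (fun a ha => State.write_of_ne _ _ _ ha) hI, by simp⟩,
        hs.write _ _ ?_⟩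
      exact_mod_cast hcnt hlt hN'
    refine (hb.seq hi ?_).conseq (fun _ _ h => h) ?_
    · rintro j s s' h h' - -
      exact ⟨h.1, h.2.1, h.2.2.2.2, h'⟩
    · rintro j s s' - ⟨s₁, -, -, h, -⟩ - -
      exact h
  -- The index now carries the memory from before the counter was reset, since `N` and `Inv` refer
  -- to that memory while the rule for `while` only sees the memory after the reset. The decreasing
  -- quantity is `N - k`.
  have h3 : Runs (fun j : ι × State => sz j.1)
      (fun j s => P j.1 j.2 ∧ N j.1 j.2 ≤ sz j.1 ∧ s = j.2.write c 0 0)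
      (.while (.op .lt (.var c) e) (.seq body (.set c (.var c + .const 1))))
      (fun j _ s' => Inv j.1 j.2 (N j.1 j.2) s') := by
    refine Runs.while (Inv := fun j _ r s' => ∃ k, k ≤ N j.1 j.2 ∧ r = N j.1 j.2 - k ∧
      s' c 0 = k ∧ Inv j.1 j.2 k s') ?_ ?_ ?_
    · rintro j s ⟨hP, hN', rfl⟩ -
      refine ⟨N j.1 j.2, hN', 0, Nat.zero_le _, rfl, by simp,
        hinit _ _ _ hP (fun a ha => State.write_of_ne _ _ _ ha) (by simp)⟩
    · refine Runs.choose_index h2 ?_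
      rintro ⟨⟨i, s₀⟩, s₁, r⟩ s ⟨⟨hP, hN', -⟩, ⟨k, hk, hr, hc, hI⟩, hlt⟩
      simp only at hP hN' hk hr hc hI
      have hev := he _ _ _ _ hP hI hk hc
      simp only [Expr.eval_op, Expr.eval_var, hev, hc, ne_eq, Op.eval_lt_eq_zero] at hlt
      have hlt' : k < N i s₀ := by exact_mod_cast not_le.1 hlt
      refine ⟨(i, s₀, k), rfl, ⟨hP, hN', hI, hc, hlt'⟩, fun s' h _ _ => ?_⟩
      exact ⟨N i s₀ - (k + 1), by simp only; omega, k + 1, hlt', rfl, h.2, h.1⟩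
    · rintro j s r s' ⟨hP, hN', -⟩ ⟨k, hk, -, hc, hI⟩ h0
      have hev := he _ _ _ _ hP hI hk hc
      simp only [Expr.eval_op, Expr.eval_var, hev, hc, Op.eval_lt_eq_zero] at h0
      obtain rfl : k = N j.1 j.2 := by omega
      exact hI
  obtain ⟨N₁, hN₁⟩ := h1
  obtain ⟨N₃, hN₃⟩ := h3
  refine ⟨N₁ + N₃, fun i s hi hs => ?_⟩
  obtain ⟨s₁, t₁, e₁, l₁, rfl, b₁, -⟩ := hN₁ i s hi hs
  obtain ⟨s₂, t₂, e₂, l₂, I₂, b₂, -⟩ := hN₃ (i, s) _ ⟨hi, hN i s hi hs, rfl⟩ b₁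
  exact ⟨s₂, t₁ + t₂, .seq e₁ e₂, by simpa using Nat.add_le_add l₁ l₂, hQ i s s₂ hi I₂, b₂,
    (Exec.seq e₁ e₂).frame⟩

end RAM

/-! ### Diagonally dominant matrices -/

namespace Matrix

/-- A matrix with unit diagonal whose off-diagonal row sums are at most `1 / 2`
has determinant at least `2⁻ⁿ`. -/
theorem norm_det_ge_of_sum_row_le {ι : Type*} [Fintype ι] [DecidableEq ι] (A : Matrix ι ι ℂ)
    (hd : ∀ i, A i i = 1) (hs : ∀ i, ∑ j ∈ Finset.univ.erase i, ‖A i j‖ ≤ 1 / 2) :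
    (1 / 2 : ℝ) ^ Fintype.card ι ≤ ‖A.det‖ := by
  -- Gershgorin: every eigenvalue lies within distance `1 / 2` of a diagonal entry, which is `1`.
  -- Over `ℂ` the determinant is the product of all eigenvalues.
  have hroot : ∀ μ ∈ A.charpoly.roots, (1 / 2 : ℝ) ≤ ‖μ‖ := by
    intro μ hμ
    have h1 : Module.End.HasEigenvalue (Matrix.toLin' A) μ := by
      rw [Module.End.hasEigenvalue_iff_isRoot_charpoly, Matrix.charpoly_toLin']
      exact (Polynomial.mem_roots'.1 hμ).2
    obtain ⟨k, hk⟩ := eigenvalue_mem_ball h1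
    rw [mem_closedBall_iff_norm, hd] at hk
    have h2 : ‖(1 : ℂ)‖ - ‖μ - 1‖ ≤ ‖μ‖ := by
      have := norm_sub_norm_le (1 : ℂ) (1 - μ)
      rw [norm_sub_rev μ 1]
      simpa using this
    rw [norm_one] at h2
    linarith [hs k]
  have hcard : Multiset.card A.charpoly.roots = Fintype.card ι := by
    rw [← A.charpoly_natDegree_eq_dim]
    exact (IsAlgClosed.splits A.charpoly).natDegree_eq_card_roots.symm
  rw [det_eq_prod_roots_charpoly, ← hcard]
  generalize A.charpoly.roots = R at hroot
  induction R using Multiset.induction with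
  | empty => simp
  | cons a R ih =>
    rw [Multiset.card_cons, Multiset.prod_cons, norm_mul, pow_succ, mul_comm]
    exact mul_le_mul (hroot a (Multiset.mem_cons_self a R))
      (ih fun μ h => hroot μ (Multiset.mem_cons_of_mem h)) (by positivity) (norm_nonneg _)

/-- A real matrix that is diagonally dominant after scaling with positive weights `y`. -/
theorem abs_det_ge_of_weighted_dominant {ι : Type*} [Fintype ι] [DecidableEq ι]
    (A : Matrix ι ι ℝ) (y : ι → ℝ) (hy : ∀ i, 0 < y i) (hd : ∀ i, A i i ≠ 0)
    (hs : ∀ i, ∑ j ∈ Finset.univ.erase i, |A i j| / |A i i| * (y j / y i) ≤ 1 / 2) :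
    (∏ i, |A i i|) * (1 / 2 : ℝ) ^ Fintype.card ι ≤ |A.det| := by
  -- Conjugation by the diagonal matrix of the `y i` together with division of each row by its
  -- diagonal entry; the weights cancel in the determinant.
  set N : Matrix ι ι ℝ := Matrix.of fun i j => (A i i)⁻¹ * (y i)⁻¹ * (A i j * y j) with hN
  have hdet : N.det = (∏ i, (A i i)⁻¹) * A.det := by
    have e1 : N = Matrix.of fun i j => ((A i i)⁻¹ * (y i)⁻¹) *
        (Matrix.of fun i j => y j * A i j) i j := by
      ext i j
      simp [hN, mul_comm]
    rw [e1, Matrix.det_mul_column, Matrix.det_mul_row, Finset.prod_mul_distrib,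
      Finset.prod_inv_distrib (f := y)]
    have : (∏ i, y i) ≠ 0 := Finset.prod_ne_zero_iff.2 fun i _ => (hy i).ne'
    field_simp
  have h := norm_det_ge_of_sum_row_le (N.map (algebraMap ℝ ℂ)) (fun i => by
      have := hd i
      have := (hy i).ne'
      simp only [hN, map_apply, of_apply]
      rw [show (A i i)⁻¹ * (y i)⁻¹ * (A i i * y i) = 1 by field_simp]
      simp) (fun i => by
      refine le_trans (le_of_eq (Finset.sum_congr rfl fun j _ => ?_)) (hs i)
      simp only [hN, map_apply, of_apply, norm_algebraMap', Real.norm_eq_abs, abs_mul, abs_inv,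
        abs_of_pos (hy i), abs_of_pos (hy j)]
      field_simp)
  rw [← RingHom.mapMatrix_apply, ← RingHom.map_det, norm_algebraMap', Real.norm_eq_abs, hdet,
    abs_mul, Finset.abs_prod] at h
  have hp : 0 < ∏ i, |A i i| := Finset.prod_pos fun i _ => abs_pos.2 (hd i)
  have e : ∏ i, |(A i i)⁻¹| = (∏ i, |A i i|)⁻¹ := by
    simp [abs_inv, Finset.prod_inv_distrib]
  rw [e] at h
  calc _ ≤ (∏ i, |A i i|) * ((∏ i, |A i i|)⁻¹ * |A.det|) :=
        mul_le_mul_of_nonneg_left h hp.le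
    _ = |A.det| := by
      field_simp

end Matrix

/-! ### Bases and their tableaux -/

namespace DetMax

open Finset Function
open scoped Matrix

variable {d m : ℕ} (X : Fin m → Fin d → ℤ)

/-- The determinant of the vectors selected by `b`. -/
def bdet (b : Fin d → Fin m) : ℤ := (Matrix.of fun r => X (b r)).det

/-- The determinant after replacing the vector in row `s` by the vector `e`. -/
def tab (b : Fin d → Fin m) (s : Fin d) (e : Fin m) : ℤ := bdet X (update b s e)

theorem bdet_update (b : Fin d → Fin m) (s : Fin d) (e : Fin m) :
    bdet X (update b s e) = ((Matrix.of fun r => X (b r)).updateRow s (X e)).det := by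
  unfold bdet
  congr 1
  ext r j
  by_cases h : r = s
  · subst h
    simp
  · simp [h]

/-- Cramer's rule. -/
theorem bdet_smul (b : Fin d → Fin m) (e : Fin m) :
    bdet X b • X e = ∑ k, tab X b k e • X (b k) := by
  have h := Matrix.mulVec_cramer (Matrix.of fun r => X (b r))ᵀ (X e)
  rw [Matrix.det_transpose] at h
  unfold tab
  simp only [bdet_update]
  rw [bdet, ← h]
  ext j
  simp [Matrix.mulVec, dotProduct, Matrix.cramer_transpose_apply, mul_comm]

/-- A determinant is linear in row `s`; apply this linear form, with the other rows taken from `c`,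
to Cramer's expansion of `X e` in the basis `b`. This is a Plücker relation. -/
theorem bdet_mul_bdet_update (b c : Fin d → Fin m) (s : Fin d) (e : Fin m) :
    bdet X b * bdet X (update c s e) = ∑ k, tab X b k e * bdet X (update c s (b k)) := by
  simp only [bdet_update]
  simp only [← Matrix.cramer_transpose_apply]
  have h := congrArg (fun u => (Matrix.of fun r => X (c r))ᵀ.cramer u s) (bdet_smul X b e)
  simpa only [map_smul, map_sum, Finset.sum_apply, Pi.smul_apply, smul_eq_mul] using h

theorem bdet_update_self (b : Fin d → Fin m) (s : Fin d) :
    bdet X (update b s (b s)) = bdet X b := by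
  rw [update_eq_self]

theorem tab_self (b : Fin d → Fin m) (k r : Fin d) :
    tab X b k (b r) = if k = r then bdet X b else 0 := by
  unfold tab
  split_ifs with h
  · rw [h, bdet_update_self]
  · exact Matrix.det_zero_of_row_eq h (by ext; simp [update_of_ne (Ne.symm h)])

/-- The pivot rule. -/
theorem bdet_mul_tab_update (b : Fin d → Fin m) {r s : Fin d} (hs : s ≠ r) (v e : Fin m) :
    bdet X b * tab X (update b r v) s e
      = tab X b s e * tab X b r v - tab X b s v * tab X b r e := by
  -- In the expansion with `c = update b r v`, every `k` other than `s` and `r` produces two equal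
  -- rows. The term `k = s` undoes the second replacement, and `k = r` gives a basis with two rows
  -- swapped.
  rw [tab, bdet_mul_bdet_update, ← sum_subset (subset_univ {s, r}), sum_pair hs]
  · have h1 : bdet X (update (update b r v) s (b s)) = tab X b r v := by
      rw [update_comm hs.symm, update_eq_self, tab]
    have h2 : bdet X (update (update b r v) s (b r)) = - tab X b s v := by
      have e : (update (update b r v) s (b r)) = update b s v ∘ Equiv.swap s r := by
        funext x
        by_cases h1 : x = s
        · subst h1
          simp [update_of_ne (Ne.symm hs)]
        · by_cases h2 : x = r
          · subst h2
            simp [update_of_ne (Ne.symm hs)]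
          · simp [h1, h2, Equiv.swap_apply_of_ne_of_ne h1 h2]
      have := Matrix.det_permute (Equiv.swap s r) (Matrix.of fun x => X (update b s v x))
      rw [Equiv.Perm.sign_swap hs] at this
      rw [e, tab, bdet, bdet]
      simpa [Matrix.submatrix] using this
    rw [h1, h2]
    ring
  · intro k _ hk
    simp only [mem_insert, mem_singleton, not_or] at hk
    have : bdet X (update (update b r v) s (b k)) = 0 :=
      Matrix.det_zero_of_row_eq (i := s) (j := k) (Ne.symm hk.1) (by ext; simp [hk.1, hk.2])
    rw [this, mul_zero]

theorem tab_update_same (b : Fin d → Fin m) (r : Fin d) (v e : Fin m) :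
    tab X (update b r v) r e = tab X b r e := by
  simp [tab]

/-- Cramer's rule for all rows of `c` at once says that the tableau matrix times the matrix of `b`
is `bdet X b` times the matrix of `c`; take determinants. The common factor is kept, so that nothing
need be assumed nonzero. -/
theorem bdet_pow_mul_bdet (b c : Fin d → Fin m) :
    bdet X b ^ d * bdet X c = (Matrix.of fun r k => tab X b k (c r)).det * bdet X b := by
  have h : (Matrix.of fun r k => tab X b k (c r)) * (Matrix.of fun r => X (b r))
      = bdet X b • (Matrix.of fun r => X (c r)) := by
    ext r j
    have := congrFun (bdet_smul X b (c r)) j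
    simpa [Matrix.mul_apply] using this.symm
  rw [bdet, bdet, ← Matrix.det_mul, h, Matrix.det_smul, Fintype.card_fin]
  rfl

/-- Replacing the rows `ρ i` amounts to a minor of the tableau. -/
theorem bdet_pow_mul_bdet_of_injective {ι : Type*} [Fintype ι] [DecidableEq ι]
    (b c : Fin d → Fin m) (ρ : ι → Fin d) (hρ : Injective ρ) (hc : ∀ r, r ∉ Set.range ρ → c r = b r)
    (hb : bdet X b ≠ 0) :
    bdet X b ^ Fintype.card ι * bdet X c
      = (Matrix.of fun i k => tab X b (ρ k) (c (ρ i))).det * bdet X b := by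
  classical
  obtain ⟨p, hp⟩ : ∃ p : Fin d → Prop, ∀ r, p r ↔ r ∈ Set.range ρ := ⟨_, fun _ => Iff.rfl⟩
  have h := bdet_pow_mul_bdet X b c
  -- Unreplaced rows contribute `bdet X b` times a unit row, so the tableau matrix is block
  -- triangular; the surplus powers of `bdet X b` cancel at the end.
  rw [Matrix.twoBlockTriangular_det _ p] at h
  rotate_left
  · rintro i hi j hj
    rw [hp] at hi hj
    rw [Matrix.of_apply, hc i hi, tab_self, if_neg]
    rintro rfl
    exact hi hj
  let e : ι ≃ {r // p r} := (Equiv.ofInjective ρ hρ).trans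
    (Equiv.subtypeEquivRight fun r => (hp r).symm)
  have h1 : (Matrix.toSquareBlockProp (Matrix.of fun r k => tab X b k (c r)) p).det
      = (Matrix.of fun i k => tab X b (ρ k) (c (ρ i))).det := by
    rw [← Matrix.det_submatrix_equiv_self e]
    rfl
  have h2 : (Matrix.toSquareBlockProp (Matrix.of fun r k => tab X b k (c r)) fun r => ¬ p r)
      = bdet X b • 1 := by
    ext ⟨i, hi⟩ ⟨j, hj⟩
    rw [Matrix.toSquareBlockProp_def, Matrix.of_apply, Matrix.of_apply, hc i (mt (hp i).2 hi),
      tab_self, Matrix.smul_apply, Matrix.one_apply]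
    simp [Subtype.mk.injEq, eq_comm]
  have h3 : d = Fintype.card ι + Fintype.card {r : Fin d // ¬ p r} := by
    have e1 := Fintype.card_subtype_compl p
    have e2 := Fintype.card_congr e
    have e3 := Fintype.card_subtype_le p
    rw [Fintype.card_fin] at e1 e3
    omega
  rw [h1, h2, Matrix.det_smul, Matrix.det_one, mul_one] at h
  have h4 : bdet X b ^ d = bdet X b ^ Fintype.card ι *
      bdet X b ^ Fintype.card {r : Fin d // ¬ p r} := by
    rw [← pow_add, ← h3]
  rw [h4] at h
  refine mul_left_cancel₀
    (pow_ne_zero (Fintype.card {r : Fin d // ¬ p r}) hb) ?_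
  linear_combination h

theorem abs_bdet_le {H : ℤ} (hX : ∀ e j, |X e j| ≤ H) (b : Fin d → Fin m) :
    |bdet X b| ≤ d.factorial * H ^ d := by
  have := Matrix.det_le (A := Matrix.of fun r => X (b r)) (abv := AbsoluteValue.abs) (x := H)
    (fun i j => hX _ _)
  simpa [bdet, nsmul_eq_mul] using this

end DetMax

/-! ### The exchange graph, and the minor belonging to a shortest closed walk above its threshold -/

namespace DetMax

open Finset Function

variable {d m : ℕ} (X : Fin m → Fin d → ℤ) (part : Fin m → Fin d)

/-- The largest tableau entry in row `s` among the elements in the part of row `r`. -/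
def wgt (b : Fin d → Fin m) (r s : Fin d) : ℕ :=
  (univ.filter fun e => part e = part (b r)).sup fun e => (tab X b s e).natAbs

/-- The largest weight of a walk of given length. -/
def walk (W : Fin d → Fin d → ℕ) : ℕ → Fin d → Fin d → ℕ
  | 0, i, j => if i = j then 1 else 0
  | l + 1, i, j => univ.sup fun k => walk W l i k * W k j

/-- The bound on the weight of closed walks of length `l`. -/
def thr (b : Fin d → Fin m) (l : ℕ) : ℕ := (d * l ^ 3 * (bdet X b).natAbs) ^ l

/-- No closed walk in the exchange graph has too large a weight. -/
def LocallyOptimal (b : Fin d → Fin m) : Prop :=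
  ∀ l, 1 ≤ l → l ≤ d → ∀ i, walk (wgt X part b) l i i ≤ thr X b l

theorem natAbs_tab_le_wgt {b : Fin d → Fin m} {r s : Fin d} {e : Fin m}
    (h : part e = part (b r)) : (tab X b s e).natAbs ≤ wgt X part b r s :=
  le_sup (f := fun e => (tab X b s e).natAbs) (by simp [h])

theorem walk_mul_le (W : Fin d → Fin d → ℕ) (l : ℕ) (i k j : Fin d) :
    walk W l i k * W k j ≤ walk W (l + 1) i j :=
  le_sup (f := fun k => walk W l i k * W k j) (mem_univ k)

/-- The sequence `g` lists the walk from its end to its start. This is the order in which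
predecessor pointers are followed, and it matches exchanges in which the element entering row `g k`
comes from the part of row `g (k + 1)`. -/
theorem prod_le_walk (W : Fin d → Fin d → ℕ) (g : ℕ → Fin d) (a : ℕ) : ∀ x,
    ∏ k ∈ range a, W (g (x + k + 1)) (g (x + k)) ≤ walk W a (g (x + a)) (g x) := by
  induction a with
  | zero => simp [walk]
  | succ a ih =>
    intro x
    rw [prod_range_succ']
    have h := ih (x + 1)
    refine le_trans ?_ (walk_mul_le W a _ (g (x + 1)) _)
    refine Nat.mul_le_mul ?_ le_rfl
    convert h using 1
    · refine prod_congr rfl fun k _ => ?_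
      rw [show x + (k + 1) = x + 1 + k by ring]
    · rw [show x + (a + 1) = x + 1 + a by ring]

/-- The bases obtained by exchanging along a walk. -/
def pivots (b : Fin d → Fin m) (g : ℕ → Fin d) (η : ℕ → Fin m) : ℕ → Fin d → Fin m
  | 0 => b
  | k + 1 => update (pivots b g η k) (g k) (η k)

theorem pivots_congr (b : Fin d → Fin m) {g g' : ℕ → Fin d} {η η' : ℕ → Fin m} {k : ℕ}
    (hg : ∀ x < k, g x = g' x) (hη : ∀ x < k, η x = η' x) : pivots b g η k = pivots b g' η' k := by
  induction k with
  | zero => rfl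
  | succ k ih =>
    rw [pivots, pivots, ih (fun x hx => hg x (by omega)) (fun x hx => hη x (by omega)),
      hg k (by omega), hη k (by omega)]

theorem pivots_apply (b : Fin d → Fin m) {g : ℕ → Fin d} (η : ℕ → Fin m) {k : ℕ}
    (hg : ∀ x < k, ∀ y < k, g x = g y → x = y) {x : ℕ} (hx : x < k) :
    pivots b g η k (g x) = η x := by
  induction k with
  | zero => omega
  | succ k ih =>
    rw [pivots]
    by_cases h : x = k
    · subst h
      simp
    · rw [update_of_ne, ih (fun x hx y hy => hg x (by omega) y (by omega)) (by omega)]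
      intro hcon
      exact h (hg x hx k (by omega) hcon)

theorem pivots_of_notMem (b : Fin d → Fin m) {g : ℕ → Fin d} (η : ℕ → Fin m) {k : ℕ} {r : Fin d}
    (hr : ∀ x < k, g x ≠ r) : pivots b g η k r = b r := by
  induction k with
  | zero => rfl
  | succ k ih =>
    rw [pivots, update_of_ne (hr k (by omega)).symm, ih fun x hx => hr x (by omega)]

/-- Telescoping, since `1 / (l + 1)³ ≤ 1 / (2 l (l + 1))`. The cube in the thresholds is what yields
this total of at most `1 / 2`, as the Gershgorin bound requires. -/
theorem sum_inv_cube_le (l : ℕ) (hl : 1 ≤ l) :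
    ∑ j ∈ Ico 1 l, (1 : ℝ) / ((j : ℝ) + 1) ^ 3 ≤ 1 / 2 * (1 - 1 / (l : ℝ)) := by
  induction l, hl using Nat.le_induction with
  | base => simp
  | succ l hl ih =>
    rw [sum_Ico_succ_top hl]
    have h0 : (0 : ℝ) < l := by exact_mod_cast hl
    have : (1 : ℝ) / ((l : ℝ) + 1) ^ 3 ≤ 1 / 2 * (1 / (l : ℝ) - 1 / ((l : ℝ) + 1)) := by
      have e : (1 : ℝ) / 2 * (1 / (l : ℝ) - 1 / ((l : ℝ) + 1)) = 1 / (2 * l * (l + 1)) := by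
        field_simp
        ring
      rw [e]
      apply one_div_le_one_div_of_le (by positivity)
      nlinarith [mul_pos h0 h0]
    push_cast
    linarith

/-- By Bernoulli's inequality. -/
theorem div_pow_le_inv {a l : ℕ} (ha : 1 ≤ a) (hal : a ≤ l) :
    ((a : ℝ) / l) ^ a ≤ 1 / ((l - a : ℕ) + 1 : ℝ) := by
  have ha' : (0 : ℝ) < a := by exact_mod_cast ha
  have hl' : (0 : ℝ) < l := by exact_mod_cast ha.trans hal
  -- Applied to `(l / a)^a = (1 + (l - a) / a)^a ≥ 1 + (l - a)`.
  have h := one_add_mul_le_pow (a := ((l : ℝ) - a) / a) (by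
    have : (0 : ℝ) ≤ ((l : ℝ) - a) / a := div_nonneg (by
      rw [sub_nonneg]
      exact_mod_cast hal) ha'.le
    linarith) a
  have e1 : 1 + (a : ℝ) * (((l : ℝ) - a) / a) = (l - a : ℕ) + 1 := by
    rw [Nat.cast_sub hal]
    field_simp
    ring
  have e2 : 1 + ((l : ℝ) - a) / a = l / a := by
    field_simp
    ring
  rw [e1, e2] at h
  rw [← inv_div, inv_pow, ← one_div]
  exact one_div_le_one_div_of_le (by positivity) h

section cycle

variable {X part} {b : Fin d → Fin m} {l : ℕ} {g : ℕ → Fin d} {η : ℕ → Fin m}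

theorem prod_shift {M : Type*} [CommMonoid M] {f : ℕ → M} (hf : ∀ x, f (x + l) = f x) (x : ℕ) :
    ∏ k ∈ range l, f (x + k) = ∏ k ∈ range l, f k := by
  induction x with
  | zero => simp
  | succ x ih =>
    rw [← ih]
    cases l with
    | zero => simp
    | succ n =>
      rw [prod_range_succ, prod_range_succ' (fun k => f (x + k))]
      congr 1
      · exact prod_congr rfl fun k _ => by rw [show x + (k + 1) = x + 1 + k by ring]
      · rw [← hf (x + 0)]
        congr 1
        ring

/-- A shortest closed walk of large weight is a cycle. -/
theorem injOn_of_minimal (hgl : ∀ x, g (x + l) = g x)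
    (hmin : ∀ a, 1 ≤ a → a < l → ∀ i, walk (wgt X part b) a i i ≤ thr X b a)
    (hP : thr X b l < ∏ k ∈ range l, wgt X part b (g (k + 1)) (g k)) :
    ∀ x < l, ∀ y < l, g x = g y → x = y := by
  -- A repeated vertex splits the closed walk, rotated so as to start there, into two shorter closed
  -- walks, each within its threshold.
  have key : ∀ x y, x < y → y < l → g x ≠ g y := by
    intro x y hxy hy h
    set f : ℕ → ℕ := fun k => wgt X part b (g (k + 1)) (g k) with hf
    have hfl : ∀ x, f (x + l) = f x := by
      intro x
      simp only [hf]
      rw [show x + l + 1 = x + 1 + l by ring, hgl, hgl]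
    rw [← prod_shift hfl x] at hP
    obtain ⟨a, rfl⟩ := Nat.exists_eq_add_of_le hxy.le
    obtain ⟨c, rfl⟩ := Nat.exists_eq_add_of_le (show a ≤ l by omega)
    have h1 : ∏ k ∈ range a, f (x + k) ≤ thr X b a := by
      refine le_trans (prod_le_walk (wgt X part b) g a x) ?_
      rw [← h]
      exact hmin a (by omega) (by omega) _
    have h2 : ∏ k ∈ range c, f (x + (a + k)) ≤ thr X b c := by
      simp only [← add_assoc]
      refine le_trans (prod_le_walk (wgt X part b) g c (x + a)) ?_
      rw [add_assoc, hgl, h]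
      exact hmin c (by omega) (by omega) _
    rw [prod_range_add] at hP
    -- The base `d l³ N` increases with the length, so merging two walks only raises the threshold.
    have h3 : thr X b a * thr X b c ≤ thr X b (a + c) := by
      unfold thr
      rw [pow_add]
      gcongr <;> omega
    exact absurd (hP.trans_le ((Nat.mul_le_mul h1 h2).trans h3)) (lt_irrefl _)
  intro x hx y hy h
  rcases lt_trichotomy x y with h1 | h1 | h1
  · exact (key x y h1 hy h).elim
  · exact h1
  · exact (key y x h1 hx h.symm).elim

/-- The exchange along a shortest closed walk of large weight: the tableau minors that occur
are diagonally dominant. -/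
theorem minor_ge (hb : bdet X b ≠ 0) (hl : 1 ≤ l) (hgl : ∀ x, g (x + l) = g x)
    (hη : ∀ x, part (η x) = part (b (g (x + 1))))
    (hηw : ∀ x, (tab X b (g x) (η x)).natAbs = wgt X part b (g (x + 1)) (g x))
    (hmin : ∀ a, 1 ≤ a → a < l → ∀ i, walk (wgt X part b) a i i ≤ thr X b a)
    (hP : thr X b l < ∏ k ∈ range l, wgt X part b (g (k + 1)) (g k)) {κ : ℕ} (hκ : κ ≤ l) :
    (∏ k ∈ range κ, (wgt X part b (g (k + 1)) (g k) : ℝ)) * (1 / 2) ^ κ * |(bdet X b : ℝ)|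
      ≤ |(bdet X b : ℝ)| ^ κ * |(bdet X (pivots b g η κ) : ℝ)| ∧
    0 < ∏ k ∈ range κ, (wgt X part b (g (k + 1)) (g k) : ℝ) := by
  have hinj := injOn_of_minimal hgl hmin hP
  set N : ℝ := |(bdet X b : ℝ)| with hN
  have hN0 : 0 < N := abs_pos.2 (by exact_mod_cast hb)
  have hNn : ((bdet X b).natAbs : ℝ) = N := by
    rw [hN, Nat.cast_natAbs, Int.cast_abs]
  set w : ℕ → ℝ := fun k => (wgt X part b (g (k + 1)) (g k) : ℝ) with hw
  have hwl : ∀ x, w (x + l) = w x := by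
    intro x
    simp only [hw]
    rw [show x + l + 1 = x + 1 + l by ring, hgl, hgl]
  set P : ℝ := ∏ k ∈ range l, w k with hPdef
  have hPN : ((d : ℝ) * l ^ 3 * N) ^ l < P := by
    have := (Nat.cast_lt (α := ℝ)).2 hP
    rw [thr] at this
    push_cast at this
    rwa [hNn] at this
  have hP0 : 0 < P := lt_of_le_of_lt (by positivity) hPN
  have hw0 : ∀ k, 0 < w k := by
    intro k
    have h1 : 0 < w (k % l) := by
      refine lt_of_le_of_ne (Nat.cast_nonneg _) fun h => ?_
      exact hP0.ne' (prod_eq_zero (mem_range.2 (Nat.mod_lt k hl)) h.symm)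
    have h2 : ∀ q r, w (r + l * q) = w r := by
      intro q
      induction q with
      | zero => simp
      | succ q ih =>
        intro r
        rw [mul_add, mul_one, ← add_assoc, hwl, ih]
    rw [← Nat.mod_add_div k l, h2]
    exact h1
  have hprod : 0 < ∏ k ∈ range κ, w k := prod_pos fun k _ => hw0 k
  refine ⟨?_, hprod⟩
  -- The geometric mean of the edge weights; exceeding the threshold means precisely that it is
  -- larger than `d l³ N`.
  set γ : ℝ := P ^ ((1 : ℝ) / l) with hγ
  have hγ0 : 0 < γ := Real.rpow_pos_of_pos hP0 _
  have hγP : γ ^ l = P := by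
    rw [hγ, one_div]
    exact Real.rpow_inv_natCast_pow hP0.le (by omega)
  have hγN : (d : ℝ) * l ^ 3 * N ≤ γ :=
    le_of_lt (lt_of_pow_lt_pow_left₀ l hγ0.le (hγP ▸ hPN))
  set Q : ℕ → ℝ := fun n => ∏ k ∈ range n, w k with hQ
  have hQ0 : ∀ n, 0 < Q n := fun n => prod_pos fun k _ => hw0 k
  -- The partial products are divided by powers of the mean so that the weights become periodic
  -- along the cycle; entries on both sides of the diagonal then obey one formula.
  set y : ℕ → ℝ := fun n => Q n / γ ^ n with hy
  have hy0 : ∀ n, 0 < y n := fun n => div_pos (hQ0 n) (by positivity)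
  have hyl : ∀ n, y (n + l) = y n := by
    intro n
    have : Q (n + l) = Q n * P := by
      simp only [hQ]
      rw [prod_range_add, prod_shift hwl n]
    simp only [hy]
    rw [this, pow_add, hγP]
    field_simp
  have hdiag : ∀ i, |(tab X b (g i) (η i) : ℝ)| = w i := by
    intro i
    simp only [hw]
    rw [← hηw, Nat.cast_natAbs, Int.cast_abs]
  -- The entry is a chord: together with the `a - 1` cycle edges between its ends it forms a closed
  -- walk of length `a < l`, of weight at most `(d a³ N)^a`. Division by `γ^a` leaves `((a /
  -- l)³)^a`, and Bernoulli finishes.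
  have hoff : ∀ i a, 1 ≤ a → a < l → |(tab X b (g (i + a)) (η i) : ℝ)| / w i * (y (i + a) / y i)
      ≤ 1 / ((l - a : ℕ) + 1 : ℝ) ^ 3 := by
    intro i a ha hal
    obtain ⟨c, rfl⟩ := Nat.exists_eq_add_of_le' ha
    set S : ℝ := ∏ k ∈ range c, w (i + 1 + k) with hS
    set T : ℝ := |(tab X b (g (i + (c + 1))) (η i) : ℝ)| with hT
    have hTS : S * T ≤ ((d : ℝ) * (c + 1 : ℕ) ^ 3 * N) ^ (c + 1) := by
      have h1 := prod_le_walk (wgt X part b) g c (i + 1)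
      have h2 := natAbs_tab_le_wgt X part (s := g (i + (c + 1))) (hη i)
      have h3 := walk_mul_le (wgt X part b) c (g (i + 1 + c)) (g (i + 1)) (g (i + 1 + c))
      have h4 := hmin (c + 1) ha hal (g (i + 1 + c))
      rw [show i + (c + 1) = i + 1 + c by ring] at h2
      have h5 := ((Nat.mul_le_mul h1 h2).trans h3).trans h4
      have h6 := (Nat.cast_le (α := ℝ)).2 h5
      rw [thr, Nat.cast_mul, Nat.cast_prod, Nat.cast_natAbs, Int.cast_abs] at h6
      push_cast at h6
      rw [hNn] at h6
      rw [hS, hT, show i + (c + 1) = i + 1 + c by ring]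
      push_cast
      exact h6
    have hyy : y (i + (c + 1)) / y i = w i * S / γ ^ (c + 1) := by
      have : Q (i + (c + 1)) = Q i * (w i * S) := by
        simp only [hQ, hS]
        rw [prod_range_add, prod_range_succ']
        rw [add_zero, mul_comm (w i)]
        congr 2
        exact prod_congr rfl fun k _ => by rw [show i + (k + 1) = i + 1 + k by ring]
      simp only [hy]
      rw [this, pow_add γ i]
      have := (hQ0 i).ne'
      field_simp
    have hl0 : (0 : ℝ) < l := by exact_mod_cast hl
    calc T / w i * (y (i + (c + 1)) / y i) = S * T / γ ^ (c + 1) := by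
          rw [hyy]
          have := (hw0 i).ne'
          field_simp
      _ ≤ ((d : ℝ) * (c + 1 : ℕ) ^ 3 * N) ^ (c + 1) / γ ^ (c + 1) := by gcongr
      _ = ((d : ℝ) * (c + 1 : ℕ) ^ 3 * N / γ) ^ (c + 1) := by rw [div_pow]
      _ ≤ ((((c + 1 : ℕ) : ℝ) / l) ^ 3) ^ (c + 1) := by
          refine pow_le_pow_left₀ (by positivity) ?_ _
          rw [div_pow, div_le_div_iff₀ hγ0 (by positivity)]
          calc (d : ℝ) * (c + 1 : ℕ) ^ 3 * N * l ^ 3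
              = ((c + 1 : ℕ) : ℝ) ^ 3 * ((d : ℝ) * l ^ 3 * N) := by ring
            _ ≤ _ := by gcongr
      _ = ((((c + 1 : ℕ) : ℝ) / l) ^ (c + 1)) ^ 3 := by rw [← pow_mul, ← pow_mul, mul_comm]
      _ ≤ (1 / ((l - (c + 1) : ℕ) + 1 : ℝ)) ^ 3 :=
          pow_le_pow_left₀ (by positivity) (div_pow_le_inv ha hal.le) _
      _ = _ := by rw [div_pow, one_pow]
  have hdet := bdet_pow_mul_bdet_of_injective X b (pivots b g η κ) (fun i : Fin κ => g i)
    (fun i k h => Fin.ext (hinj _ (by omega) _ (by omega) h))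
    (fun r hr => pivots_of_notMem b η fun x hx h => hr ⟨⟨x, hx⟩, h⟩) hb
  set A : Matrix (Fin κ) (Fin κ) ℝ := Matrix.of fun i k => (tab X b (g k) (η i) : ℝ) with hA
  have hdetA : N ^ κ * |(bdet X (pivots b g η κ) : ℝ)| = |A.det| * N := by
    have h1 : ((Matrix.of fun i k : Fin κ =>
        tab X b (g k) (pivots b g η κ (g i))).det : ℝ) = A.det := by
      rw [Int.cast_det]
      congr 1
      ext i k
      simp only [hA, Matrix.map_apply, Matrix.of_apply]
      rw [pivots_apply b η (fun x hx y hy h => hinj x (by omega) y (by omega) h) i.2]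
    have h2 := congrArg (fun z : ℤ => |(z : ℝ)|) hdet
    simp only [Int.cast_mul, Int.cast_pow, abs_mul, abs_pow, Fintype.card_fin] at h2
    rw [h1] at h2
    exact h2
  rw [hdetA]
  refine mul_le_mul_of_nonneg_right ?_ hN0.le
  have hAd : ∀ i : Fin κ, |A i i| = w i := fun i => hdiag i
  have hdom := A.abs_det_ge_of_weighted_dominant (fun i => y i) (fun i => hy0 i)
    (fun i => abs_pos.1 ((hAd i).symm ▸ hw0 i)) ?_
  · simp only [hAd, Fintype.card_fin] at hdom
    rwa [Fin.prod_univ_eq_prod_range (fun k => w k) κ] at hdom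
  intro i
  -- For column `k` at cyclic distance `a` from the diagonal, `j k = l - a`. Distinct columns give
  -- distinct values in `[1, l)`, so a row sum is part of the sum of inverse cubes.
  let j : Fin κ → ℕ := fun k => if k < i then i - k else l + i - k
  have hj : ∀ k ∈ univ.erase i, j k ∈ Ico 1 l := by
    intro k hk
    have hki : (k : ℕ) ≠ i := fun h => (mem_erase.1 hk).1 (Fin.ext h)
    simp only [j, mem_Ico, Fin.lt_def]
    split_ifs <;> omega
  have hjinj : Set.InjOn j (univ.erase i : Finset (Fin κ)) := by
    intro k hk k' hk' h
    have h1 := hj k hk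
    have h2 := hj k' hk'
    simp only [j, mem_Ico, Fin.lt_def] at h h1 h2
    apply Fin.ext
    have := k.2
    have := k'.2
    split_ifs at h h1 h2 <;> omega
  calc _ ≤ ∑ k ∈ univ.erase i, (1 : ℝ) / ((j k : ℝ) + 1) ^ 3 := by
        refine sum_le_sum fun k hk => ?_
        have hki : (k : ℕ) ≠ i := fun h => (mem_erase.1 hk).1 (Fin.ext h)
        rw [hAd]
        simp only [hA, Matrix.of_apply, j, Fin.lt_def]
        split_ifs with h
        · have := hoff i (l + k - i) (by omega) (by omega)
          rw [show (i : ℕ) + (l + k - i) = k + l by omega, hgl, hyl,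
            show l - (l + (k : ℕ) - i) = i - k by omega] at this
          exact this
        · have := hoff i (k - i) (by omega) (by omega)
          rw [show (i : ℕ) + (k - i) = k by omega,
            show l - ((k : ℕ) - i) = l + i - k by omega] at this
          exact this
    _ = ∑ x ∈ (univ.erase i).image j, (1 : ℝ) / ((x : ℝ) + 1) ^ 3 :=
        (sum_image (f := fun x : ℕ => (1 : ℝ) / ((x : ℝ) + 1) ^ 3) hjinj).symm
    _ ≤ ∑ x ∈ Ico 1 l, (1 : ℝ) / ((x : ℝ) + 1) ^ 3 :=
        sum_le_sum_of_subset_of_nonneg (image_subset_iff.2 hj) fun _ _ _ => by positivity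
    _ ≤ 1 / 2 * (1 - 1 / (l : ℝ)) := sum_inv_cube_le l hl
    _ ≤ 1 / 2 := by
        have : (0 : ℝ) ≤ 1 / (l : ℝ) := by positivity
        linarith

end cycle

end DetMax

/-! ### Progress from a violation, and the approximation factor of local optima -/

namespace DetMax

open Finset Function

variable {d m : ℕ} {X : Fin m → Fin d → ℤ} {part : Fin m → Fin d} {b : Fin d → Fin m}

theorem walk_one (W : Fin d → Fin d → ℕ) (i j : Fin d) : walk W 1 i j = W i j := by
  refine le_antisymm (Finset.sup_le fun k _ => ?_) ?_
  · simp only [walk]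
    split_ifs with h
    · simp [h]
    · simp
  · simpa [walk] using walk_mul_le W 0 i i j

/-- Data of a shortest closed walk of large weight, listed backwards. -/
structure Violation (X : Fin m → Fin d → ℤ) (part : Fin m → Fin d) (b : Fin d → Fin m) (l : ℕ)
    (g : ℕ → Fin d) (η : ℕ → Fin m) : Prop where
  one_le : 1 ≤ l
  le : l ≤ d
  closed : g l = g 0
  part_eq : ∀ x < l, part (η x) = part (b (g (x + 1)))
  tab_eq : ∀ x < l, (tab X b (g x) (η x)).natAbs = wgt X part b (g (x + 1)) (g x)
  minimal : ∀ a, 1 ≤ a → a < l → ∀ i, walk (wgt X part b) a i i ≤ thr X b a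
  large : thr X b l < ∏ k ∈ range l, wgt X part b (g (k + 1)) (g k)

namespace Violation

variable {l : ℕ} {g : ℕ → Fin d} {η : ℕ → Fin m}

/-- Only the first `l` positions (and `g l`) are constrained. Composition with `% l` gives the
periodic sequences required by the cycle lemmas; the wrap-around is correct because of `closed`. -/
theorem mod_succ (h : Violation X part b l g η) (x : ℕ) : g ((x + 1) % l) = g (x % l + 1) := by
  have hl := h.one_le
  rw [Nat.add_mod_eq_ite]
  rcases Nat.lt_or_ge 1 l with h1 | h1
  · rw [Nat.mod_eq_of_lt h1]
    split_ifs with h2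
    · have : x % l + 1 = l := by
        have := Nat.mod_lt x hl
        omega
      rw [this, h.closed, Nat.sub_self]
    · rfl
  · obtain rfl : l = 1 := by omega
    simp only [Nat.mod_one]
    simpa using h.closed.symm

theorem prod_mod (h : Violation X part b l g η) :
    thr X b l < ∏ k ∈ range l, wgt X part b (g ((k + 1) % l)) (g (k % l)) := by
  refine h.large.trans_eq (prod_congr rfl fun k hk => ?_)
  rw [h.mod_succ, Nat.mod_eq_of_lt (mem_range.1 hk)]

theorem injOn (h : Violation X part b l g η) : ∀ x < l, ∀ y < l, g x = g y → x = y := by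
  intro x hx y hy hxy
  refine injOn_of_minimal (g := fun x => g (x % l)) (fun x => by simp) h.minimal h.prod_mod
    x hx y hy ?_
  simpa [Nat.mod_eq_of_lt hx, Nat.mod_eq_of_lt hy] using hxy

theorem minor_ge (h : Violation X part b l g η) (hb : bdet X b ≠ 0) {κ : ℕ} (hκ : κ ≤ l) :
    (∏ k ∈ range κ, (wgt X part b (g (k + 1)) (g k) : ℝ)) * (1 / 2) ^ κ * |(bdet X b : ℝ)|
      ≤ |(bdet X b : ℝ)| ^ κ * |(bdet X (pivots b g η κ) : ℝ)| ∧
    0 < ∏ k ∈ range κ, (wgt X part b (g (k + 1)) (g k) : ℝ) := by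
  have hl := h.one_le
  have := DetMax.minor_ge (g := fun x => g (x % l)) (η := fun x => η (x % l)) hb hl
    (fun x => by simp) (fun x => by
      simp only [h.mod_succ]
      exact h.part_eq _ (Nat.mod_lt _ hl))
    (fun x => by
      simp only [h.mod_succ]
      exact h.tab_eq _ (Nat.mod_lt _ hl)) h.minimal h.prod_mod hκ
  have e : ∏ k ∈ range κ, (wgt X part b (g ((k + 1) % l)) (g (k % l)) : ℝ)
      = ∏ k ∈ range κ, (wgt X part b (g (k + 1)) (g k) : ℝ) := by
    refine prod_congr rfl fun k hk => ?_
    rw [h.mod_succ, Nat.mod_eq_of_lt (by have := mem_range.1 hk; omega)]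
  rw [e, pivots_congr (g := fun x => g (x % l)) b (g' := g) (η' := η)
    (fun x hx => by simp [Nat.mod_eq_of_lt (show x < l by omega)])
    (fun x hx => by simp [Nat.mod_eq_of_lt (show x < l by omega)])] at this
  exact this

/-- The lower bound on the minors holds for every initial segment of the cycle. Hence each single
pivot of the exchange divides by a nonzero determinant. -/
theorem bdet_pivots_ne_zero (h : Violation X part b l g η) (hb : bdet X b ≠ 0) {κ : ℕ}
    (hκ : κ ≤ l) : bdet X (pivots b g η κ) ≠ 0 := by
  intro h0
  obtain ⟨h1, h2⟩ := h.minor_ge hb hκ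
  rw [h0] at h1
  have : 0 < |(bdet X b : ℝ)| := abs_pos.2 (by exact_mod_cast hb)
  have : 0 < (∏ k ∈ range κ, (wgt X part b (g (k + 1)) (g k) : ℝ)) * (1 / 2) ^ κ
    * |(bdet X b : ℝ)| := by positivity
  rw [Int.cast_zero, abs_zero, mul_zero] at h1
  linarith

/-- Row `g x` takes over the part of row `g (x + 1)`, so along the cycle the parts are rotated, and
elsewhere they are unchanged. -/
theorem injective_part (h : Violation X part b l g η) (hi : Injective fun r => part (b r)) :
    Injective fun r => part (pivots b g η l r) := by
  have h1 : ∀ x < l, part (pivots b g η l (g x)) = part (b (g (x + 1))) := fun x hx => by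
    rw [pivots_apply b η h.injOn hx, h.part_eq x hx]
  have h2 : ∀ r, (¬ ∃ x < l, g x = r) → part (pivots b g η l r) = part (b r) := fun r hr => by
    rw [pivots_of_notMem b η fun x hx he => hr ⟨x, hx, he⟩]
  have h3 : ∀ x < l, ∃ y < l, g y = g (x + 1) ∧ (y = x + 1 ∨ y = 0 ∧ x + 1 = l) := by
    intro x hx
    by_cases hx' : x + 1 < l
    · exact ⟨x + 1, hx', rfl, Or.inl rfl⟩
    · obtain rfl : l = x + 1 := by omega
      exact ⟨0, by omega, h.closed.symm, Or.inr ⟨rfl, rfl⟩⟩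
  intro r r' hrr
  simp only at hrr
  by_cases hr : ∃ x < l, g x = r <;> by_cases hr' : ∃ x < l, g x = r'
  · obtain ⟨x, hx, rfl⟩ := hr
    obtain ⟨x', hx', rfl⟩ := hr'
    rw [h1 x hx, h1 x' hx'] at hrr
    obtain ⟨y, hy, e, c⟩ := h3 x hx
    obtain ⟨y', hy', e', c'⟩ := h3 x' hx'
    have := h.injOn y hy y' hy' (by rw [e, e']; exact hi hrr)
    congr 1
    omega
  · obtain ⟨x, hx, rfl⟩ := hr
    rw [h1 x hx, h2 r' hr'] at hrr
    obtain ⟨y, hy, e, c⟩ := h3 x hx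
    exact (hr' ⟨y, hy, e.trans (hi hrr)⟩).elim
  · obtain ⟨x, hx, rfl⟩ := hr'
    rw [h1 x hx, h2 r hr] at hrr
    obtain ⟨y, hy, e, c⟩ := h3 x hx
    exact (hr ⟨y, hy, e.trans (hi hrr.symm)⟩).elim
  · rw [h2 r hr, h2 r' hr'] at hrr
    exact hi hrr

/-- For `l ≥ 2` the minor is more than `(d l³ N / 2)^l`, and `d l³ / 2` is at least two. The second
alternative is only needed for `d = 1`, where the threshold gives a gain of more than one but not of
two. -/
theorem improves (h : Violation X part b l g η) (hb : bdet X b ≠ 0) :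
    2 * (bdet X b).natAbs ≤ (bdet X (pivots b g η l)).natAbs ∨
      LocallyOptimal X part (pivots b g η l) := by
  have hl := h.one_le
  have hld := h.le
  rcases Nat.lt_or_ge 1 l with h1 | h1
  · left
    obtain ⟨h2, h3⟩ := h.minor_ge hb le_rfl
    set N : ℝ := |(bdet X b : ℝ)| with hN
    have hN0 : 0 < N := abs_pos.2 (by exact_mod_cast hb)
    have h4 := (Nat.cast_lt (α := ℝ)).2 h.large
    rw [thr] at h4
    push_cast at h4
    rw [show ((bdet X b).natAbs : ℝ) = N by rw [hN, Nat.cast_natAbs, Int.cast_abs]] at h4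
    have h5 : ((d : ℝ) * l ^ 3 * N) ^ l * (1 / 2) ^ l * N
        ≤ N ^ l * |(bdet X (pivots b g η l) : ℝ)| :=
      le_trans (by gcongr) h2
    have h6 : ((d : ℝ) * l ^ 3 / 2) ^ l * N ≤ |(bdet X (pivots b g η l) : ℝ)| := by
      refine le_of_mul_le_mul_left (le_trans (le_of_eq ?_) h5) (pow_pos hN0 l)
      rw [div_pow, mul_pow, mul_pow, mul_pow, one_div, inv_pow]
      ring
    have h7 : (2 : ℝ) ≤ ((d : ℝ) * l ^ 3 / 2) ^ l := by
      have hl2 : (2 : ℝ) ≤ l := by exact_mod_cast h1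
      have hd2 : (2 : ℝ) ≤ d := by exact_mod_cast h1.trans_le hld
      have : (2 : ℝ) ≤ (d : ℝ) * l ^ 3 / 2 := by
        have : (2 : ℝ) ^ 3 ≤ (l : ℝ) ^ 3 := by gcongr
        nlinarith
      exact this.trans (le_self_pow₀ (by linarith) (by omega))
    have h8 : 2 * N ≤ |(bdet X (pivots b g η l) : ℝ)| :=
      le_trans (mul_le_mul_of_nonneg_right h7 hN0.le) h6
    rw [hN, ← Int.cast_abs, ← Int.cast_abs, ← Nat.cast_natAbs, ← Nat.cast_natAbs] at h8
    exact_mod_cast h8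
  -- A loop replaces a single element, and the new determinant is exactly the edge weight, which
  -- exceeds `d N`. For `d = 1` there is only one part and the new element realizes the maximum over
  -- it, so the search is over.
  · obtain rfl : l = 1 := by omega
    have hD : (bdet X (pivots b g η 1)).natAbs = wgt X part b (g 1) (g 0) := by
      rw [← h.tab_eq 0 (by omega)]
      rfl
    have h4 := h.large
    rw [prod_range_one, zero_add, ← hD, thr] at h4
    simp only [one_pow, mul_one, pow_one] at h4
    rcases Nat.lt_or_ge 1 d with h5 | h5
    · left
      exact le_trans (Nat.mul_le_mul_right _ h5) h4.le
    · right
      obtain rfl : d = 1 := by omega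
      intro a ha ha' i
      obtain rfl : a = 1 := by omega
      rw [walk_one, thr, hD]
      simp only [one_pow, mul_one, pow_one, one_mul]
      refine Finset.sup_le fun e _ => ?_
      have : tab X (pivots b g η 1) i e = tab X b (g 0) e := by
        rw [Subsingleton.elim i (g 0)]
        exact tab_update_same X b (g 0) (η 0) e
      rw [this]
      exact natAbs_tab_le_wgt X part (Subsingleton.elim _ _)

end Violation

/-- A permutation decomposes into cycles, and a cycle of length `l` is a closed walk of length `l`
in the graph with weights `W`. The powers of `G` multiply because the cycle lengths add up to `d`.
-/
theorem prod_perm_le {W : Fin d → Fin d → ℕ} {G : ℕ}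
    (hW : ∀ l, 1 ≤ l → l ≤ d → ∀ i, walk W l i i ≤ G ^ l) (σ : Equiv.Perm (Fin d)) :
    ∏ r, W r (σ r) ≤ G ^ d := by
  have key : ∏ r ∈ σ.support, W r (σ r) ≤ G ^ σ.support.card := by
    induction σ using Equiv.Perm.cycle_induction_on with
    | base_one => simp
    | base_cycles σ hσ =>
      obtain ⟨x, hx, hs⟩ := id hσ
      set l := σ.support.card with hl
      have hl1 : 1 ≤ l := Nat.one_le_of_lt hσ.two_le_card_support
      have hld : l ≤ d := (card_le_univ _).trans_eq (Fintype.card_fin d)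
      have hord : orderOf σ = l := hσ.orderOf
      -- Iterates of the inverse, because `prod_le_walk` expects the edge `g (k + 1) → g k` and `σ`
      -- maps `g (k + 1)` to `g k`.
      set g : ℕ → Fin d := fun k => (σ⁻¹ ^ k) x with hg
      have hgs : ∀ k, σ (g (k + 1)) = g k := fun k => by
        simp only [hg]
        rw [pow_succ', Equiv.Perm.mul_apply]
        exact σ.apply_symm_apply _
      have hgl : g l = g 0 := by
        simp only [hg]
        rw [inv_pow, ← hord, pow_orderOf_eq_one]
        simp
      have himg : (range l).image (fun k => g (k + 1)) = σ.support := by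
        ext y
        rw [mem_image, ← Equiv.Perm.support_inv]
        constructor
        · rintro ⟨k, -, rfl⟩
          rw [hg, Equiv.Perm.pow_apply_mem_support, Equiv.Perm.support_inv]
          exact Equiv.Perm.mem_support.2 hx
        · intro hy
          rw [Equiv.Perm.support_inv, Equiv.Perm.mem_support] at hy
          have hsc : σ⁻¹.SameCycle x y := Equiv.Perm.sameCycle_inv.2 (hs hy)
          obtain ⟨i, h0, hi, rfl⟩ := hsc.exists_pow_eq''
          rw [orderOf_inv, hord] at hi
          exact ⟨i - 1, mem_range.2 (by omega), by simp only [hg, Nat.sub_add_cancel h0]⟩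
      have hinj : Set.InjOn (fun k => g (k + 1)) (range l : Finset ℕ) := by
        rw [← card_image_iff, himg, card_range]
      have hprod : ∏ r ∈ σ.support, W r (σ r) = ∏ k ∈ range l, W (g (k + 1)) (g k) := by
        rw [← himg, prod_image hinj]
        exact prod_congr rfl fun k _ => by rw [hgs]
      rw [hprod]
      have := prod_le_walk W g l 0
      simp only [zero_add] at this
      refine this.trans ?_
      rw [hgl]
      exact hW l hl1 hld _
    | induction_disjoint σ τ hd _ ih₁ ih₂ =>
      rw [hd.card_support_mul, hd.support_mul, prod_union hd.disjoint_support, pow_add]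
      refine Nat.mul_le_mul (le_trans (le_of_eq ?_) ih₁) (le_trans (le_of_eq ?_) ih₂)
      · refine prod_congr rfl fun r hr => ?_
        rw [Equiv.Perm.mul_apply, (hd r).resolve_left (Equiv.Perm.mem_support.1 hr)]
      · refine prod_congr rfl fun r hr => ?_
        rw [Equiv.Perm.mul_apply, (hd (τ r)).resolve_right]
        exact Equiv.Perm.mem_support.1 (Equiv.Perm.apply_mem_support.2 hr)
  -- Fixed points are loops, that is, closed walks of length one.
  have hfix : ∏ r ∈ σ.supportᶜ, W r (σ r) ≤ G ^ σ.supportᶜ.card := by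
    refine prod_le_pow_card _ _ _ fun r hr => ?_
    rw [mem_compl, Equiv.Perm.notMem_support] at hr
    rw [hr, ← walk_one W, ← pow_one G]
    exact hW 1 le_rfl (by have := r.2; omega) r
  rw [← prod_mul_prod_compl σ.support]
  refine (Nat.mul_le_mul key hfix).trans_eq ?_
  rw [← pow_add, card_add_card_compl, Fintype.card_fin]

/-- In the Leibniz expansion of the tableau matrix, an entry for `c r` in row `k` is at most `wgt b
r k`, since `c r` and `b r` share a part. Every threshold is below `(d⁴ N)^l`, and `d! ≤ d^d`
supplies the fifth power of `d`. -/
theorem LocallyOptimal.natAbs_bdet_le (h : LocallyOptimal X part b) (hb : bdet X b ≠ 0)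
    {c : Fin d → Fin m} (hc : ∀ r, part (c r) = part (b r)) :
    (bdet X c).natAbs ≤ d ^ (5 * d) * (bdet X b).natAbs := by
  set N := (bdet X b).natAbs with hN
  have hN0 : 0 < N := Int.natAbs_pos.2 hb
  have hG : ∀ l, 1 ≤ l → l ≤ d → ∀ i, walk (wgt X part b) l i i ≤ (d ^ 4 * N) ^ l := by
    intro l h1 h2 i
    refine (h l h1 h2 i).trans ?_
    unfold thr
    gcongr
    calc d * l ^ 3 ≤ d * d ^ 3 := by gcongr
      _ = d ^ 4 := by ring
  have hdet : (Matrix.of fun r k => tab X b k (c r)).det.natAbs ≤ d ^ d * (d ^ 4 * N) ^ d := by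
    rw [← Matrix.det_transpose, Matrix.det_apply]
    refine (Int.natAbs_sum_le _ _).trans ?_
    calc _ ≤ ∑ σ : Equiv.Perm (Fin d), (d ^ 4 * N) ^ d := by
          refine sum_le_sum fun σ _ => ?_
          refine le_trans ?_ (prod_perm_le hG σ)
          rw [Units.smul_def, smul_eq_mul, Int.natAbs_mul, Int.units_natAbs, one_mul]
          refine (map_prod Int.natAbsHom _ _).trans_le ?_
          exact prod_le_prod' fun r _ => natAbs_tab_le_wgt X part (hc r)
      _ ≤ _ := by
          rw [sum_const, smul_eq_mul, card_univ, Fintype.card_perm, Fintype.card_fin]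
          exact Nat.mul_le_mul_right _ (Nat.factorial_le_pow d)
  have h1 := congrArg Int.natAbs (bdet_pow_mul_bdet X b c)
  rw [Int.natAbs_mul, Int.natAbs_mul, Int.natAbs_pow, ← hN] at h1
  have h2 : N ^ d * (bdet X c).natAbs ≤ N ^ d * (d ^ (5 * d) * N) := by
    rw [h1]
    refine (Nat.mul_le_mul_right N hdet).trans_eq ?_
    rw [mul_pow, ← pow_mul, show 5 * d = d + 4 * d by ring, pow_add]
    ring
  exact Nat.le_of_mul_le_mul_left h2 (pow_pos hN0 d)

end DetMax

/-! ### Running maxima -/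

namespace RAM

variable {ι : Type} {sz : ι → ℕ}

/-- Cell `addr` of array `w` becomes the maximum of `val` over all values `k < bound` of the counter
`c` that satisfy `cond`; cell `addr` of array `g` becomes a maximizer. -/
def Prog.argmax (w g c : ℕ) (bound addr cond val : Expr) : Prog :=
  .seq (.assign w addr (.const (-1)))
    (.for c bound (.ite cond
      (.ite (.op .lt (.read w addr) val)
        (.seq (.assign g addr (.var c)) (.assign w addr val)) .skip) .skip))

/-- Agreement of memories except for a counter and the cells written by `Prog.argmax`. -/
def AgreeOff (w g c : ℕ) (A : ℤ) (s s' : State) : Prop :=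
  ∀ a j, ¬ ((a = w ∨ a = g) ∧ j = A) → a ≠ c → s' a j = s a j

theorem AgreeOff.eq {w g c : ℕ} {A : ℤ} {s s' : State} (h : AgreeOff w g c A s s') {a : ℕ}
    (ha : a ∉ [w, g, c]) : s' a = s a := by
  simp only [List.mem_cons, List.not_mem_nil, or_false, not_or] at ha
  funext j
  exact h _ _ (fun h => h.1.elim ha.1 ha.2.1) ha.2.2

/-- The cells written by `Prog.argmax` after `n` steps. -/
def IsArgmax (w g : ℕ) (A : ℤ) (n : ℕ) (cf : ℕ → Prop) (vf : ℕ → ℤ) (s : State) : Prop :=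
  (∀ k < n, cf k → vf k ≤ s w A) ∧
    ((s w A = -1 ∧ ∀ k < n, ¬ cf k) ∨ ∃ k < n, cf k ∧ s g A = k ∧ s w A = vf k)

theorem Runs.argmax {P : ι → State → Prop} {w g c : ℕ} (hwg : w ≠ g) (hwc : w ≠ c) (hgc : g ≠ c)
    {bound addr cond val : Expr} (N : ι → State → ℕ) (A : ι → State → ℤ)
    (cf : ι → State → ℕ → Prop) (vf : ι → State → ℕ → ℤ)
    (hN : ∀ i s, P i s → Bdd (sz i) s → N i s ≤ sz i)
    (hA : ∀ i s s', P i s → AgreeOff w g c (A i s) s s' → addr.eval s' = A i s)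
    (hb : ∀ i s s', P i s → AgreeOff w g c (A i s) s s' → bound.eval s' = N i s)
    (hcf : ∀ i s s' k, P i s → AgreeOff w g c (A i s) s s' → s' c 0 = (k : ℕ) → k < N i s →
      (cond.eval s' ≠ 0 ↔ cf i s k) ∧ (cf i s k → val.eval s' = vf i s k))
    (hv : ∀ i s k, P i s → k < N i s → cf i s k → 0 ≤ vf i s k ∧ vf i s k ≤ 2 ^ sz i) :
    Runs sz P (.argmax w g c bound addr cond val) (fun i s s' =>
      AgreeOff w g c (A i s) s s' ∧
        IsArgmax w g (A i s) (N i s) (cf i s) (vf i s) s') := by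
  -- All candidate values are nonnegative, so the first candidate beats `-1`, and a remaining `-1`
  -- shows that there was none.
  have h1 : Runs sz P (.assign w addr (.const (-1)))
      (fun i s s' => s' = s.write w (A i s) (-1)) := by
    refine Runs.straight trivial fun i s h hs => ?_
    have := hA i s s h fun _ _ _ _ => rfl
    simp only [Prog.run_assign, this, Expr.eval_const, true_and]
    exact hs.write _ _ (by simpa using one_le_pow₀ (by norm_num))
  have h2 : Runs (fun j : ι × State => sz j.1)
      (fun j s => P j.1 j.2 ∧ N j.1 j.2 ≤ sz j.1 ∧ s = j.2.write w (A j.1 j.2) (-1))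
      (.for c bound (.ite cond
        (.ite (.op .lt (.read w addr) val)
          (.seq (.assign g addr (.var c)) (.assign w addr val)) .skip) .skip))
      (fun j _ s' => AgreeOff w g c (A j.1 j.2) j.2 s' ∧
        IsArgmax w g (A j.1 j.2) (N j.1 j.2) (cf j.1 j.2) (vf j.1 j.2) s') := by
    refine Runs.for (Inv := fun j _ k s' => AgreeOff w g c (A j.1 j.2) j.2 s' ∧
        IsArgmax w g (A j.1 j.2) k (cf j.1 j.2) (vf j.1 j.2) s') (fun j _ => N j.1 j.2)
        ?_ ?_ ?_ ?_ ?_ ?_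
    · exact fun j s h _ => h.2.1
    · rintro ⟨i, s₀⟩ s s' ⟨-, -, rfl⟩ h -
      refine ⟨fun a k hk hac => ?_, fun k hk => (Nat.not_lt_zero _ hk).elim,
        Or.inl ⟨?_, fun k hk => (Nat.not_lt_zero _ hk).elim⟩⟩
      · rw [h a hac, State.write_apply, if_neg]
        rintro ⟨rfl, rfl⟩
        exact hk ⟨Or.inl rfl, rfl⟩
      · rw [h w hwc, State.write_same]
    · rintro ⟨i, s₀⟩ s k s₁ s₂ - h ⟨h1, h2⟩
      refine ⟨fun a j hj hac => by rw [h a hac, h1 a j hj hac], ?_⟩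
      unfold IsArgmax
      rw [h w hwc, h g hgc]
      exact h2
    · rintro ⟨i, s₀⟩ s k s' ⟨hP, -, -⟩ ⟨h1, -⟩ - -
      exact hb i s₀ s' hP h1
    · refine Runs.straight ⟨⟨⟨trivial, trivial⟩, trivial⟩, trivial⟩ ?_
      rintro ⟨⟨i, s₀⟩, s₁, k⟩ s ⟨⟨hP, hN', -⟩, ⟨hag, h1, h2⟩, hck, hk⟩ hs
      simp only at hP hN' hag h1 h2 hck hk hs ⊢
      have hAs := hA i s₀ s hP hag
      obtain ⟨hc1, hc2⟩ := hcf i s₀ s k hP hag hck hk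
      simp only [Prog.run_ite, Prog.run_skip, Prog.run_seq, Prog.run_assign, Expr.eval_op,
        Expr.eval_read, Expr.eval_var, Op.eval_lt_eq_zero]
      rw [hAs]
      by_cases hc : cond.eval s = 0
      · rw [if_pos hc]
        have hnc : ¬ cf i s₀ k := fun h => hc1.2 h hc
        refine ⟨⟨⟨hag, fun k' hk' h' => ?_, ?_⟩, hck⟩, hs⟩
        · rcases Nat.lt_succ_iff_lt_or_eq.1 hk' with h | rfl
          · exact h1 k' h h'
          · exact (hnc h').elim
        · rcases h2 with ⟨h3, h4⟩ | ⟨k', hk', h3⟩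
          · refine Or.inl ⟨h3, fun k' hk' => ?_⟩
            rcases Nat.lt_succ_iff_lt_or_eq.1 hk' with h | rfl
            · exact h4 k' h
            · exact hnc
          · exact Or.inr ⟨k', by omega, h3⟩
      · rw [if_neg hc]
        have hcfk := hc1.1 hc
        have hval := hc2 hcfk
        obtain ⟨hv0, hv1⟩ := hv i s₀ k hP hk hcfk
        rw [hval]
        by_cases hlt : vf i s₀ k ≤ s w (A i s₀)
        · rw [if_pos hlt]
          refine ⟨⟨⟨hag, fun k' hk' h' => ?_, ?_⟩, hck⟩, hs⟩
          · rcases Nat.lt_succ_iff_lt_or_eq.1 hk' with h | rfl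
            · exact h1 k' h h'
            · exact hlt
          · rcases h2 with ⟨h3, h4⟩ | ⟨k', hk', h3⟩
            · rw [h3] at hlt
              omega
            · exact Or.inr ⟨k', by omega, h3⟩
        · rw [if_neg hlt]
          -- Between the two writes, address and value are evaluated once more; they may not depend
          -- on the cell of `g` that has just changed, which is what the hypotheses over `AgreeOff`
          -- provide.
          have hag' : AgreeOff w g c (A i s₀) s₀ (s.write g (A i s₀) (s c 0)) := by
            intro a j hj hac
            rw [State.write_apply, if_neg, hag a j hj hac]
            rintro ⟨rfl, rfl⟩
            exact hj ⟨Or.inr rfl, rfl⟩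
          have e1 := hA i s₀ _ hP hag'
          have e2 := (hcf i s₀ (s.write g (A i s₀) (s c 0)) k hP hag' (by
            rw [State.write_apply, if_neg (fun h => hgc h.1.symm), hck]) hk).2 hcfk
          rw [e1, e2]
          refine ⟨⟨⟨?_, fun k' hk' h' => ?_, Or.inr ⟨k, by omega, hcfk, ?_, ?_⟩⟩, ?_⟩, ?_⟩
          · intro a j hj hac
            rw [State.write_apply, if_neg, hag' a j hj hac]
            rintro ⟨rfl, rfl⟩
            exact hj ⟨Or.inl rfl, rfl⟩
          · rw [State.write_same]
            rcases Nat.lt_succ_iff_lt_or_eq.1 hk' with h | rfl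
            · exact (h1 k' h h').trans (not_le.1 hlt).le
            · exact le_rfl
          · rw [State.write_of_ne _ _ _ hwg.symm, State.write_same, hck]
          · rw [State.write_same]
          · rw [State.write_of_ne _ _ _ hwc.symm, State.write_of_ne _ _ _ hgc.symm, hck]
          · refine (hs.write _ _ ?_).write _ _ ?_
            · rw [hck, abs_of_nonneg (by positivity)]
              exact_mod_cast (hk.le.trans hN').trans Nat.lt_two_pow_self.le
            · rwa [abs_of_nonneg hv0]
    · rintro ⟨i, s₀⟩ s s' - h
      exact h
  obtain ⟨N₁, hN₁⟩ := h1
  obtain ⟨N₂, hN₂⟩ := h2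
  refine ⟨N₁ + N₂, fun i s hi hs => ?_⟩
  obtain ⟨s₁, t₁, e₁, l₁, rfl, b₁, -⟩ := hN₁ i s hi hs
  obtain ⟨s₂, t₂, e₂, l₂, I₂, b₂, -⟩ := hN₂ (i, s) _ ⟨hi, hN i s hi hs, rfl⟩ b₁
  exact ⟨s₂, t₁ + t₂, .seq e₁ e₂, by simpa using Nat.add_le_add l₁ l₂, I₂, b₂,
    (Exec.seq e₁ e₂).frame⟩

/-- Puts the cell bound into the precondition, so that proof obligations stated in terms of `P`
alone can use it. -/
theorem Runs.of_bdd {P : ι → State → Prop} {p : Prog} {Q : ι → State → State → Prop}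
    (h : Runs sz (fun i s => P i s ∧ Bdd (sz i) s) p Q) : Runs sz P p Q := by
  obtain ⟨N, hN⟩ := h
  exact ⟨N, fun i s hi hs => hN i s ⟨hi, hs⟩ hs⟩

theorem Runs.ite {P : ι → State → Prop} {c : Expr} {p q : Prog} {Q : ι → State → State → Prop}
    (hp : Runs sz (fun i s => P i s ∧ c.eval s ≠ 0) p Q)
    (hq : Runs sz (fun i s => P i s ∧ c.eval s = 0) q Q) : Runs sz P (.ite c p q) Q := by
  obtain ⟨N₁, hN₁⟩ := hp
  obtain ⟨N₂, hN₂⟩ := hq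
  obtain ⟨C, hC⟩ := c.exists_bound
  refine ⟨Polynomial.C C * (Polynomial.X + 1) + N₁ + N₂, fun i s hi hs => ?_⟩
  have hc := (hC _ _ hs).2
  simp only [Polynomial.eval_add, Polynomial.eval_mul, Polynomial.eval_C, Polynomial.eval_X,
    Polynomial.eval_one]
  by_cases h0 : c.eval s = 0
  · obtain ⟨s', t, h1, h2, h3, h4, -⟩ := hN₂ i s ⟨hi, h0⟩ hs
    exact ⟨s', _, .ite_false h0 h1, by omega, h3, h4, (Exec.ite_false h0 h1).frame⟩
  · obtain ⟨s', t, h1, h2, h3, h4, -⟩ := hN₁ i s ⟨hi, h0⟩ hs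
    exact ⟨s', _, .ite_true h0 h1, by omega, h3, h4, (Exec.ite_true h0 h1).frame⟩

theorem Runs.frame {P : ι → State → Prop} {p : Prog} {Q : ι → State → State → Prop}
    (h : Runs sz P p Q) :
    Runs sz P p (fun i s s' => Q i s s' ∧ ∀ a, a ∉ p.writes → s' a = s a) :=
  h.conseq (fun _ _ h => h) fun _ _ _ _ h h' _ => ⟨h, h'⟩

end RAM

/-! ### The local search program -/

namespace DetMax

open RAM Finset Function

/-- The vectors, their parts, and bounds on the numbers that occur. -/
structure Ctx : Type where
  d : ℕ
  m : ℕ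
  X : Fin m → Fin d → ℤ
  part : Fin m → Fin d
  H : ℕ
  L : ℕ
  one_le_H : 1 ≤ H
  abs_X_le : ∀ e j, |X e j| ≤ H
  size_le : (m + d + 2) ^ 4 ≤ L
  bits_le : 4 * ((d + 1) ^ 4 * (d.factorial * H ^ d)) ^ (d + 1) ≤ 2 ^ L

/-! Arrays of the search program: single variables (`v`), counters (`c`) and tables (`a`). -/

@[simp] abbrev vD : ℕ := 2
@[simp] abbrev vM : ℕ := 3
@[simp] abbrev cX : ℕ := 4
@[simp] abbrev cE : ℕ := 5
@[simp] abbrev aPart : ℕ := 6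
@[simp] abbrev aB : ℕ := 7
@[simp] abbrev aT : ℕ := 8
@[simp] abbrev vDet : ℕ := 9
@[simp] abbrev aW : ℕ := 10
@[simp] abbrev aArg : ℕ := 11
@[simp] abbrev aThr : ℕ := 12
@[simp] abbrev aWalk : ℕ := 13
@[simp] abbrev aPred : ℕ := 14
@[simp] abbrev vFlag : ℕ := 15
@[simp] abbrev vSrc : ℕ := 16
@[simp] abbrev vCur : ℕ := 17
@[simp] abbrev vPrev : ℕ := 18
@[simp] abbrev vPiv : ℕ := 19
@[simp] abbrev aNew : ℕ := 20
@[simp] abbrev cT : ℕ := 21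

/-- The memory contains the dimensions and the parts. -/
def Env (c : Ctx) (s : State) : Prop :=
  s vD 0 = c.d ∧ s vM 0 = c.m ∧ ∀ e : Fin c.m, s aPart (e : ℕ) = (c.part e : ℕ)

/-- The memory contains the basis `b` with its tableau. -/
def Tableau (c : Ctx) (b : Fin c.d → Fin c.m) (s : State) : Prop :=
  (∀ r : Fin c.d, s aB (r : ℕ) = (b r : ℕ)) ∧
  (∀ (r : Fin c.d) (e : Fin c.m), s aT ((r : ℕ) * c.m + (e : ℕ)) = tab c.X b r e) ∧
  s vDet 0 = bdet c.X b

theorem Env.congr {c : Ctx} {s s' : State} (h : Env c s) (h1 : s' vD = s vD) (h2 : s' vM = s vM)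
    (h3 : s' aPart = s aPart) : Env c s' := by
  unfold Env
  rw [h1, h2, h3]
  exact h

theorem Tableau.congr {c : Ctx} {b : Fin c.d → Fin c.m} {s s' : State} (h : Tableau c b s)
    (h1 : s' aB = s aB) (h2 : s' aT = s aT) (h3 : s' vDet = s vDet) : Tableau c b s' := by
  unfold Tableau
  rw [h1, h2, h3]
  exact h

/-- A search state: the input together with a basis. -/
abbrev Cfg : Type := (c : Ctx) × (Fin c.d → Fin c.m)

abbrev Cfg.sz (i : Cfg) : ℕ := i.1.L

/-- The machine has no remainder operation; tables are indexed by one counter, from which row and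
column are recovered by this expression and by division. -/
theorem natCast_sub_div_mul (k m : ℕ) : (k : ℤ) - (k : ℤ) / (m : ℤ) * (m : ℤ) = (k % m : ℕ) := by
  rw [Int.natCast_mod, Int.emod_def]
  ring

theorem exists_fin_pair {a m k : ℕ} (h : k < a * m) :
    ∃ (r : Fin a) (e : Fin m), k = r * m + e ∧ k / m = r ∧ k % m = e := by
  have hm : 0 < m := by
    rcases Nat.eq_zero_or_pos m with rfl | h'
    · simp at h
    · exact h'
  refine ⟨⟨k / m, ?_⟩, ⟨k % m, Nat.mod_lt _ hm⟩, ?_, rfl, rfl⟩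
  · exact Nat.div_lt_of_lt_mul (by rwa [mul_comm])
  · simp only
    rw [mul_comm, Nat.div_add_mod]

theorem pair_lt {a m : ℕ} (r : Fin a) (e : Fin m) : (r : ℕ) * m + e < a * m := by
  have h1 := r.2
  have h2 := e.2
  calc (r : ℕ) * m + e < r * m + m := by omega
    _ = (r + 1) * m := by ring
    _ ≤ a * m := Nat.mul_le_mul_right _ h1

theorem pair_div {m x : ℕ} (e : Fin m) : (x * m + e) / m = x := by
  rw [mul_comm, Nat.mul_add_div (by have := e.2; omega), Nat.div_eq_of_lt e.2, add_zero]

theorem pair_mod {m x : ℕ} (e : Fin m) : (x * m + e) % m = e := by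
  rw [Nat.mul_add_mod_self_right, Nat.mod_eq_of_lt e.2]

theorem pair_inj {m x y : ℕ} {e f : Fin m} (h : x * m + e = y * m + f) : x = y ∧ e = f := by
  have h1 := congrArg (· / m) h
  have h2 := congrArg (· % m) h
  simp only [pair_div, pair_mod] at h1 h2
  exact ⟨h1, Fin.ext h2⟩

namespace Ctx

variable (c : Ctx)

/-- All loop lengths of the search, such as `d * d`, `d * m` and `d * d * d`, are instances. -/
theorem mul_le_L {x y z w : ℕ} (hx : x ≤ c.m + c.d + 2) (hy : y ≤ c.m + c.d + 2)
    (hz : z ≤ c.m + c.d + 2) (hw : w ≤ c.m + c.d + 2) : x * y * z * w ≤ c.L := by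
  refine le_trans ?_ c.size_le
  calc x * y * z * w ≤ (c.m + c.d + 2) * (c.m + c.d + 2) * (c.m + c.d + 2) * (c.m + c.d + 2) := by
        gcongr
    _ = _ := by ring

theorem d_mul_d_le : c.d * c.d ≤ c.L := by
  simpa using c.mul_le_L (x := c.d) (y := c.d) (z := 1) (w := 1) (by omega) (by omega) (by omega)
    (by omega)

theorem m_le : c.m ≤ c.L := by
  simpa using c.mul_le_L (x := c.m) (y := 1) (z := 1) (w := 1) (by omega) (by omega) (by omega)
    (by omega)

end Ctx

/-- Compute the weights of the exchange graph. -/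
def weightsProg : Prog :=
  .for cX (.var vD * .var vD)
    (.argmax aW aArg cE (.var vM) (.var cX)
      (.op .eq (.read aPart (.var cE)) (.read aPart (.read aB (.var cX / .var vD))))
      (.abs (.read aT ((.var cX - .var cX / .var vD * .var vD) * .var vM + .var cE))))

/-- The memory contains the weights of the exchange graph. -/
def Weights (c : Ctx) (b : Fin c.d → Fin c.m) (s : State) : Prop :=
  ∀ r t : Fin c.d, s aW ((r : ℕ) * c.d + (t : ℕ)) = wgt c.X c.part b r t ∧
    ∃ e : Fin c.m, s aArg ((r : ℕ) * c.d + (t : ℕ)) = (e : ℕ) ∧ c.part e = c.part (b r) ∧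
      (tab c.X b t e).natAbs = wgt c.X c.part b r t

/-- The case without candidates cannot occur, since `b r` lies in its own part; so a maximizer has
been stored. -/
theorem weights_of_isArgmax {c : Ctx} {b : Fin c.d → Fin c.m} {s s' : State} (hE : Env c s)
    (hT : Tableau c b s) (r t : Fin c.d) {A : ℤ}
    (h : IsArgmax aW aArg A c.m
      (fun e => s aPart (e : ℕ) = s aPart (s aB (r : ℕ)))
      (fun e => |s aT ((t : ℕ) * c.m + (e : ℕ))|) s') :
    s' aW A = wgt c.X c.part b r t ∧ ∃ e : Fin c.m, s' aArg A = (e : ℕ) ∧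
      c.part e = c.part (b r) ∧ (tab c.X b t e).natAbs = wgt c.X c.part b r t := by
  have hcf : ∀ e : Fin c.m, s aPart (e : ℕ) = s aPart (s aB (r : ℕ)) ↔ c.part e = c.part (b r) := by
    intro e
    rw [hT.1, hE.2.2, hE.2.2, Fin.ext_iff]
    norm_cast
  have hvf : ∀ e : Fin c.m, |s aT ((t : ℕ) * c.m + (e : ℕ))| = (tab c.X b t e).natAbs := by
    intro e
    rw [hT.2.1, Int.abs_eq_natAbs]
  obtain ⟨h1, h2⟩ := h
  rcases h2 with ⟨-, h2⟩ | ⟨e, he, h2, h3, h4⟩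
  · exact (h2 (b r) (b r).2 ((hcf _).2 rfl)).elim
  · lift e to Fin c.m using he
    simp only [hcf] at h2
    simp only [hvf] at h4
    have hw : (tab c.X b t e).natAbs = wgt c.X c.part b r t := by
      refine le_antisymm (natAbs_tab_le_wgt c.X c.part h2) (Finset.sup_le fun e' he' => ?_)
      have := h1 e' e'.2 ((hcf _).2 (by simpa using he'))
      simp only [hvf, h4] at this
      exact_mod_cast this
    exact ⟨by rw [h4, hw], e, h3, h2, hw⟩

theorem runs_weights : Runs Cfg.sz (fun i s => Env i.1 s ∧ Tableau i.1 i.2 s) weightsProg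
    (fun i _ s' => Weights i.1 i.2 s') := by
  refine Runs.of_bdd ?_
  refine Runs.for (Inv := fun i s k s' => (∀ a, a ∉ [aW, aArg, cX, cE] → s' a = s a) ∧
      ∀ r t : Fin i.1.d, (r : ℕ) * i.1.d + t < k →
        s' aW ((r : ℕ) * i.1.d + (t : ℕ)) = wgt i.1.X i.1.part i.2 r t ∧
        ∃ e : Fin i.1.m, s' aArg ((r : ℕ) * i.1.d + (t : ℕ)) = (e : ℕ) ∧
          i.1.part e = i.1.part (i.2 r) ∧ (tab i.1.X i.2 t e).natAbs = wgt i.1.X i.1.part i.2 r t)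
    (fun i _ => i.1.d * i.1.d) ?_ ?_ ?_ ?_ ?_ ?_
  · rintro ⟨c, b⟩ s - -
    exact c.d_mul_d_le
  · rintro ⟨c, b⟩ s s' - h -
    exact ⟨fun a ha => h a (by rintro rfl; simp at ha), fun r t h => by simp at h⟩
  · rintro ⟨c, b⟩ s k s₁ s₂ - h ⟨h1, h2⟩
    refine ⟨fun a ha => by rw [h a (by rintro rfl; simp at ha), h1 a ha], ?_⟩
    rw [h aW (by decide), h aArg (by decide)]
    exact h2
  · rintro ⟨c, b⟩ s k s' ⟨⟨hE, -⟩, -⟩ ⟨h1, -⟩ - -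
    simp [h1, hE.1]
  · refine Runs.of_bdd (Runs.choose_index (Runs.argmax (sz := fun j : Cfg × State × ℕ => j.1.1.L)
      (P := fun j s => (Env j.1.1 s ∧ Tableau j.1.1 j.1.2 s) ∧ Bdd j.1.1.L s ∧ s cX 0 = j.2.2 ∧
        j.2.2 < j.1.1.d * j.1.1.d)
      (by decide) (by decide) (by decide)
      (fun j _ => j.1.1.m) (fun j _ => j.2.2)
      (fun j s e => s aPart (e : ℕ) = s aPart (s aB ((j.2.2 / j.1.1.d : ℕ) : ℤ)))
      (fun j s e => |s aT (((j.2.2 % j.1.1.d : ℕ) : ℤ) * j.1.1.m + (e : ℕ))|) ?_ ?_ ?_ ?_ ?_) ?_)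
    · rintro ⟨⟨c, b⟩, s₀, k⟩ s - -
      exact c.m_le
    · rintro ⟨⟨c, b⟩, s₀, k⟩ s s' ⟨-, -, hk, -⟩ h
      simp only [Expr.eval_var]
      rw [h.eq (by decide), hk]
    · rintro ⟨⟨c, b⟩, s₀, k⟩ s s' ⟨⟨hE, -⟩, -, hk, -⟩ h
      simp only [Expr.eval_var]
      rw [h.eq (by decide), hE.2.1]
    · rintro ⟨⟨c, b⟩, s₀, k⟩ s s' e ⟨⟨hE, hT⟩, -, hk, hlt⟩ h hce he
      simp only [Expr.eval_op, Expr.eval_read, Expr.eval_var, Expr.eval_div, Expr.eval_abs,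
        Expr.eval_add, Expr.eval_mul, Expr.eval_sub, ne_eq, Op.eval_eq_eq_zero, not_not]
      rw [hce, h.eq (a := vD) (by decide), h.eq (a := vM) (by decide), h.eq (a := cX) (by decide),
        h.eq (a := aPart) (by decide), h.eq (a := aB) (by decide), h.eq (a := aT) (by decide), hk, hE.1, hE.2.1,
        natCast_sub_div_mul]
      exact ⟨Iff.rfl, fun _ => rfl⟩
    · rintro ⟨⟨c, b⟩, s₀, k⟩ s e ⟨-, hB, -⟩ - -
      exact ⟨abs_nonneg _, hB _ _⟩
    · rintro ⟨⟨c, b⟩, s₀, k⟩ s ⟨⟨⟨⟨hE, hT⟩, hB⟩, ⟨h1, h2⟩, hk, hlt⟩, hB'⟩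
      simp only at hE hT hB h1 h2 hk hlt
      have hE' := hE.congr (h1 vD (by decide)) (h1 vM (by decide)) (h1 aPart (by decide))
      have hT' := hT.congr (h1 aB (by decide)) (h1 aT (by decide)) (h1 vDet (by decide))
      refine ⟨(⟨c, b⟩, s₀, k), rfl, ⟨⟨hE', hT'⟩, hB', hk, hlt⟩, ?_⟩
      rintro s' ⟨h3, h4⟩ - -
      simp only at h3 h4 ⊢
      refine ⟨⟨fun a ha => ?_, fun r t hrt => ?_⟩, ?_⟩
      · simp only [List.mem_cons, List.not_mem_nil, or_false, not_or] at ha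
        rw [h3.eq (by simp [ha]), h1 a (by simp [ha])]
      · rcases Nat.lt_succ_iff_lt_or_eq.1 hrt with hlt' | rfl
        · have hne : ((r : ℕ) : ℤ) * c.d + (t : ℕ) ≠ (k : ℤ) := by exact_mod_cast hlt'.ne
          rw [h3 aW _ (fun h => hne h.2) (by decide), h3 aArg _ (fun h => hne h.2) (by decide)]
          exact h2 r t hlt'
        · rw [pair_div, pair_mod] at h4
          push_cast at h4
          exact weights_of_isArgmax hE' hT' r t h4
      · rw [h3.eq (by decide), hk]
  · rintro ⟨c, b⟩ s s' - ⟨-, h⟩ r t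
    exact h r t (pair_lt r t)

end DetMax

/-! ### Bounds on the stored numbers; thresholds and walks of length zero -/

namespace DetMax

open RAM Finset Function

theorem natAbs_bdet_le {d m : ℕ} {X : Fin m → Fin d → ℤ} {H : ℕ} (hX : ∀ e j, |X e j| ≤ H)
    (b : Fin d → Fin m) : (bdet X b).natAbs ≤ d.factorial * H ^ d := by
  have := abs_bdet_le X hX b
  rw [Int.abs_eq_natAbs] at this
  exact_mod_cast this

theorem walk_le {d : ℕ} {W : Fin d → Fin d → ℕ} {G : ℕ} (hW : ∀ r s, W r s ≤ G) (l : ℕ) :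
    ∀ i j, walk W l i j ≤ G ^ l := by
  induction l with
  | zero =>
    intro i j
    simp only [walk, pow_zero]
    split_ifs <;> simp
  | succ l ih =>
    intro i j
    rw [pow_succ]
    exact Finset.sup_le fun k _ => Nat.mul_le_mul (ih i k) (hW k j)

namespace Ctx

variable (c : Ctx)

theorem natAbs_bdet_le (b : Fin c.d → Fin c.m) :
    (bdet c.X b).natAbs ≤ c.d.factorial * c.H ^ c.d :=
  DetMax.natAbs_bdet_le c.abs_X_le b

theorem base_pos : 1 ≤ c.d.factorial * c.H ^ c.d :=
  Nat.mul_pos c.d.factorial_pos (pow_pos c.one_le_H _)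

/-- One inequality covers all large numbers of the search: determinants (`l = 1`), walk weights, and
the partial powers computed for the thresholds. The spare factor four is used to count the rounds.
-/
theorem le_two_pow {x l : ℕ} (hx : x ≤ ((c.d + 1) ^ 4 * (c.d.factorial * c.H ^ c.d)) ^ l)
    (hl : l ≤ c.d + 1) : 4 * x ≤ 2 ^ c.L := by
  refine le_trans ?_ c.bits_le
  refine Nat.mul_le_mul_left _ (hx.trans ?_)
  exact Nat.pow_le_pow_right (Nat.mul_pos (by positivity) c.base_pos) hl

theorem four_mul_natAbs_bdet_le (b : Fin c.d → Fin c.m) : 4 * (bdet c.X b).natAbs ≤ 2 ^ c.L := by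
  refine c.le_two_pow (l := 1) ((c.natAbs_bdet_le b).trans ?_) (by omega)
  rw [pow_one]
  exact Nat.le_mul_of_pos_left _ (by positivity)

theorem walk_le_two_pow (b : Fin c.d → Fin c.m) {l : ℕ} (hl : l ≤ c.d) (i j : Fin c.d) :
    4 * walk (wgt c.X c.part b) l i j ≤ 2 ^ c.L := by
  refine c.le_two_pow (l := l) (walk_le (fun r s => ?_) l i j) (by omega)
  refine Finset.sup_le fun e _ => (c.natAbs_bdet_le _).trans ?_
  exact Nat.le_mul_of_pos_left _ (by positivity)

theorem pow_le_two_pow (b : Fin c.d → Fin c.m) {l k : ℕ} (hl : l ≤ c.d) (hk : k ≤ c.d) :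
    4 * (c.d * l ^ 3 * (bdet c.X b).natAbs) ^ k ≤ 2 ^ c.L := by
  refine c.le_two_pow (l := k) (Nat.pow_le_pow_left ?_ k) (by omega)
  refine Nat.mul_le_mul ?_ (c.natAbs_bdet_le b)
  calc c.d * l ^ 3 ≤ (c.d + 1) * (c.d + 1) ^ 3 := by gcongr <;> omega
    _ = (c.d + 1) ^ 4 := by ring

end Ctx

/-- Compute the bounds on the weights of closed walks. -/
def thrProg : Prog :=
  .for cX (.var vD + .const 1) (.seq (.assign aThr (.var cX) (.const 1))
    (.for cE (.var cX) (.assign aThr (.var cX) (.read aThr (.var cX) *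
      (.var vD * (.var cX * .var cX * .var cX) * .abs (.var vDet))))))

theorem runs_thr : Runs Cfg.sz (fun i s => Env i.1 s ∧ Tableau i.1 i.2 s) thrProg
    (fun i _ s' => ∀ l : ℕ, l ≤ i.1.d → s' aThr l = thr i.1.X i.2 l) := by
  refine Runs.for (Inv := fun i s k s' => (∀ a, a ∉ [aThr, cX, cE] → s' a = s a) ∧
      ∀ l : ℕ, l < k → s' aThr l = thr i.1.X i.2 l)
    (fun i _ => i.1.d + 1) ?_ ?_ ?_ ?_ ?_ ?_
  · rintro ⟨c, b⟩ s - -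
    simpa using c.mul_le_L (x := c.d + 1) (y := 1) (z := 1) (w := 1) (by omega) (by omega)
      (by omega) (by omega)
  · rintro ⟨c, b⟩ s s' - h -
    exact ⟨fun a ha => h a (by rintro rfl; simp at ha), fun l h => by omega⟩
  · rintro ⟨c, b⟩ s k s₁ s₂ - h ⟨h1, h2⟩
    refine ⟨fun a ha => by rw [h a (by rintro rfl; simp at ha), h1 a ha], ?_⟩
    rw [h aThr (by decide)]
    exact h2
  · rintro ⟨c, b⟩ s k s' ⟨hE, -⟩ ⟨h1, -⟩ - -
    have := h1 vD (by decide)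
    simp [this, hE.1]
  · have hin : Runs (fun j : Cfg × ℕ => j.1.1.L)
        (fun j s => Env j.1.1 s ∧ Tableau j.1.1 j.1.2 s ∧ s cX 0 = j.2 ∧ j.2 ≤ j.1.1.d ∧
          s aThr (j.2 : ℕ) = 1)
        (.for cE (.var cX) (.assign aThr (.var cX) (.read aThr (.var cX) *
          (.var vD * (.var cX * .var cX * .var cX) * .abs (.var vDet)))))
        (fun j s s' => (∀ l : ℤ, l ≠ j.2 → s' aThr l = s aThr l) ∧
          s' aThr (j.2 : ℕ) = thr j.1.1.X j.1.2 j.2) := by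
      refine Runs.for (Inv := fun j s k s' => (∀ a, a ∉ [aThr, cE] → s' a = s a) ∧
          (∀ l : ℤ, l ≠ j.2 → s' aThr l = s aThr l) ∧
          s' aThr (j.2 : ℕ) = ((j.1.1.d * j.2 ^ 3 * (bdet j.1.1.X j.1.2).natAbs) ^ k : ℕ))
        (fun j _ => j.2) ?_ ?_ ?_ ?_ ?_ ?_
      · rintro ⟨⟨c, b⟩, l⟩ s ⟨-, -, -, hl, -⟩ -
        simpa using c.mul_le_L (x := l) (y := 1) (z := 1) (w := 1) (by simp only at hl; omega)
          (by omega) (by omega) (by omega)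
      · rintro ⟨⟨c, b⟩, l⟩ s s' ⟨-, -, -, -, h1⟩ h -
        refine ⟨fun a ha => h a (by rintro rfl; simp at ha), ?_⟩
        rw [h aThr (by decide)]
        exact ⟨fun _ _ => rfl, by simpa using h1⟩
      · rintro ⟨⟨c, b⟩, l⟩ s k s₁ s₂ - h ⟨h1, h2⟩
        refine ⟨fun a ha => by rw [h a (by rintro rfl; simp at ha), h1 a ha], ?_⟩
        rw [h aThr (by decide)]
        exact h2
      · rintro ⟨⟨c, b⟩, l⟩ s k s' ⟨-, -, hX, -⟩ ⟨h1, -⟩ - -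
        have := h1 cX (by decide)
        simp [this, hX]
      · refine Runs.straight trivial ?_
        rintro ⟨⟨⟨c, b⟩, l⟩, s₀, k⟩ s ⟨⟨hE, hT, hX, hl, -⟩, ⟨h1, h2, h3⟩, hc, hk⟩ hs
        simp only at hE hT hX hl h1 h2 h3 hc hk hs ⊢
        have e1 : s vD 0 = c.d := by rw [h1 vD (by decide), hE.1]
        have e2 : s cX 0 = l := by rw [h1 cX (by decide), hX]
        have e3 : s vDet 0 = bdet c.X b := by rw [h1 vDet (by decide), hT.2.2]
        have e4 : ((c.d * l ^ 3 * (bdet c.X b).natAbs) ^ k : ℕ) *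
            ((c.d : ℤ) * (l * l * l) * |bdet c.X b|)
            = ((c.d * l ^ 3 * (bdet c.X b).natAbs) ^ (k + 1) : ℕ) := by
          rw [Int.abs_eq_natAbs]
          push_cast
          ring
        simp only [Prog.run_assign, Expr.eval_var, Expr.eval_mul, Expr.eval_read, Expr.eval_abs,
          e1, e2, e3, h3, e4]
        refine ⟨⟨⟨fun a ha => ?_, fun x hx => ?_, by rw [State.write_same]⟩, ?_⟩, ?_⟩
        · rw [State.write_of_ne _ _ _ (by rintro rfl; simp at ha), h1 a ha]
        · rw [State.write_apply, if_neg (fun h => hx h.2), h2 x hx]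
        · rw [State.write_of_ne _ _ _ (by decide), hc]
        · refine hs.write _ _ ?_
          rw [abs_of_nonneg (by positivity)]
          have := c.pow_le_two_pow b hl (show k + 1 ≤ c.d by omega)
          exact_mod_cast (by omega :
            (c.d * l ^ 3 * (bdet c.X b).natAbs) ^ (k + 1) ≤ 2 ^ c.L)
      · rintro ⟨⟨c, b⟩, l⟩ s s' - ⟨-, h⟩
        exact h
    have hout : Runs (fun j : Cfg × State × ℕ => j.1.1.L)
        (fun j s => (Env j.1.1 s ∧ Tableau j.1.1 j.1.2 s) ∧ s cX 0 = j.2.2 ∧ j.2.2 ≤ j.1.1.d)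
        (.assign aThr (.var cX) (.const 1))
        (fun j s s' => s' = s.write aThr j.2.2 1) := by
      refine Runs.straight trivial ?_
      rintro ⟨⟨c, b⟩, s₀, k⟩ s ⟨-, hX, -⟩ hs
      simp only [Prog.run_assign, Expr.eval_var, hX, Expr.eval_const, true_and]
      exact hs.write _ _ (by simpa using one_le_pow₀ (by norm_num))
    refine (hout.seq (hin.comap fun j : Cfg × State × ℕ => (j.1, j.2.2)).frame ?_).choose_index ?_
    · rintro ⟨⟨c, b⟩, s₀, k⟩ s s' ⟨⟨hE, hT⟩, hX, hk⟩ rfl - -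
      refine ⟨hE.congr rfl rfl rfl, hT.congr rfl rfl rfl, hX, hk, by simp⟩
    · rintro ⟨⟨c, b⟩, s₀, k⟩ s ⟨⟨hE, hT⟩, ⟨h1, h2⟩, hX, hk⟩
      simp only at hE hT h1 h2 hX hk
      refine ⟨(⟨c, b⟩, s₀, k), rfl, ⟨⟨hE.congr (h1 _ (by decide)) (h1 _ (by decide))
        (h1 _ (by decide)), hT.congr (h1 _ (by decide)) (h1 _ (by decide)) (h1 _ (by decide))⟩, hX,
        Nat.lt_succ_iff.1 hk⟩, ?_⟩
      rintro s' ⟨s₁, rfl, -, ⟨⟨h3, h4⟩, h5⟩, -⟩ - -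
      simp only at h3 h4 h5 ⊢
      refine ⟨⟨fun a ha => ?_, fun l hl => ?_⟩, ?_⟩
      · simp only [List.mem_cons, List.not_mem_nil, or_false, not_or] at ha
        rw [h5 a (by simp [Prog.writes, Prog.for, Prog.set, ha]), State.write_of_ne _ _ _ ha.1,
          h1 a (by simp [ha])]
      · rcases Nat.lt_succ_iff_lt_or_eq.1 hl with h | rfl
        · have hne : (l : ℤ) ≠ k := by exact_mod_cast h.ne
          rw [h3 l hne, State.write_apply, if_neg (fun h => hne h.2), h2 l h]
        · exact h4
      · rw [h5 cX (by decide), State.write_of_ne _ _ _ (by decide), hX]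
  · rintro ⟨c, b⟩ s s' - ⟨-, h⟩ l hl
    exact h l (Nat.lt_succ_iff.2 hl)

/-- Weights of walks of length `0`. -/
def walkInitProg : Prog :=
  .for cX (.var vD * .var vD)
    (.assign aWalk (.var cX) (.op .eq (.var cX / .var vD) (.var cX - .var cX / .var vD * .var vD)))

theorem runs_walkInit : Runs Cfg.sz (fun i s => Env i.1 s) walkInitProg
    (fun i _ s' => ∀ r t : Fin i.1.d, s' aWalk ((r : ℕ) * i.1.d + (t : ℕ))
      = walk (wgt i.1.X i.1.part i.2) 0 r t) := by
  refine Runs.for (Inv := fun i s k s' => (∀ a, a ∉ [aWalk, cX] → s' a = s a) ∧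
      ∀ r t : Fin i.1.d, (r : ℕ) * i.1.d + t < k → s' aWalk ((r : ℕ) * i.1.d + (t : ℕ))
        = walk (wgt i.1.X i.1.part i.2) 0 r t)
    (fun i _ => i.1.d * i.1.d) ?_ ?_ ?_ ?_ ?_ ?_
  · rintro ⟨c, b⟩ s - -
    exact c.d_mul_d_le
  · rintro ⟨c, b⟩ s s' - h -
    exact ⟨fun a ha => h a (by rintro rfl; simp at ha), fun r t h => by omega⟩
  · rintro ⟨c, b⟩ s k s₁ s₂ - h ⟨h1, h2⟩
    refine ⟨fun a ha => by rw [h a (by rintro rfl; simp at ha), h1 a ha], ?_⟩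
    rw [h aWalk (by decide)]
    exact h2
  · rintro ⟨c, b⟩ s k s' hE ⟨h1, -⟩ - -
    have := h1 vD (by decide)
    simp [this, hE.1]
  · refine Runs.straight trivial ?_
    rintro ⟨⟨c, b⟩, s₀, k⟩ s ⟨hE, ⟨h1, h2⟩, hc, hk⟩ hs
    simp only at hE h1 h2 hc hk hs ⊢
    have e1 : s vD 0 = c.d := by rw [h1 vD (by decide), hE.1]
    simp only [Prog.run_assign, Expr.eval_var, Expr.eval_mul, Expr.eval_op, Expr.eval_div,
      Expr.eval_sub, hc, e1, natCast_sub_div_mul]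
    refine ⟨⟨⟨fun a ha => ?_, fun r t hrt => ?_⟩, ?_⟩, ?_⟩
    · rw [State.write_of_ne _ _ _ (by rintro rfl; simp at ha), h1 a ha]
    · rcases Nat.lt_succ_iff_lt_or_eq.1 hrt with h | rfl
      · have hne : ((r : ℕ) : ℤ) * c.d + (t : ℕ) ≠ (k : ℤ) := by exact_mod_cast h.ne
        rw [State.write_apply, if_neg (fun h => hne h.2), h2 r t h]
      · rw [pair_mod, ← Int.natCast_div, pair_div]
        push_cast
        rw [State.write_same, Op.eval, walk]
        by_cases h : r = t
        · simp [h]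
        · rw [if_neg h, if_neg fun h' => h (Fin.ext (by exact_mod_cast h'))]
          rfl
    · rw [State.write_of_ne _ _ _ (by decide), hc]
    · refine hs.write _ _ ?_
      rw [Op.eval]
      split_ifs
      · simpa using one_le_pow₀ (by norm_num)
      · simp
  · rintro ⟨c, b⟩ s s' - ⟨-, h⟩ r t
    exact h r t (pair_lt r t)

end DetMax

/-! ### Heaviest walks by dynamic programming, and detection of a violation -/

namespace DetMax

open RAM Finset Function

/-- Compute the largest weights of walks of length at most `d`. -/
def walkProg : Prog :=
  .for cX (.var vD * (.var vD * .var vD))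
    (.argmax aWalk aPred cE (.var vD) (.var cX + .var vD * .var vD) (.const 1)
      (.read aWalk (.var cX / .var vD * .var vD + .var cE) *
        .read aW (.var cE * .var vD + (.var cX - .var cX / .var vD * .var vD))))

/-- The memory contains the largest weights of walks of length at most `d`. -/
def Walks (c : Ctx) (b : Fin c.d → Fin c.m) (s : State) : Prop :=
  (∀ l ≤ c.d, ∀ r t : Fin c.d, s aWalk (((l : ℕ) * c.d + (r : ℕ)) * c.d + (t : ℕ))
      = walk (wgt c.X c.part b) l r t) ∧
  ∀ l < c.d, ∀ r t : Fin c.d, ∃ p : Fin c.d,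
    s aPred ((((l + 1 : ℕ) : ℤ) * c.d + (r : ℕ)) * c.d + (t : ℕ)) = (p : ℕ) ∧
    walk (wgt c.X c.part b) (l + 1) r t
      = walk (wgt c.X c.part b) l r p * wgt c.X c.part b p t

/-- Since every vertex is allowed as the last but one vertex of the walk, there is always a
candidate, and its index becomes the predecessor pointer. -/
theorem walk_of_isArgmax {d : ℕ} {W : Fin d → Fin d → ℕ} {l : ℕ} {r t : Fin d} {s s' : State}
    {A : ℤ} {f g : ℕ → ℤ} (hf : ∀ p : Fin d, s aWalk (f p) = walk W l r p)
    (hg : ∀ p : Fin d, s aW (g p) = W p t)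
    (h : IsArgmax aWalk aPred A d (fun _ => True) (fun p => s aWalk (f p) * s aW (g p)) s') :
    s' aWalk A = walk W (l + 1) r t ∧ ∃ p : Fin d, s' aPred A = (p : ℕ) ∧
      walk W (l + 1) r t = walk W l r p * W p t := by
  obtain ⟨h1, ⟨-, h2⟩ | ⟨p, hp, -, h2, h3⟩⟩ := h
  · exact (h2 r r.2 trivial).elim
  · lift p to Fin d using hp
    simp only [hf, hg] at h3
    have hw : walk W (l + 1) r t = walk W l r p * W p t := by
      refine le_antisymm (Finset.sup_le fun q _ => ?_) (walk_mul_le W l r p t)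
      have := h1 q q.2 trivial
      simp only [hf, hg, h3] at this
      exact_mod_cast this
    exact ⟨by rw [h3, hw]; push_cast; rfl, p, h2, hw⟩

theorem runs_walk : Runs Cfg.sz (fun i s => Env i.1 s ∧ Weights i.1 i.2 s ∧
      ∀ r t : Fin i.1.d, s aWalk ((r : ℕ) * i.1.d + (t : ℕ))
        = walk (wgt i.1.X i.1.part i.2) 0 r t) walkProg
    (fun i _ s' => Walks i.1 i.2 s') := by
  refine Runs.for (Inv := fun i s k s' => (∀ a, a ∉ [aWalk, aPred, cX, cE] → s' a = s a) ∧
      (∀ (l : ℕ) (r t : Fin i.1.d), (l * i.1.d + r) * i.1.d + t < k + i.1.d * i.1.d →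
        s' aWalk (((l : ℕ) * i.1.d + (r : ℕ)) * i.1.d + (t : ℕ))
          = walk (wgt i.1.X i.1.part i.2) l r t) ∧
      ∀ (l : ℕ) (r t : Fin i.1.d), (l * i.1.d + r) * i.1.d + t < k → ∃ p : Fin i.1.d,
        s' aPred ((((l + 1 : ℕ) : ℤ) * i.1.d + (r : ℕ)) * i.1.d + (t : ℕ)) = (p : ℕ) ∧
        walk (wgt i.1.X i.1.part i.2) (l + 1) r t
          = walk (wgt i.1.X i.1.part i.2) l r p * wgt i.1.X i.1.part i.2 p t)
    (fun i _ => i.1.d * (i.1.d * i.1.d)) ?_ ?_ ?_ ?_ ?_ ?_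
  · rintro ⟨c, b⟩ s - -
    simpa [mul_assoc] using c.mul_le_L (x := c.d) (y := c.d) (z := c.d) (w := 1) (by omega)
      (by omega) (by omega) (by omega)
  · rintro ⟨c, b⟩ s s' ⟨-, -, h0⟩ h -
    refine ⟨fun a ha => h a (by rintro rfl; simp at ha), fun l r t hl => ?_,
      fun l r t h => by omega⟩
    obtain rfl : l = 0 := by
      by_contra hl0
      have h1 : 1 * c.d ≤ l * c.d := Nat.mul_le_mul_right _ (by omega)
      have h2 : 1 * c.d * c.d ≤ (l * c.d + r) * c.d := Nat.mul_le_mul_right _ (by omega)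
      simp only [one_mul] at h2
      simp only at hl
      omega
    rw [h aWalk (by decide)]
    simpa using h0 r t
  · rintro ⟨c, b⟩ s k s₁ s₂ - h ⟨h1, h2⟩
    refine ⟨fun a ha => by rw [h a (by rintro rfl; simp at ha), h1 a ha], ?_⟩
    rw [h aWalk (by decide), h aPred (by decide)]
    exact h2
  · rintro ⟨c, b⟩ s k s' ⟨hE, -⟩ ⟨h1, -⟩ - -
    have := h1 vD (by decide)
    simp [this, hE.1]
  · refine Runs.choose_index (Runs.argmax (sz := fun j : Cfg × State × ℕ => j.1.1.L)
      (P := fun j s => Env j.1.1 s ∧ s cX 0 = j.2.2 ∧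
        j.2.2 < j.1.1.d * (j.1.1.d * j.1.1.d) ∧
        ∀ p : ℕ, p < j.1.1.d →
          0 ≤ s aWalk ((j.2.2 / j.1.1.d : ℕ) * j.1.1.d + p) *
            s aW ((p : ℤ) * j.1.1.d + (j.2.2 % j.1.1.d : ℕ)) ∧
          s aWalk ((j.2.2 / j.1.1.d : ℕ) * j.1.1.d + p) *
            s aW ((p : ℤ) * j.1.1.d + (j.2.2 % j.1.1.d : ℕ)) ≤ 2 ^ j.1.1.L)
      (by decide) (by decide) (by decide)
      (fun j _ => j.1.1.d) (fun j _ => j.2.2 + j.1.1.d * j.1.1.d)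
      (fun j s e => True)
      (fun j s p => s aWalk ((j.2.2 / j.1.1.d : ℕ) * j.1.1.d + p) *
            s aW ((p : ℤ) * j.1.1.d + (j.2.2 % j.1.1.d : ℕ))) ?_ ?_ ?_ ?_ ?_) ?_
    · rintro ⟨⟨c, b⟩, s₀, k⟩ s - -
      simpa using c.mul_le_L (x := c.d) (y := 1) (z := 1) (w := 1) (by omega) (by omega)
        (by omega) (by omega)
    · rintro ⟨⟨c, b⟩, s₀, k⟩ s s' ⟨hE, hk, -⟩ h
      simp only [Expr.eval_var, Expr.eval_add, Expr.eval_mul]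
      rw [h.eq (by decide), h.eq (by decide), hk, hE.1]
    · rintro ⟨⟨c, b⟩, s₀, k⟩ s s' ⟨hE, hk, -⟩ h
      simp only [Expr.eval_var]
      rw [h.eq (by decide), hE.1]
    · rintro ⟨⟨c, b⟩, s₀, k⟩ s s' e ⟨hE, hk, hlt, -⟩ h hce he
      simp only at hE hk hlt he h
      refine ⟨by simp, fun _ => ?_⟩
      simp only [Expr.eval_read, Expr.eval_var, Expr.eval_div, Expr.eval_add, Expr.eval_mul,
        Expr.eval_sub]
      rw [hce, h.eq (a := vD) (by decide), h.eq (a := cX) (by decide), h.eq (a := aW) (by decide),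
        hk, hE.1, natCast_sub_div_mul, h aWalk _ _ (by decide)]
      · rfl
      -- Writing goes to the next layer, `d * d` cells further on, while reading stays below `k + d
      -- * d`; so the cell under construction is never read as input.
      · rintro ⟨-, h'⟩
        have h1 : k / c.d * c.d + e = k + c.d * c.d := by exact_mod_cast h'
        have h2 : k / c.d * c.d ≤ k := Nat.div_mul_le_self k c.d
        have h3 : c.d * 1 ≤ c.d * c.d := Nat.mul_le_mul_left _ (by omega)
        omega
    · rintro ⟨⟨c, b⟩, s₀, k⟩ s e ⟨-, -, -, h⟩ he -
      exact h e he
    · rintro ⟨⟨c, b⟩, s₀, k⟩ s ⟨⟨hE, hW, -⟩, ⟨h1, h2, h2'⟩, hk, hlt⟩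
      simp only at hE hW h1 h2 h2' hk hlt
      have hE' := hE.congr (h1 vD (by decide)) (h1 vM (by decide)) (h1 aPart (by decide))
      obtain ⟨z, t, rfl, -, -⟩ := exists_fin_pair (a := c.d * c.d) (m := c.d) (k := k)
        (by rwa [mul_assoc])
      obtain ⟨z, hz⟩ := z
      obtain ⟨l, r, rfl, -, -⟩ := exists_fin_pair hz
      simp only at hlt hk h2 h2'
      have hd1 : 1 ≤ c.d := by
        have := t.2
        omega
      have hsq : c.d * 1 ≤ c.d * c.d := Nat.mul_le_mul_left _ hd1
      have hf : ∀ p : Fin c.d, s aWalk ((((l : ℕ) * c.d + (r : ℕ) : ℕ) : ℤ) * c.d + (p : ℕ))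
          = walk (wgt c.X c.part b) l r p := by
        intro p
        have := h2 l r p (by have := p.2; omega)
        exact_mod_cast this
      have hg : ∀ p : Fin c.d, s aW ((p : ℕ) * c.d + (t : ℕ)) = wgt c.X c.part b p t := by
        intro p
        rw [h1 aW (by decide)]
        exact (hW p t).1
      refine ⟨(⟨c, b⟩, s₀, _), rfl, ⟨hE', hk, hlt, fun p hp => ?_⟩, ?_⟩
      · simp only
        rw [pair_div, pair_mod]
        have h3 := hf ⟨p, hp⟩
        have h4 := hg ⟨p, hp⟩
        simp only at h3 h4
        rw [h3, h4]
        refine ⟨by positivity, ?_⟩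
        have h5 := walk_mul_le (wgt c.X c.part b) l r ⟨p, hp⟩ t
        have h6 := c.walk_le_two_pow b (show (l : ℕ) + 1 ≤ c.d from l.2) r t
        exact_mod_cast (by omega : walk (wgt c.X c.part b) l r ⟨p, hp⟩ *
          wgt c.X c.part b ⟨p, hp⟩ t ≤ 2 ^ c.L)
      · rintro s' ⟨h3, h4⟩ - -
        simp only at h3 h4 ⊢
        rw [pair_div, pair_mod] at h4
        have h5 := walk_of_isArgmax (f := fun p : ℕ =>
          (((l : ℕ) * c.d + (r : ℕ) : ℕ) : ℤ) * c.d + (p : ℕ))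
          (g := fun p : ℕ => (p : ℤ) * c.d + (t : ℕ)) hf hg h4
        have hAd : (((l : ℕ) * c.d + (r : ℕ)) * c.d + (t : ℕ)) + c.d * c.d
            = (((l : ℕ) + 1) * c.d + (r : ℕ)) * c.d + (t : ℕ) := by ring
        refine ⟨⟨fun a ha => ?_, fun l' r' t' h' => ?_, fun l' r' t' h' => ?_⟩, ?_⟩
        · simp only [List.mem_cons, List.not_mem_nil, or_false, not_or] at ha
          rw [h3.eq (by simp [ha]), h1 a (by simp [ha])]
        · rcases Nat.lt_or_ge ((l' * c.d + r') * c.d + t')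
            ((((l : ℕ) * c.d + (r : ℕ)) * c.d + (t : ℕ)) + c.d * c.d) with h | h
          · rw [h3 aWalk _ _ (by decide)]
            · exact h2 l' r' t' h
            · rintro ⟨-, h6⟩
              exact h.ne (by exact_mod_cast h6)
          · have h6 : (l' * c.d + r') * c.d + t'
                = (((l : ℕ) + 1) * c.d + (r : ℕ)) * c.d + (t : ℕ) := by omega
            obtain ⟨h7, rfl⟩ := pair_inj h6
            obtain ⟨rfl, rfl⟩ := pair_inj h7
            rw [← h5.1]
            congr 1
            push_cast
            ring
        · rcases Nat.lt_succ_iff_lt_or_eq.1 h' with h | h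
          · rw [h3 aPred _ _ (by decide)]
            · exact h2' l' r' t' h
            · rintro ⟨-, h6⟩
              have h7 : ((l' + 1) * c.d + r') * c.d + t'
                = (((l : ℕ) * c.d + (r : ℕ)) * c.d + (t : ℕ)) + c.d * c.d := by exact_mod_cast h6
              have h8 : ((l' + 1) * c.d + r') * c.d + t'
                = ((l' * c.d + r') * c.d + t') + c.d * c.d := by ring
              omega
          · obtain ⟨h7, rfl⟩ := pair_inj h
            obtain ⟨rfl, rfl⟩ := pair_inj h7
            obtain ⟨p, h8, h9⟩ := h5.2
            refine ⟨p, ?_, h9⟩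
            rw [← h8]
            congr 1
            push_cast
            ring
        · rw [h3.eq (by decide), hk]
  · rintro ⟨c, b⟩ s s' - ⟨-, h, h'⟩
    refine ⟨fun l hl r t => h l r t ?_, fun l hl r t => h' l r t ?_⟩
    · have h1 := pair_lt (⟨l, Nat.lt_succ_of_le hl⟩ : Fin (c.d + 1)) r
      have h2 := pair_lt (⟨_, h1⟩ : Fin ((c.d + 1) * c.d)) t
      simp only at h2 ⊢
      calc _ < (c.d + 1) * c.d * c.d := h2
        _ = _ := by ring
    · have h1 := pair_lt (⟨l, hl⟩ : Fin c.d) r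
      have h2 := pair_lt (⟨_, h1⟩ : Fin (c.d * c.d)) t
      simp only at h2 ⊢
      rwa [← mul_assoc]

/-- Find a shortest closed walk of large weight. -/
def findProg : Prog :=
  .for cX (.var vD * .var vD)
    (.ite (.var vFlag) .skip
      (.ite (.op .lt (.read aThr (.var cX / .var vD + .const 1))
          (.read aWalk (((.var cX / .var vD + .const 1) * .var vD
            + (.var cX - .var cX / .var vD * .var vD)) * .var vD
            + (.var cX - .var cX / .var vD * .var vD))))
        (.seq (.set vFlag (.var cX / .var vD + .const 1))
          (.set vSrc (.var cX - .var cX / .var vD * .var vD)))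
        .skip))

/-- The outcome of the search for a closed walk of large weight. -/
def Found (c : Ctx) (b : Fin c.d → Fin c.m) (s : State) : Prop :=
  (s vFlag 0 = 0 ∧ LocallyOptimal c.X c.part b) ∨
  ∃ (l : ℕ) (i : Fin c.d), 1 ≤ l ∧ l ≤ c.d ∧ s vFlag 0 = l ∧ s vSrc 0 = (i : ℕ) ∧
    thr c.X b l < walk (wgt c.X c.part b) l i i ∧
    ∀ a, 1 ≤ a → a < l → ∀ j, walk (wgt c.X c.part b) a j j ≤ thr c.X b a

/-- Lengths are scanned in increasing order and nothing is recorded after the first hit, so the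
recorded length is minimal. The flag holds the length itself, which is nonzero. -/
theorem runs_find : Runs Cfg.sz (fun i s => Env i.1 s ∧ Walks i.1 i.2 s ∧
      (∀ l : ℕ, l ≤ i.1.d → s aThr l = thr i.1.X i.2 l) ∧ s vFlag 0 = 0) findProg
    (fun i _ s' => Found i.1 i.2 s') := by
  refine Runs.for (Inv := fun i s k s' => (∀ a, a ∉ [vFlag, vSrc, cX] → s' a = s a) ∧
      ((s' vFlag 0 = 0 ∧ ∀ (a : ℕ) (j : Fin i.1.d), a * i.1.d + j < k →
        walk (wgt i.1.X i.1.part i.2) (a + 1) j j ≤ thr i.1.X i.2 (a + 1)) ∨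
      ∃ (l : ℕ) (r : Fin i.1.d), 1 ≤ l ∧ l ≤ i.1.d ∧ s' vFlag 0 = l ∧ s' vSrc 0 = (r : ℕ) ∧
        thr i.1.X i.2 l < walk (wgt i.1.X i.1.part i.2) l r r ∧
        ∀ a, 1 ≤ a → a < l → ∀ j, walk (wgt i.1.X i.1.part i.2) a j j ≤ thr i.1.X i.2 a))
    (fun i _ => i.1.d * i.1.d) ?_ ?_ ?_ ?_ ?_ ?_
  · rintro ⟨c, b⟩ s - -
    exact c.d_mul_d_le
  · rintro ⟨c, b⟩ s s' ⟨-, -, -, h0⟩ h -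
    refine ⟨fun a ha => h a (by rintro rfl; simp at ha), Or.inl ⟨?_, fun a j h => by omega⟩⟩
    rw [h vFlag (by decide), h0]
  · rintro ⟨c, b⟩ s k s₁ s₂ - h ⟨h1, h2⟩
    refine ⟨fun a ha => by rw [h a (by rintro rfl; simp at ha), h1 a ha], ?_⟩
    rw [h vFlag (by decide), h vSrc (by decide)]
    exact h2
  · rintro ⟨c, b⟩ s k s' ⟨hE, -⟩ ⟨h1, -⟩ - -
    have := h1 vD (by decide)
    simp [this, hE.1]
  · refine Runs.straight ⟨trivial, ⟨trivial, trivial⟩, trivial⟩ ?_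
    rintro ⟨⟨c, b⟩, s₀, k⟩ s ⟨⟨hE, hW, hT, -⟩, ⟨h1, h2⟩, hc, hk⟩ hs
    simp only at hE hW hT h1 h2 hc hk hs ⊢
    have e1 : s vD 0 = c.d := by rw [h1 vD (by decide), hE.1]
    rcases h2 with ⟨h2, h3⟩ | h2
    · rw [Prog.run_ite_zero (by simpa using h2)]
      obtain ⟨l, r, rfl, -, -⟩ := exists_fin_pair hk
      have ed : s cX 0 / c.d = (l : ℕ) := by
        rw [hc, ← Int.natCast_div, pair_div]
      have em : s cX 0 - (l : ℕ) * c.d = (r : ℕ) := by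
        rw [← ed, hc, natCast_sub_div_mul, pair_mod]
      have hthr : s aThr ((l : ℕ) + 1) = thr c.X b (l + 1) := by
        rw [h1 aThr (by decide)]
        exact_mod_cast hT (l + 1) l.2
      have hwalk : s aWalk ((((l : ℕ) + 1) * c.d + (r : ℕ)) * c.d + (r : ℕ))
          = walk (wgt c.X c.part b) (l + 1) r r := by
        rw [h1 aWalk (by decide)]
        exact_mod_cast hW.1 (l + 1) l.2 r r
      by_cases hlt : walk (wgt c.X c.part b) (l + 1) r r ≤ thr c.X b (l + 1)
      · rw [Prog.run_ite_zero, Prog.run_skip]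
        · refine ⟨⟨⟨h1, Or.inl ⟨h2, fun a j haj => ?_⟩⟩, hc⟩, hs⟩
          rcases Nat.lt_succ_iff_lt_or_eq.1 haj with h | h
          · exact h3 a j h
          · obtain ⟨rfl, rfl⟩ := pair_inj h
            exact hlt
        · simp only [Expr.eval_op, Expr.eval_read, Expr.eval_add, Expr.eval_sub, Expr.eval_mul,
            Expr.eval_div, Expr.eval_var, Expr.eval_const, e1, ed, em, hthr, hwalk,
            Op.eval_lt_eq_zero]
          exact_mod_cast hlt
      · rw [Prog.run_ite_ne]
        · simp only [Prog.run_seq, Prog.run_set, Expr.eval_add, Expr.eval_sub, Expr.eval_mul,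
            Expr.eval_div, Expr.eval_var, Expr.eval_const, e1, ed, State.write_of_ne _ _ _
            (show cX ≠ vFlag by decide), State.write_of_ne _ _ _ (show vD ≠ vFlag by decide), em]
          refine ⟨⟨⟨fun a ha => ?_, Or.inr ⟨l + 1, r, by omega, l.2, ?_, ?_,
            not_le.1 hlt, ?_⟩⟩, ?_⟩,
            ?_⟩
          · simp only [List.mem_cons, List.not_mem_nil, or_false, not_or] at ha
            rw [State.write_of_ne _ _ _ ha.2.1, State.write_of_ne _ _ _ ha.1, h1 a (by simp [ha])]
          · rw [State.write_of_ne _ _ _ (by decide), State.write_same]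
            push_cast
            rfl
          · rw [State.write_same]
          · intro a h1a hal j
            obtain ⟨a, rfl⟩ := Nat.exists_eq_add_of_le' h1a
            refine h3 a j ?_
            have h4 : (a + 1) * c.d ≤ l * c.d := Nat.mul_le_mul_right _ (by omega)
            have h5 : (a + 1) * c.d = a * c.d + c.d := by ring
            have := j.2
            omega
          · rw [State.write_of_ne _ _ _ (by decide), State.write_of_ne _ _ _ (by decide), hc]
          · have hb : c.d ≤ 2 ^ c.L := by
              have : c.d ≤ c.L := by
                simpa using c.mul_le_L (x := c.d) (y := 1) (z := 1) (w := 1) (by omega) (by omega)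
                  (by omega) (by omega)
              exact this.trans Nat.lt_two_pow_self.le
            refine (hs.write _ _ ?_).write _ _ ?_
            · rw [abs_of_nonneg (by positivity)]
              exact_mod_cast (show (l : ℕ) + 1 ≤ c.d from l.2).trans hb
            · rw [abs_of_nonneg (by positivity)]
              exact_mod_cast r.2.le.trans hb
        · simp only [Expr.eval_op, Expr.eval_read, Expr.eval_add, Expr.eval_sub, Expr.eval_mul,
            Expr.eval_div, Expr.eval_var, Expr.eval_const, e1, ed, em, hthr, hwalk, ne_eq,
            Op.eval_lt_eq_zero]
          exact_mod_cast hlt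
    · rw [Prog.run_ite_ne, Prog.run_skip]
      · exact ⟨⟨⟨h1, Or.inr h2⟩, hc⟩, hs⟩
      · obtain ⟨l, r, h3, -, h4, -⟩ := h2
        rw [Expr.eval_var, h4]
        exact_mod_cast (by omega : l ≠ 0)
  · rintro ⟨c, b⟩ s s' - ⟨-, h⟩
    rcases h with ⟨h1, h2⟩ | h
    · refine Or.inl ⟨h1, fun l h3 h4 i => ?_⟩
      obtain ⟨a, rfl⟩ := Nat.exists_eq_add_of_le' h3
      exact h2 a i (pair_lt (⟨a, h4⟩ : Fin c.d) i)
    · exact Or.inr h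

end DetMax

/-! ### Updating the stored tableau by a pivot -/

namespace DetMax

open RAM Finset Function

namespace Ctx

variable (c : Ctx)

theorem d_mul_m_le : c.d * c.m ≤ c.L := by
  simpa using c.mul_le_L (x := c.d) (y := c.m) (z := 1) (w := 1) (by omega) (by omega) (by omega)
    (by omega)

theorem d_le : c.d ≤ c.L := by
  simpa using c.mul_le_L (x := c.d) (y := 1) (z := 1) (w := 1) (by omega) (by omega) (by omega)
    (by omega)

theorem abs_bdet_le_two_pow (b : Fin c.d → Fin c.m) : |bdet c.X b| ≤ 2 ^ c.L := by
  rw [Int.abs_eq_natAbs]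
  have := c.four_mul_natAbs_bdet_le b
  exact_mod_cast (by omega : (bdet c.X b).natAbs ≤ 2 ^ c.L)

theorem abs_natCast_le {k : ℕ} (h : k ≤ c.L) : |(k : ℤ)| ≤ 2 ^ c.L := by
  rw [abs_of_nonneg (by positivity)]
  exact_mod_cast h.trans Nat.lt_two_pow_self.le

end Ctx

/-- A basis together with a row and an element entering the basis there. -/
abbrev Pivot : Type := (i : Cfg) × Fin i.1.d × Fin i.1.m

/-- Compute the tableau after a pivot. -/
def newTableauProg : Prog :=
  .for cX (.var vD * .var vM)
    (.ite (.op .eq (.var cX / .var vM) (.var vCur))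
      (.assign aNew (.var cX) (.read aT (.var cX)))
      (.assign aNew (.var cX)
        ((.read aT (.var cX) * .read aT (.var vCur * .var vM + .var vPiv)
          - .read aT (.var cX / .var vM * .var vM + .var vPiv)
            * .read aT (.var vCur * .var vM + (.var cX - .var cX / .var vM * .var vM)))
          / .var vDet)))

/-- Outside the pivot row the numerator is the determinant times the new entry, so the integer
division is exact. The new entries are again determinants of selected vectors, hence their size does
not grow with the number of pivots. -/
theorem runs_newTableau : Runs (fun j : Pivot => j.1.1.L)
    (fun j s => Env j.1.1 s ∧ Tableau j.1.1 j.1.2 s ∧ bdet j.1.1.X j.1.2 ≠ 0 ∧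
      s vCur 0 = (j.2.1 : ℕ) ∧ s vPiv 0 = (j.2.2 : ℕ)) newTableauProg
    (fun j _ s' => ∀ (r : Fin j.1.1.d) (e : Fin j.1.1.m), s' aNew ((r : ℕ) * j.1.1.m + (e : ℕ))
      = tab j.1.1.X (update j.1.2 j.2.1 j.2.2) r e) := by
  refine Runs.for (Inv := fun j s k s' => (∀ a, a ∉ [aNew, cX] → s' a = s a) ∧
      ∀ (r : Fin j.1.1.d) (e : Fin j.1.1.m), (r : ℕ) * j.1.1.m + e < k →
        s' aNew ((r : ℕ) * j.1.1.m + (e : ℕ)) = tab j.1.1.X (update j.1.2 j.2.1 j.2.2) r e)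
    (fun j _ => j.1.1.d * j.1.1.m) ?_ ?_ ?_ ?_ ?_ ?_
  · rintro ⟨⟨c, b⟩, x, v⟩ s - -
    exact c.d_mul_m_le
  · rintro ⟨⟨c, b⟩, x, v⟩ s s' - h -
    exact ⟨fun a ha => h a (by rintro rfl; simp at ha), fun r t h => by omega⟩
  · rintro ⟨⟨c, b⟩, x, v⟩ s k s₁ s₂ - h ⟨h1, h2⟩
    refine ⟨fun a ha => by rw [h a (by rintro rfl; simp at ha), h1 a ha], ?_⟩
    rw [h aNew (by decide)]
    exact h2
  · rintro ⟨⟨c, b⟩, x, v⟩ s k s' ⟨hE, -⟩ ⟨h1, -⟩ - -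
    have e1 := h1 vD (by decide)
    have e2 := h1 vM (by decide)
    simp [e1, e2, hE.1, hE.2.1]
  · refine Runs.straight ⟨trivial, trivial⟩ ?_
    rintro ⟨⟨⟨c, b⟩, x, v⟩, s₀, k⟩ s ⟨⟨hE, hT, hb, hx, hv⟩, ⟨h1, h2⟩, hc, hk⟩ hs
    simp only at hE hT hb hx hv h1 h2 hc hk hs ⊢
    obtain ⟨r, e, rfl, -, -⟩ := exists_fin_pair hk
    have e1 : s vM 0 = c.m := by rw [h1 vM (by decide), hE.2.1]
    have e2 : s vCur 0 = (x : ℕ) := by rw [h1 vCur (by decide), hx]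
    have e3 : s vPiv 0 = (v : ℕ) := by rw [h1 vPiv (by decide), hv]
    have e4 : s vDet 0 = bdet c.X b := by rw [h1 vDet (by decide), hT.2.2]
    have e5 : ∀ (r : Fin c.d) (e : Fin c.m), s aT ((r : ℕ) * c.m + (e : ℕ)) = tab c.X b r e := by
      rw [h1 aT (by decide)]
      exact hT.2.1
    have ed : s cX 0 / c.m = (r : ℕ) := by
      rw [hc, ← Int.natCast_div, pair_div]
    have em : s cX 0 - (r : ℕ) * c.m = (e : ℕ) := by
      rw [← ed, hc, natCast_sub_div_mul, pair_mod]
    have ec : s aT (s cX 0) = tab c.X b r e := by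
      rw [hc, ← e5]
      push_cast
      rfl
    have hrun : (Prog.ite (.op .eq (.var cX / .var vM) (.var vCur))
        (.assign aNew (.var cX) (.read aT (.var cX)))
        (.assign aNew (.var cX)
          ((.read aT (.var cX) * .read aT (.var vCur * .var vM + .var vPiv)
            - .read aT (.var cX / .var vM * .var vM + .var vPiv)
              * .read aT (.var vCur * .var vM + (.var cX - .var cX / .var vM * .var vM)))
            / .var vDet))).run s
        = s.write aNew (((r : ℕ) * c.m + (e : ℕ) : ℕ) : ℤ) (tab c.X (update b x v) r e) := by
      by_cases hrx : r = x
      · subst hrx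
        rw [Prog.run_ite_ne, tab_update_same]
        · simp only [Prog.run_assign, Expr.eval_var, Expr.eval_read]
          rw [ec, hc]
        · simp only [Expr.eval_op, Expr.eval_div, Expr.eval_var, e1, e2, ed, ne_eq,
            Op.eval_eq_eq_zero, not_not]
      · rw [Prog.run_ite_zero]
        · simp only [Prog.run_assign, Expr.eval_var, Expr.eval_read, Expr.eval_div, Expr.eval_sub,
            Expr.eval_mul, Expr.eval_add, e1, e2, e3, e4, ed, em, e5, ec]
          rw [← bdet_mul_tab_update c.X b hrx, Int.mul_ediv_cancel_left _ hb, hc]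
        · simp only [Expr.eval_op, Expr.eval_div, Expr.eval_var, e1, e2, ed, Op.eval_eq_eq_zero]
          exact fun h => hrx (Fin.ext (by exact_mod_cast h))
    rw [hrun]
    refine ⟨⟨⟨fun a ha => ?_, fun r' e' h' => ?_⟩, ?_⟩, ?_⟩
    · rw [State.write_of_ne _ _ _ (by rintro rfl; simp at ha), h1 a ha]
    · rcases Nat.lt_succ_iff_lt_or_eq.1 h' with h | h
      · rw [State.write_apply, if_neg, h2 r' e' h]
        rintro ⟨-, h3⟩
        exact h.ne (by exact_mod_cast h3)
      · obtain ⟨h3, rfl⟩ := pair_inj h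
        obtain rfl := Fin.ext h3
        push_cast
        rw [State.write_same]
    · rw [State.write_of_ne _ _ _ (by decide), hc]
    · exact hs.write _ _ (c.abs_bdet_le_two_pow _)
  · rintro ⟨⟨c, b⟩, x, v⟩ s s' - ⟨-, h⟩ r t
    exact h r t (pair_lt r t)

/-- Replace the tableau by the new one. -/
def copyProg : Prog :=
  .for cX (.var vD * .var vM) (.assign aT (.var cX) (.read aNew (.var cX)))

theorem runs_copy : Runs Ctx.L Env copyProg
    (fun c s s' => ∀ (r : Fin c.d) (e : Fin c.m), s' aT ((r : ℕ) * c.m + (e : ℕ))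
      = s aNew ((r : ℕ) * c.m + (e : ℕ))) := by
  refine Runs.for (Inv := fun c s k s' => (∀ a, a ∉ [aT, cX] → s' a = s a) ∧
      ∀ (r : Fin c.d) (e : Fin c.m), (r : ℕ) * c.m + e < k →
        s' aT ((r : ℕ) * c.m + (e : ℕ)) = s aNew ((r : ℕ) * c.m + (e : ℕ)))
    (fun c _ => c.d * c.m) ?_ ?_ ?_ ?_ ?_ ?_
  · rintro c s - -
    exact c.d_mul_m_le
  · rintro c s s' - h -
    exact ⟨fun a ha => h a (by rintro rfl; simp at ha), fun r t h => by omega⟩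
  · rintro c s k s₁ s₂ - h ⟨h1, h2⟩
    refine ⟨fun a ha => by rw [h a (by rintro rfl; simp at ha), h1 a ha], ?_⟩
    rw [h aT (by decide)]
    exact h2
  · rintro c s k s' hE ⟨h1, -⟩ - -
    have e1 := h1 vD (by decide)
    have e2 := h1 vM (by decide)
    simp [e1, e2, hE.1, hE.2.1]
  · refine Runs.straight trivial ?_
    rintro ⟨c, s₀, k⟩ s ⟨hE, ⟨h1, h2⟩, hc, hk⟩ hs
    simp only at hE h1 h2 hc hk hs ⊢
    simp only [Prog.run_assign, Expr.eval_var, Expr.eval_read, hc]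
    refine ⟨⟨⟨fun a ha => ?_, fun r' e' h' => ?_⟩, ?_⟩, ?_⟩
    · rw [State.write_of_ne _ _ _ (by rintro rfl; simp at ha), h1 a ha]
    · rcases Nat.lt_succ_iff_lt_or_eq.1 h' with h | h
      · rw [State.write_apply, if_neg, h2 r' e' h]
        rintro ⟨-, h3⟩
        exact h.ne (by exact_mod_cast h3)
      · rw [← h, h1 aNew (by decide)]
        push_cast
        rw [State.write_same]
    · rw [State.write_of_ne _ _ _ (by decide), hc]
    · exact hs.write _ _ (hs _ _)
  · rintro c s s' - ⟨-, h⟩ r t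
    exact h r t (pair_lt r t)

/-- Perform a pivot. -/
def pivotProg : Prog :=
  .seq newTableauProg (.seq (.set vDet (.read aT (.var vCur * .var vM + .var vPiv)))
    (.seq copyProg (.assign aB (.var vCur) (.var vPiv))))

/-- The order matters: the new table needs the old table and the old determinant, and the new
determinant is the old entry at the pivot position, so it is read before the old table is
overwritten. -/
theorem runs_pivot : Runs (fun j : Pivot => j.1.1.L)
    (fun j s => Env j.1.1 s ∧ Tableau j.1.1 j.1.2 s ∧ bdet j.1.1.X j.1.2 ≠ 0 ∧
      s vCur 0 = (j.2.1 : ℕ) ∧ s vPiv 0 = (j.2.2 : ℕ)) pivotProg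
    (fun j _ s' => Tableau j.1.1 (update j.1.2 j.2.1 j.2.2) s') := by
  have h1 : Runs (fun j : Pivot => j.1.1.L)
      (fun j s => Env j.1.1 s ∧ Tableau j.1.1 j.1.2 s ∧
        s vCur 0 = (j.2.1 : ℕ) ∧ s vPiv 0 = (j.2.2 : ℕ))
      (.set vDet (.read aT (.var vCur * .var vM + .var vPiv)))
      (fun j s s' => s' vDet 0 = bdet j.1.1.X (update j.1.2 j.2.1 j.2.2)) := by
    refine Runs.straight trivial ?_
    rintro ⟨⟨c, b⟩, x, v⟩ s ⟨hE, hT, hx, hv⟩ hs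
    simp only [Prog.run_set, Expr.eval_read, Expr.eval_add, Expr.eval_mul, Expr.eval_var] at hx hv ⊢
    rw [hx, hv, hE.2.1, hT.2.1]
    exact ⟨State.write_same _ _ _ _, hs.write _ _ (c.abs_bdet_le_two_pow _)⟩
  have h2 : Runs (fun j : Pivot => j.1.1.L)
      (fun j s => s vCur 0 = (j.2.1 : ℕ) ∧ s vPiv 0 = (j.2.2 : ℕ))
      (.assign aB (.var vCur) (.var vPiv))
      (fun j s s' => s' = s.write aB (j.2.1 : ℕ) (j.2.2 : ℕ)) := by
    refine Runs.straight trivial ?_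
    rintro ⟨⟨c, b⟩, x, v⟩ s ⟨hx, hv⟩ hs
    simp only [Prog.run_assign, Expr.eval_var] at hx hv ⊢
    rw [hx, hv]
    exact ⟨rfl, hs.write _ _ (c.abs_natCast_le (v.2.le.trans c.m_le))⟩
  have h3 := ((runs_copy.comap fun j : Pivot => j.1.1).pre (P' := fun j s =>
    Env j.1.1 s ∧ s vCur 0 = (j.2.1 : ℕ) ∧ s vPiv 0 = (j.2.2 : ℕ)) fun _ _ h => h.1).seq h2
    fun j s s' hP _ hf _ =>
      ⟨by rw [hf vCur (by decide)]; exact hP.2.1, by rw [hf vPiv (by decide)]; exact hP.2.2⟩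
  have h4 := h1.seq h3 fun j s s' hP _ hf _ => ⟨hP.1.congr (hf _ (by decide)) (hf _ (by decide))
    (hf _ (by decide)), by rw [hf vCur (by decide)]; exact hP.2.2.1,
    by rw [hf vPiv (by decide)]; exact hP.2.2.2⟩
  have h5 := runs_newTableau.seq h4 fun j s s' hP _ hf _ => ⟨hP.1.congr (hf _ (by decide))
    (hf _ (by decide)) (hf _ (by decide)), hP.2.1.congr (hf _ (by decide)) (hf _ (by decide))
    (hf _ (by decide)), by rw [hf vCur (by decide)]; exact hP.2.2.2.1,
    by rw [hf vPiv (by decide)]; exact hP.2.2.2.2⟩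
  refine h5.conseq (fun _ _ h => h) ?_
  rintro ⟨⟨c, b⟩, x, v⟩ s s₄ ⟨hE, hT, hb, hx, hv⟩ ⟨s₁, q₁, f₁,
    ⟨s₂, q₂, f₂, ⟨s₃, q₃, f₃, rfl, -⟩, -⟩,
    -⟩ - -
  simp only at hE hT hb hx hv q₁ q₂ q₃ ⊢
  refine ⟨fun r => ?_, fun r e => ?_, ?_⟩
  · by_cases hr : r = x
    · subst hr
      rw [State.write_same, update_self]
    · rw [update_of_ne hr, State.write_apply, if_neg, f₃ aB (by decide), f₂ aB (by decide),
        f₁ aB (by decide), hT.1]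
      rintro ⟨-, h⟩
      exact hr (Fin.ext (by exact_mod_cast h))
  · rw [State.write_of_ne _ _ _ (by decide), q₃, f₂ aNew (by decide), q₁]
  · rw [State.write_of_ne _ _ _ (by decide), f₃ vDet (by decide), q₂]

end DetMax

/-! ### Exchange along the stored closed walk -/

namespace DetMax

open RAM Finset Function

/-- One step of the exchange: pivot along the last edge of the remaining walk. -/
def exchangeStep : Prog :=
  .seq (.seq (.set vPrev (.read aPred (((.var vFlag - .var cT) * .var vD + .var vSrc) * .var vD
      + .var vCur)))
      (.set vPiv (.read aArg (.var vPrev * .var vD + .var vCur))))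
    (.seq pivotProg (.set vCur (.var vPrev)))

/-- Exchange along the closed walk that was found. -/
def exchangeProg : Prog := .for cT (.var vFlag) exchangeStep

/-- A basis with a closed walk of given length, listed backwards. -/
abbrev ExWalk : Type := (i : Cfg) × ℕ × (ℕ → Fin i.1.d) × (ℕ → Fin i.1.m)

/-- The closed walk is the one stored in memory. -/
def StoredWalk (j : ExWalk) (s : State) : Prop :=
  s vFlag 0 = (j.2.1 : ℕ) ∧ s vSrc 0 = (j.2.2.1 0 : ℕ) ∧
  ∀ t < j.2.1,
    s aPred (((j.2.1 - t : ℤ) * j.1.1.d + (j.2.2.1 0 : ℕ)) * j.1.1.d + (j.2.2.1 t : ℕ))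
      = (j.2.2.1 (t + 1) : ℕ) ∧
    s aArg ((j.2.2.1 (t + 1) : ℕ) * j.1.1.d + (j.2.2.1 t : ℕ)) = (j.2.2.2 t : ℕ)

theorem StoredWalk.congr {j : ExWalk} {s s' : State} (h : StoredWalk j s)
    (h1 : s' vFlag = s vFlag) (h2 : s' vSrc = s vSrc) (h3 : s' aPred = s aPred)
    (h4 : s' aArg = s aArg) : StoredWalk j s' := by
  unfold StoredWalk
  rw [h1, h2, h3, h4]
  exact h

/-- Predecessors and maximizers belong to the basis at the beginning of the round, and a pivot does
not touch their arrays. Only the tableau follows the intermediate bases, which are nonsingular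
because the walk is a `Violation`. -/
theorem runs_exchangeStep : Runs (fun j : ExWalk × ℕ => j.1.1.1.L)
    (fun j s => Env j.1.1.1 s ∧ StoredWalk j.1 s ∧ bdet j.1.1.1.X j.1.1.2 ≠ 0 ∧
      Violation j.1.1.1.X j.1.1.1.part j.1.1.2 j.1.2.1 j.1.2.2.1 j.1.2.2.2 ∧ j.2 < j.1.2.1 ∧
      s cT 0 = (j.2 : ℕ) ∧ s vCur 0 = (j.1.2.2.1 j.2 : ℕ) ∧
      Tableau j.1.1.1 (pivots j.1.1.2 j.1.2.2.1 j.1.2.2.2 j.2) s) exchangeStep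
    (fun j _ s' => Tableau j.1.1.1 (pivots j.1.1.2 j.1.2.2.1 j.1.2.2.2 (j.2 + 1)) s' ∧
      s' vCur 0 = (j.1.2.2.1 (j.2 + 1) : ℕ)) := by
  have h1 : Runs (fun j : ExWalk × ℕ => j.1.1.1.L)
      (fun j s => Env j.1.1.1 s ∧ StoredWalk j.1 s ∧ j.2 < j.1.2.1 ∧
        s cT 0 = (j.2 : ℕ) ∧ s vCur 0 = (j.1.2.2.1 j.2 : ℕ))
      (.seq (.set vPrev (.read aPred (((.var vFlag - .var cT) * .var vD + .var vSrc) * .var vD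
        + .var vCur)))
        (.set vPiv (.read aArg (.var vPrev * .var vD + .var vCur))))
      (fun j s s' => s' = (s.write vPrev 0 (j.1.2.2.1 (j.2 + 1) : ℕ)).write vPiv 0
        (j.1.2.2.2 j.2 : ℕ)) := by
    refine Runs.straight ⟨trivial, trivial⟩ ?_
    rintro ⟨⟨⟨c, b⟩, l, g, η⟩, t⟩ s ⟨hE, ⟨hw1, hw2, hw3⟩, ht, hc, hcur⟩ hs
    simp only at hE hw1 hw2 hw3 ht hc hcur ⊢
    obtain ⟨hp, ha⟩ := hw3 t ht
    have e1 : (Expr.read aPred (((.var vFlag - .var cT) * .var vD + .var vSrc) * .var vD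
        + .var vCur)).eval s = (g (t + 1) : ℕ) := by
      simp only [Expr.eval_read, Expr.eval_add, Expr.eval_mul, Expr.eval_sub, Expr.eval_var]
      rw [hw1, hw2, hc, hcur, hE.1, hp]
    have e2 : (Expr.read aArg (.var vPrev * .var vD + .var vCur)).eval
        (s.write vPrev 0 (g (t + 1) : ℕ)) = (η t : ℕ) := by
      simp only [Expr.eval_read, Expr.eval_add, Expr.eval_mul, Expr.eval_var]
      rw [State.write_same, State.write_of_ne _ _ _ (show vD ≠ vPrev by decide),
        State.write_of_ne _ _ _ (show vCur ≠ vPrev by decide),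
        State.write_of_ne _ _ _ (show aArg ≠ vPrev by decide), hcur, hE.1, ha]
    rw [Prog.run_seq, Prog.run_set, Prog.run_set, e1, e2]
    exact ⟨rfl, (hs.write _ _ (c.abs_natCast_le ((g (t + 1)).2.le.trans c.d_le))).write _ _
      (c.abs_natCast_le ((η t).2.le.trans c.m_le))⟩
  have h2 : Runs (fun j : ExWalk × ℕ => j.1.1.1.L)
      (fun j s => s vPrev 0 = (j.1.2.2.1 (j.2 + 1) : ℕ)) (.set vCur (.var vPrev))
      (fun j s s' => s' = s.write vCur 0 (j.1.2.2.1 (j.2 + 1) : ℕ)) := by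
    refine Runs.straight trivial ?_
    rintro ⟨⟨⟨c, b⟩, l, g, η⟩, t⟩ s h hs
    simp only [Prog.run_set, Expr.eval_var] at h ⊢
    rw [h]
    exact ⟨rfl, hs.write _ _ (c.abs_natCast_le ((g (t + 1)).2.le.trans c.d_le))⟩
  have h3 := runs_pivot.comap fun j : ExWalk × ℕ =>
    (⟨⟨j.1.1.1, pivots j.1.1.2 j.1.2.2.1 j.1.2.2.2 j.2⟩, j.1.2.2.1 j.2, j.1.2.2.2 j.2⟩ : Pivot)
  have h4 := (h3.pre (P' := fun j s => (Env j.1.1.1 s ∧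
      Tableau j.1.1.1 (pivots j.1.1.2 j.1.2.2.1 j.1.2.2.2 j.2) s ∧
      bdet j.1.1.1.X (pivots j.1.1.2 j.1.2.2.1 j.1.2.2.2 j.2) ≠ 0 ∧
      s vCur 0 = (j.1.2.2.1 j.2 : ℕ) ∧ s vPiv 0 = (j.1.2.2.2 j.2 : ℕ)) ∧
      s vPrev 0 = (j.1.2.2.1 (j.2 + 1) : ℕ)) fun _ _ h => h.1).seq h2
    fun j s s' hP _ hf _ => by
      rw [hf vPrev (by decide)]
      exact hP.2
  have h5 := (h1.pre (P' := fun j s => Env j.1.1.1 s ∧ StoredWalk j.1 s ∧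
      bdet j.1.1.1.X j.1.1.2 ≠ 0 ∧
      Violation j.1.1.1.X j.1.1.1.part j.1.1.2 j.1.2.1 j.1.2.2.1 j.1.2.2.2 ∧ j.2 < j.1.2.1 ∧
      s cT 0 = (j.2 : ℕ) ∧ s vCur 0 = (j.1.2.2.1 j.2 : ℕ) ∧
      Tableau j.1.1.1 (pivots j.1.1.2 j.1.2.2.1 j.1.2.2.2 j.2) s)
      fun _ _ h => ⟨h.1, h.2.1, h.2.2.2.2.1, h.2.2.2.2.2.1, h.2.2.2.2.2.2.1⟩).seq h4 (by
    rintro ⟨⟨⟨c, b⟩, l, g, η⟩, t⟩ s s' ⟨hE, hw, hb, hv, ht, hc, hcur, hT⟩ rfl - -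
    simp only at hE hb hv ht hc hcur hT ⊢
    refine ⟨⟨hE.congr rfl rfl rfl, hT.congr rfl rfl rfl, hv.bdet_pivots_ne_zero hb ht.le, ?_,
      State.write_same _ _ _ _⟩, ?_⟩
    · rw [State.write_of_ne _ _ _ (by decide), State.write_of_ne _ _ _ (by decide), hcur]
    · rw [State.write_of_ne _ _ _ (by decide), State.write_same])
  refine h5.conseq (fun _ _ h => h) ?_
  rintro ⟨⟨⟨c, b⟩, l, g, η⟩, t⟩ s s₃ - ⟨s₁, -, -, ⟨s₂, hT, -, rfl, -⟩, -⟩ - -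
  exact ⟨hT.congr rfl rfl rfl, State.write_same _ _ _ _⟩

theorem runs_exchange : Runs (fun j : ExWalk => j.1.1.L)
    (fun j s => Env j.1.1 s ∧ StoredWalk j s ∧ bdet j.1.1.X j.1.2 ≠ 0 ∧
      Violation j.1.1.X j.1.1.part j.1.2 j.2.1 j.2.2.1 j.2.2.2 ∧
      s vCur 0 = (j.2.2.1 0 : ℕ) ∧ Tableau j.1.1 j.1.2 s) exchangeProg
    (fun j _ s' => Tableau j.1.1 (pivots j.1.2 j.2.2.1 j.2.2.2 j.2.1) s') := by
  have hw : ∀ a, a ∈ exchangeStep.writes → a ∈ [vPrev, vPiv, aNew, cX, vDet, aT, aB, vCur] := by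
    decide
  refine Runs.for (Inv := fun j s k s' =>
      (∀ a, a ∉ [vPrev, vPiv, aNew, cX, vDet, aT, aB, vCur, cT] → s' a = s a) ∧
      s' vCur 0 = (j.2.2.1 k : ℕ) ∧ Tableau j.1.1 (pivots j.1.2 j.2.2.1 j.2.2.2 k) s')
    (fun j _ => j.2.1) ?_ ?_ ?_ ?_ ?_ ?_
  · rintro ⟨⟨c, b⟩, l, g, η⟩ s ⟨-, -, -, hv, -⟩ -
    exact hv.le.trans c.d_le
  · rintro ⟨⟨c, b⟩, l, g, η⟩ s s' ⟨-, -, -, -, hcur, hT⟩ h -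
    refine ⟨fun a ha => h a (by rintro rfl; simp at ha), ?_, hT.congr (h _ (by decide))
      (h _ (by decide)) (h _ (by decide))⟩
    rw [h vCur (by decide), hcur]
  · rintro ⟨⟨c, b⟩, l, g, η⟩ s k s₁ s₂ - h ⟨h1, h2, h3⟩
    refine ⟨fun a ha => by rw [h a (by rintro rfl; simp at ha), h1 a ha], ?_, h3.congr
      (h _ (by decide)) (h _ (by decide)) (h _ (by decide))⟩
    rw [h vCur (by decide)]
    exact h2
  · rintro ⟨⟨c, b⟩, l, g, η⟩ s k s' ⟨-, hw, -⟩ ⟨h1, -⟩ - -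
    rw [Expr.eval_var, h1 vFlag (by decide)]
    exact hw.1
  · refine runs_exchangeStep.choose_index ?_
    rintro ⟨⟨⟨c, b⟩, l, g, η⟩, s₀, k⟩ s ⟨⟨hE, hw', hb, hv, -, -⟩, ⟨h1, h2, h3⟩, hc, hk⟩
    refine ⟨(⟨⟨c, b⟩, l, g, η⟩, k), rfl, ⟨hE.congr (h1 _ (by decide)) (h1 _ (by decide))
      (h1 _ (by decide)), hw'.congr (h1 _ (by decide)) (h1 _ (by decide)) (h1 _ (by decide))
      (h1 _ (by decide)), hb, hv, hk, hc, h2, h3⟩, ?_⟩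
    rintro s' ⟨h4, h5⟩ h6 -
    refine ⟨⟨fun a ha => ?_, h5, h4⟩, ?_⟩
    · rw [h6 a fun h => ha ?_, h1 a ha]
      have := hw a h
      simp only [List.mem_cons, List.not_mem_nil, or_false] at this ⊢
      tauto
    · rw [h6 cT (by decide), hc]
  · rintro ⟨⟨c, b⟩, l, g, η⟩ s s' - ⟨-, -, h⟩
    exact h

/-- Following the predecessor pointers back from the end recovers a walk of maximal weight, and the
stored maximizers supply the entering elements. -/
theorem exists_storedWalk {c : Ctx} {b : Fin c.d → Fin c.m} {s : State} (hW : Weights c b s)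
    (hK : Walks c b s) (h0 : s vFlag 0 ≠ 0) (hF : Found c b s) :
    ∃ (l : ℕ) (g : ℕ → Fin c.d) (η : ℕ → Fin c.m), StoredWalk ⟨⟨c, b⟩, l, g, η⟩ s ∧
      Violation c.X c.part b l g η := by
  obtain ⟨h, -⟩ | ⟨l, i, hl1, hld, hfl, hsrc, hlarge, hmin⟩ := hF
  · exact (h0 h).elim
  have hp : ∀ (a : ℕ) (t : Fin c.d), ∃ p : Fin c.d, a < c.d →
      s aPred ((((a + 1 : ℕ) : ℤ) * c.d + (i : ℕ)) * c.d + (t : ℕ)) = (p : ℕ) ∧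
      walk (wgt c.X c.part b) (a + 1) i t
        = walk (wgt c.X c.part b) a i p * wgt c.X c.part b p t := by
    intro a t
    by_cases ha : a < c.d
    · obtain ⟨p, hp⟩ := hK.2 a ha i t
      exact ⟨p, fun _ => hp⟩
    · exact ⟨t, fun h => (ha h).elim⟩
  choose p hp using hp
  choose hw e he using hW
  -- After `t` steps back, `l - t` edges remain between `i` and `g t`; the pointer used is the one
  -- for walks of that length.
  let g : ℕ → Fin c.d := fun n => Nat.rec i (fun t r => p (l - t - 1) r) n
  have hg0 : g 0 = i := rfl
  have hgs : ∀ t, g (t + 1) = p (l - t - 1) (g t) := fun t => rfl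
  have hstep : ∀ t < l, s aPred (((l - t : ℤ) * c.d + (i : ℕ)) * c.d + ((g t).val : ℤ))
        = ((g (t + 1)).val : ℤ) ∧ walk (wgt c.X c.part b) (l - t) i (g t)
        = walk (wgt c.X c.part b) (l - (t + 1)) i (g (t + 1)) *
          wgt c.X c.part b (g (t + 1)) (g t) := by
    intro t ht
    obtain ⟨h1, h2⟩ := hp (l - t - 1) (g t) (by omega)
    rw [← hgs, show l - t - 1 + 1 = l - t by omega] at h1 h2
    rw [show l - t - 1 = l - (t + 1) by omega] at h2
    refine ⟨?_, h2⟩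
    rw [← h1, Nat.cast_sub ht.le]
  have hprod : ∀ t ≤ l, walk (wgt c.X c.part b) l i i
      = (∏ k ∈ range t, wgt c.X c.part b (g (k + 1)) (g k)) *
        walk (wgt c.X c.part b) (l - t) i (g t) := by
    intro t
    induction t with
    | zero =>
      intro _
      simp [hg0]
    | succ t ih =>
      intro ht
      rw [ih (by omega), (hstep t (by omega)).2, prod_range_succ]
      ring
  have hend := hprod l le_rfl
  rw [Nat.sub_self, walk] at hend
  -- The remaining walk of length zero has weight `0` unless it starts where it ends, but the total
  -- weight exceeds a threshold and is therefore positive.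
  have hgl : i = g l := by
    by_contra hne
    rw [if_neg hne, mul_zero] at hend
    omega
  rw [if_pos hgl, mul_one] at hend
  refine ⟨l, g, fun t => e (g (t + 1)) (g t), ⟨hfl, hsrc, fun t ht => ⟨(hstep t ht).1,
    (he _ _).1⟩⟩, ⟨hl1, hld, hgl.symm, fun x _ => (he _ _).2.1, fun x _ => (he _ _).2.2, hmin, ?_⟩⟩
  rwa [← hend]

/-- One round of the local search. -/
def roundProg : Prog :=
  .seq (.set vFlag (.const 0)) (.seq weightsProg (.seq thrProg (.seq walkInitProg (.seq walkProg
    (.seq findProg (.ite (.var vFlag) (.seq (.set vCur (.var vSrc)) exchangeProg) .skip))))))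

/-- The outcome of a round. -/
def RoundPost (c : Ctx) (b : Fin c.d → Fin c.m) (s' : State) : Prop :=
  (s' vFlag 0 = 0 ∧ LocallyOptimal c.X c.part b ∧ Tableau c b s') ∨
  (s' vFlag 0 ≠ 0 ∧ ¬ LocallyOptimal c.X c.part b ∧ ∃ b' : Fin c.d → Fin c.m,
    Tableau c b' s' ∧ bdet c.X b' ≠ 0 ∧
    ((Injective fun r => c.part (b r)) → Injective fun r => c.part (b' r)) ∧
    (2 * (bdet c.X b).natAbs ≤ (bdet c.X b').natAbs ∨ LocallyOptimal c.X c.part b'))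

theorem runs_finish : Runs Cfg.sz (fun i s => Env i.1 s ∧ Tableau i.1 i.2 s ∧ bdet i.1.X i.2 ≠ 0 ∧
      Weights i.1 i.2 s ∧ Walks i.1 i.2 s ∧ Found i.1 i.2 s)
    (.ite (.var vFlag) (.seq (.set vCur (.var vSrc)) exchangeProg) .skip)
    (fun i _ s' => RoundPost i.1 i.2 s') := by
  refine Runs.ite ?_ ?_
  · have h1 : Runs (fun j : ExWalk => j.1.1.L) (fun j s => s vSrc 0 = (j.2.2.1 0 : ℕ))
        (.set vCur (.var vSrc)) (fun j s s' => s' = s.write vCur 0 (j.2.2.1 0 : ℕ)) := by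
      refine Runs.straight trivial ?_
      rintro ⟨⟨c, b⟩, l, g, η⟩ s h hs
      simp only [Prog.run_set, Expr.eval_var] at h ⊢
      rw [h]
      exact ⟨rfl, hs.write _ _ (c.abs_natCast_le ((g 0).2.le.trans c.d_le))⟩
    have h2 := (h1.pre (P' := fun j s => Env j.1.1 s ∧ StoredWalk j s ∧ bdet j.1.1.X j.1.2 ≠ 0 ∧
      Violation j.1.1.X j.1.1.part j.1.2 j.2.1 j.2.2.1 j.2.2.2 ∧ Tableau j.1.1 j.1.2 s)
      fun _ _ h => h.2.1.2.1).seq runs_exchange (by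
        rintro j s s' ⟨hE, hw, hb, hv, hT⟩ rfl - -
        exact ⟨hE.congr rfl rfl rfl, hw.congr rfl rfl rfl rfl, hb, hv, State.write_same _ _ _ _,
          hT.congr rfl rfl rfl⟩)
    refine h2.choose_index ?_
    rintro ⟨c, b⟩ s ⟨⟨hE, hT, hb, hW, hK, hF⟩, h0⟩
    obtain ⟨l, g, η, hw, hv⟩ := exists_storedWalk hW hK h0 hF
    refine ⟨⟨⟨c, b⟩, l, g, η⟩, rfl, ⟨hE, hw, hb, hv, hT⟩, ?_⟩
    rintro s' ⟨s₁, -, -, hT', -⟩ hf -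
    refine Or.inr ⟨by rw [hf vFlag (by decide)]; exact h0, fun hopt => ?_, _, hT',
      hv.bdet_pivots_ne_zero hb le_rfl, hv.injective_part, hv.improves hb⟩
    obtain ⟨h, -⟩ | ⟨l', i, hl1, hld, -, -, hlarge, -⟩ := hF
    · exact h0 h
    · exact absurd (hopt l' hl1 hld i) (not_le.2 hlarge)
  · refine Runs.straight trivial ?_
    rintro ⟨c, b⟩ s ⟨⟨hE, hT, hb, hW, hK, hF⟩, h0⟩ hs
    refine ⟨Or.inl ⟨h0, ?_, hT⟩, hs⟩
    obtain ⟨-, h⟩ | ⟨l, i, hl1, -, hfl, -⟩ := hF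
    · exact h
    · simp only [Expr.eval_var] at h0
      rw [hfl] at h0
      exact absurd h0 (by exact_mod_cast (by omega : l ≠ 0))

theorem Weights.congr {c : Ctx} {b : Fin c.d → Fin c.m} {s s' : State} (h : Weights c b s)
    (h1 : s' aW = s aW) (h2 : s' aArg = s aArg) : Weights c b s' := by
  unfold Weights
  rw [h1, h2]
  exact h

theorem Walks.congr {c : Ctx} {b : Fin c.d → Fin c.m} {s s' : State} (h : Walks c b s)
    (h1 : s' aWalk = s aWalk) (h2 : s' aPred = s aPred) : Walks c b s' := by
  unfold Walks
  rw [h1, h2]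
  exact h


end DetMax

namespace RAM

/-- A postcondition that ignores the initial memory needs no record of the intermediate one, which
keeps long sequential compositions readable. -/
theorem Runs.seq_post {ι : Type} {sz : ι → ℕ} {P R : ι → State → Prop} {p q : Prog}
    {Q : ι → State → State → Prop} {Q' : ι → State → Prop} (hp : Runs sz P p Q)
    (hq : Runs sz R q fun i _ => Q' i)
    (h : ∀ i s s', P i s → Q i s s' → (∀ a, a ∉ p.writes → s' a = s a) → Bdd (sz i) s' → R i s') :
    Runs sz P (.seq p q) fun i _ => Q' i :=
  (hp.seq hq h).conseq (fun _ _ h => h) fun _ _ _ _ ⟨_, _, _, h, _⟩ _ _ => h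

end RAM

/-! ### Assembling one round of the search, from its last step backwards -/

namespace DetMax

open RAM Finset Function

/-- A basis and its tableau are stored. -/
def Ready (i : Cfg) (s : State) : Prop :=
  Env i.1 s ∧ Tableau i.1 i.2 s ∧ bdet i.1.X i.2 ≠ 0

/-- Programs that do not change the input and the basis. -/
def Harmless (p : Prog) : Prop := ∀ a ∈ [vD, vM, aPart, aB, aT, vDet], a ∉ p.writes

theorem Ready.of_harmless {p : Prog} (hp : Harmless p) {i : Cfg} {s s' : State} (h : Ready i s)
    (hf : ∀ a, a ∉ p.writes → s' a = s a) : Ready i s' := by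
  obtain ⟨h1, h2, h3⟩ := h
  exact ⟨h1.congr (hf _ (hp _ (by decide))) (hf _ (hp _ (by decide))) (hf _ (hp _ (by decide))),
    h2.congr (hf _ (hp _ (by decide))) (hf _ (hp _ (by decide))) (hf _ (hp _ (by decide))), h3⟩

/-- The thresholds are stored. -/
def Thresholds (i : Cfg) (s : State) : Prop :=
  ∀ l : ℕ, l ≤ i.1.d → s aThr l = thr i.1.X i.2 l

/-- The walks of length zero are stored. -/
def InitialWalks (i : Cfg) (s : State) : Prop :=
  ∀ r t : Fin i.1.d, s aWalk ((r : ℕ) * i.1.d + (t : ℕ)) = walk (wgt i.1.X i.1.part i.2) 0 r t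

theorem runs_roundFind : Runs Cfg.sz (fun i s => Ready i s ∧
      Weights i.1 i.2 s ∧ Thresholds i s ∧ s vFlag 0 = 0 ∧ Walks i.1 i.2 s)
    (.seq findProg (.ite (.var vFlag) (.seq (.set vCur (.var vSrc)) exchangeProg) .skip))
    (fun i _ => RoundPost i.1 i.2) := by
  refine (runs_find.pre fun i s h => ⟨h.1.1, h.2.2.2.2, h.2.2.1, h.2.2.2.1⟩).seq_post runs_finish ?_
  rintro i s s' ⟨hR, hW, -, -, hK⟩ hQ hf -
  obtain ⟨hE, hT, hb⟩ := hR.of_harmless (by unfold Harmless; decide) hf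
  exact ⟨hE, hT, hb, hW.congr (hf _ (by decide)) (hf _ (by decide)),
    hK.congr (hf _ (by decide)) (hf _ (by decide)), hQ⟩

theorem runs_roundWalk : Runs Cfg.sz (fun i s => Ready i s ∧
      Weights i.1 i.2 s ∧ Thresholds i s ∧ s vFlag 0 = 0 ∧ InitialWalks i s)
    (.seq walkProg (.seq findProg
      (.ite (.var vFlag) (.seq (.set vCur (.var vSrc)) exchangeProg) .skip)))
    (fun i _ => RoundPost i.1 i.2) := by
  refine (runs_walk.pre fun i s h => ⟨h.1.1, h.2.1, h.2.2.2.2⟩).seq_post runs_roundFind ?_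
  rintro i s s' ⟨hR, hW, hθ, h0, -⟩ hQ hf -
  refine ⟨hR.of_harmless (by unfold Harmless; decide) hf,
    hW.congr (hf _ (by decide)) (hf _ (by decide)), ?_, ?_, hQ⟩
  · unfold Thresholds
    rw [hf aThr (by decide)]
    exact hθ
  · rw [hf vFlag (by decide), h0]

theorem runs_roundInit : Runs Cfg.sz (fun i s => Ready i s ∧
      Weights i.1 i.2 s ∧ Thresholds i s ∧ s vFlag 0 = 0)
    (.seq walkInitProg (.seq walkProg (.seq findProg
      (.ite (.var vFlag) (.seq (.set vCur (.var vSrc)) exchangeProg) .skip))))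
    (fun i _ => RoundPost i.1 i.2) := by
  refine (runs_walkInit.pre fun i s h => h.1.1).seq_post runs_roundWalk ?_
  rintro i s s' ⟨hR, hW, hθ, h0⟩ hQ hf -
  refine ⟨hR.of_harmless (by unfold Harmless; decide) hf,
    hW.congr (hf _ (by decide)) (hf _ (by decide)), ?_, ?_, hQ⟩
  · unfold Thresholds
    rw [hf aThr (by decide)]
    exact hθ
  · rw [hf vFlag (by decide), h0]

theorem runs_roundThr : Runs Cfg.sz (fun i s => Ready i s ∧ Weights i.1 i.2 s ∧ s vFlag 0 = 0)
    (.seq thrProg (.seq walkInitProg (.seq walkProg (.seq findProg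
      (.ite (.var vFlag) (.seq (.set vCur (.var vSrc)) exchangeProg) .skip)))))
    (fun i _ => RoundPost i.1 i.2) := by
  refine (runs_thr.pre fun i s h => ⟨h.1.1, h.1.2.1⟩).seq_post runs_roundInit ?_
  rintro i s s' ⟨hR, hW, h0⟩ hQ hf -
  refine ⟨hR.of_harmless (by unfold Harmless; decide) hf,
    hW.congr (hf _ (by decide)) (hf _ (by decide)), hQ, ?_⟩
  rw [hf vFlag (by decide), h0]

theorem runs_roundWeights : Runs Cfg.sz (fun i s => Ready i s ∧ s vFlag 0 = 0)
    (.seq weightsProg (.seq thrProg (.seq walkInitProg (.seq walkProg (.seq findProg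
      (.ite (.var vFlag) (.seq (.set vCur (.var vSrc)) exchangeProg) .skip))))))
    (fun i _ => RoundPost i.1 i.2) := by
  refine (runs_weights.pre fun i s h => ⟨h.1.1, h.1.2.1⟩).seq_post runs_roundThr ?_
  rintro i s s' ⟨hR, h0⟩ hQ hf -
  refine ⟨hR.of_harmless (by unfold Harmless; decide) hf, hQ, ?_⟩
  rw [hf vFlag (by decide), h0]

theorem runs_round : Runs Cfg.sz Ready roundProg (fun i _ => RoundPost i.1 i.2) := by
  have h0 : Runs Cfg.sz Ready (.set vFlag (.const 0)) (fun _ _ s' => s' vFlag 0 = 0) := by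
    refine Runs.straight trivial fun i s _ hs => ⟨State.write_same _ _ _ _, hs.write _ _ ?_⟩
    simp
  refine h0.seq_post runs_roundWeights ?_
  rintro i s s' hR h0 hf -
  exact ⟨hR.of_harmless (by unfold Harmless; decide) hf, h0⟩

end DetMax

/-! ### The number of rounds -/

namespace DetMax

open RAM Finset Function

/-- The local search. -/
def searchProg : Prog := .seq (.set vFlag (.const 1)) (.while (.var vFlag) roundProg)

/-- A basis with distinct parts and its tableau are stored. -/
def SearchInv (c : Ctx) (b : Fin c.d → Fin c.m) (s : State) : Prop :=
  Ready ⟨c, b⟩ s ∧ Injective fun r => c.part (b r)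

theorem runs_searchLoop : Runs Ctx.L
    (fun c s => s vFlag 0 ≠ 0 ∧ ∃ b, SearchInv c b s)
    (.while (.var vFlag) roundProg)
    (fun c _ s' => ∃ b, SearchInv c b s' ∧ LocallyOptimal c.X c.part b) := by
  -- The potential `k` bounds the remaining rounds: with at most `L` bits available, `2 ^ L ≤ |bdet|
  -- * 2 ^ k` allows fewer than `k` further doublings. The reserve `2 ≤ k` pays for a round that
  -- reaches a local optimum without doubling and for the last round, which only clears the flag.
  refine Runs.while (Inv := fun c _ k s' => ∃ b, SearchInv c b s' ∧
    ((s' vFlag 0 = 0 ∧ LocallyOptimal c.X c.part b) ∨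
      s' vFlag 0 ≠ 0 ∧ 1 ≤ k ∧ (LocallyOptimal c.X c.part b ∨
        (2 ≤ k ∧ 2 ^ c.L ≤ (bdet c.X b).natAbs * 2 ^ k)))) ?_ ?_ ?_
  · rintro c s ⟨h0, b, hb⟩ -
    have hL : 2 ≤ c.L := le_trans (by
      calc 2 ≤ 2 ^ 4 := by norm_num
        _ ≤ (c.m + c.d + 2) ^ 4 := by gcongr; omega) c.size_le
    refine ⟨c.L, le_rfl, b, hb, Or.inr ⟨h0, by omega, Or.inr ⟨hL, ?_⟩⟩⟩
    exact Nat.le_mul_of_pos_left _ (Int.natAbs_pos.2 hb.1.2.2)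
  · refine (runs_round.choose_index (ι := Cfg) ?_)
    rintro ⟨c, s₀, k⟩ s ⟨-, ⟨b, ⟨hR, hI⟩, hb⟩, h0⟩
    simp only at hR hI hb h0
    obtain ⟨h, -⟩ | ⟨-, hk, hb⟩ := hb
    · exact (h0 h).elim
    refine ⟨⟨c, b⟩, rfl, hR, ?_⟩
    rintro s' (⟨hf, hopt, hT⟩ | ⟨hf, hopt, b', hT, hb', hI', himp⟩) hfr -
    · refine ⟨k - 1, by simp only; omega, b, ⟨⟨hR.1.congr (hfr _ (by decide)) (hfr _ (by decide))
        (hfr _ (by decide)), hT, hR.2.2⟩, hI⟩, Or.inl ⟨hf, hopt⟩⟩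
    · obtain h | ⟨h2, hlarge⟩ := hb
      · exact (hopt h).elim
      refine ⟨k - 1, by simp only; omega, b', ⟨⟨hR.1.congr (hfr _ (by decide)) (hfr _ (by decide))
        (hfr _ (by decide)), hT, hb'⟩, hI' hI⟩, Or.inr ⟨hf, by omega, ?_⟩⟩
      rcases himp with himp | himp
      · right
        have h3 : 2 ^ c.L ≤ (bdet c.X b').natAbs * 2 ^ (k - 1) := by
          refine hlarge.trans ?_
          obtain ⟨k, rfl⟩ : ∃ k', k = k' + 1 := ⟨k - 1, by omega⟩
          simp only [Nat.add_sub_cancel]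
          calc _ = 2 * (bdet c.X b).natAbs * 2 ^ k := by ring
            _ ≤ _ := Nat.mul_le_mul_right _ himp
        refine ⟨?_, h3⟩
        -- Here the factor four is spent: `4 * |bdet| ≤ 2 ^ L ≤ |bdet| * 2 ^ (k - 1)` forces `k - 1
        -- ≥ 2`.
        by_contra hlt
        have h4 := c.four_mul_natAbs_bdet_le b'
        have h5 : 2 ^ (k - 1) ≤ 2 ^ 1 := Nat.pow_le_pow_right (by norm_num) (by omega)
        have h6 := Nat.mul_le_mul_left (bdet c.X b').natAbs h5
        have h7 : 0 < (bdet c.X b').natAbs := Int.natAbs_pos.2 hb'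
        linarith
      · exact Or.inl himp
  · rintro c s k s' - ⟨b, h1, h4⟩ h0
    rcases h4 with ⟨-, h4⟩ | ⟨h4, -⟩
    · exact ⟨b, h1, h4⟩
    · exact (h4 h0).elim

theorem runs_search : Runs Ctx.L (fun c s => ∃ b, SearchInv c b s) searchProg
    (fun c _ s' => ∃ b, SearchInv c b s' ∧ LocallyOptimal c.X c.part b) := by
  have h1 : Runs Ctx.L (fun c s => ∃ b, SearchInv c b s) (.set vFlag (.const 1))
      (fun _ _ s' => s' vFlag 0 = 1) := by
    refine Runs.straight trivial fun c s _ hs => ⟨State.write_same _ _ _ _, hs.write _ _ ?_⟩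
    simpa using one_le_pow₀ (by norm_num)
  refine h1.seq_post runs_searchLoop ?_
  rintro c s s' ⟨b, hb, hI⟩ h0 hf -
  exact ⟨by rw [h0]; decide, b, hb.of_harmless (by unfold Harmless; decide) hf, hI⟩

end DetMax

/-! ### Loops with a single assignment -/

namespace RAM

variable {ι : Type} {sz : ι → ℕ}

/-- A loop whose body is a single assignment. -/
theorem Runs.for_assign {P : ι → State → Prop} {a c : ℕ} (hac : a ≠ c) {bound addr e : Expr}
    (N : ι → ℕ) (G : ι → State → ℕ → (ℤ → ℤ) → Prop) (hN : ∀ i, N i ≤ sz i)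
    (h0 : ∀ i s, P i s → G i s 0 (s a))
    (hb : ∀ i s (s' : State), P i s → (∀ x, x ≠ a → x ≠ c → s' x = s x) → bound.eval s' = N i)
    (hstep : ∀ i s (s' : State) (k : ℕ), P i s → (∀ x, x ≠ a → x ≠ c → s' x = s x) →
      G i s k (s' a) → s' c 0 = k → k < N i →
      G i s (k + 1) (s'.write a (addr.eval s') (e.eval s') a) ∧ |e.eval s'| ≤ 2 ^ sz i) :
    Runs sz P (.for c bound (.assign a addr e)) (fun i s s' => G i s (N i) (s' a)) := by
  refine Runs.for (Inv := fun i s k s' => (∀ x, x ≠ a → x ≠ c → s' x = s x) ∧ G i s k (s' a))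
    (fun i _ => N i) (fun i _ _ _ => hN i) ?_ ?_ ?_ ?_ ?_
  · intro i s s' hP h _
    exact ⟨fun x _ hx => h x hx, by rw [h a hac]; exact h0 i s hP⟩
  · rintro i s k s₁ s₂ - h ⟨h1, h2⟩
    exact ⟨fun x hxa hx => by rw [h x hx, h1 x hxa hx], by rwa [h a hac]⟩
  · rintro i s k s' hP ⟨h1, -⟩ - -
    exact hb i s s' hP h1
  · refine Runs.straight trivial ?_
    rintro ⟨i, s, k⟩ s' ⟨hP, ⟨h1, h2⟩, hc, hk⟩ hB
    simp only at hP h1 h2 hc hk hB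
    obtain ⟨h3, h4⟩ := hstep i s s' k hP h1 h2 hc hk
    refine ⟨⟨⟨fun x hxa hx => ?_, h3⟩, ?_⟩, hB.write _ _ h4⟩
    · rw [Prog.run_assign, State.write_of_ne _ _ _ hxa, h1 x hxa hx]
    · rw [Prog.run_assign, State.write_of_ne _ _ _ hac.symm, hc]
  · rintro i s s' - ⟨-, h⟩
    exact h

/-- Filling an array. -/
theorem Runs.fill {P : ι → State → Prop} {a c : ℕ} (hac : a ≠ c) {bound e : Expr}
    (N : ι → ℕ) (V : ι → ℕ → ℤ) (hN : ∀ i, N i ≤ sz i)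
    (hb : ∀ i s (s' : State), P i s → (∀ x, x ≠ a → x ≠ c → s' x = s x) → bound.eval s' = N i)
    (hstep : ∀ i s (s' : State) (k : ℕ), P i s → (∀ x, x ≠ a → x ≠ c → s' x = s x) →
      s' c 0 = k → k < N i → e.eval s' = V i k)
    (hV : ∀ i k, k < N i → |V i k| ≤ 2 ^ sz i) :
    Runs sz P (.for c bound (.assign a (.var c) e)) (fun i _ s' => ∀ k < N i, s' a k = V i k) := by
  refine Runs.for_assign hac N (fun i _ k v => ∀ y < k, v y = V i y) hN ?_ hb ?_
  · intro i s _ y hy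
    omega
  · intro i s s' k hP h1 h2 hc hk
    rw [hstep i s s' k hP h1 hc hk, Expr.eval_var, hc]
    refine ⟨fun y hy => ?_, hV i k hk⟩
    rcases Nat.lt_succ_iff_lt_or_eq.1 hy with h | rfl
    · rw [State.write_apply, if_neg fun h' => h.ne (by exact_mod_cast h'.2), h2 y h]
    · rw [State.write_same]

/-- Accumulating in a variable. -/
theorem Runs.fold {P : ι → State → Prop} {a c : ℕ} (hac : a ≠ c) {bound e : Expr}
    (N : ι → ℕ) (V : ι → ℕ → ℤ) (hN : ∀ i, N i ≤ sz i) (h0 : ∀ i s, P i s → s a 0 = V i 0)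
    (hb : ∀ i s (s' : State), P i s → (∀ x, x ≠ a → x ≠ c → s' x = s x) → bound.eval s' = N i)
    (hstep : ∀ i s (s' : State) (k : ℕ), P i s → (∀ x, x ≠ a → x ≠ c → s' x = s x) →
      s' a 0 = V i k → s' c 0 = k → k < N i → e.eval s' = V i (k + 1))
    (hV : ∀ i k, k ≤ N i → |V i k| ≤ 2 ^ sz i) :
    Runs sz P (.for c bound (.set a e)) (fun i _ s' => s' a 0 = V i (N i)) := by
  refine Runs.for_assign hac N (fun i _ k v => v 0 = V i k) hN h0 hb ?_
  intro i s s' k hP h1 h2 hc hk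
  rw [hstep i s s' k hP h1 h2 hc hk]
  exact ⟨State.write_same _ _ _ _, hV i _ hk⟩

end RAM

/-! ### The input and its size -/

namespace RAM

theorem bitLen_le_inputSize {l : List ℤ} {a : ℤ} (h : a ∈ l) : bitLen a ≤ inputSize l :=
  List.single_le_sum (by simp) _ (List.mem_map_of_mem h)

theorem length_le_inputSize (l : List ℤ) : l.length ≤ inputSize l := by
  unfold inputSize
  induction l with
  | nil => simp
  | cons a l ih =>
    simp only [List.length_cons, List.map_cons, List.sum_cons]
    have : 1 ≤ bitLen a := by simp [bitLen]
    omega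

theorem abs_le_two_pow_of_bitLen_le {a : ℤ} {b : ℕ} (h : bitLen a ≤ b) : |a| ≤ 2 ^ b := by
  have h1 : a.natAbs < 2 ^ Nat.size a.natAbs := Nat.lt_size_self _
  have h2 : 2 ^ Nat.size a.natAbs ≤ 2 ^ b := Nat.pow_le_pow_right (by norm_num) (by
    unfold bitLen at h
    omega)
  rw [Int.abs_eq_natAbs]
  exact_mod_cast (h1.trans_le h2).le

theorem abs_getD_le (l : List ℤ) (k : ℕ) : |l.getD k 0| ≤ 2 ^ inputSize l := by
  by_cases h : k < l.length
  · rw [List.getD_eq_getElem _ _ h]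
    exact abs_le_two_pow_of_bitLen_le (bitLen_le_inputSize (List.getElem_mem h))
  · rw [List.getD_eq_default _ _ (not_lt.1 h)]
    simp

theorem Bdd.init (l : List ℤ) : Bdd (inputSize l) (State.init l) := by
  intro a i
  unfold State.init
  split_ifs
  · exact abs_getD_le l _
  · simp

theorem State.init_natCast (l : List ℤ) (k : ℕ) : State.init l 0 k = l.getD k 0 := by
  simp [State.init]

end RAM

namespace PartitionInstance

open RAM Finset

variable (I : PartitionInstance)

/-- The numerators in the order of the input. -/
def num (y : ℕ) : ℤ := I.encode.getD (2 + I.n + y) 0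

/-- The denominators in the order of the input. -/
def den (y : ℕ) : ℤ := I.encode.getD (2 + I.n + I.n * I.d + y) 0

theorem encode_length : I.encode.length = 2 + I.n + I.n * I.d + I.n * I.d := by
  simp [encode]
  omega

theorem encode_getD_part (e : Fin I.n) : I.encode.getD (2 + e) 0 = (I.part e : ℕ) := by
  have he := e.2
  unfold encode
  rw [List.getD_append _ _ _ _ (by simp; omega), List.getD_append _ _ _ _ (by simp; omega),
    List.getD_append_right _ _ _ _ (by simp), List.getD_eq_getElem _ _ (by simp)]
  simp

theorem num_eq (e : Fin I.n) (i : Fin I.d) : I.num (e * I.d + i) = (I.vec e i).num := by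
  have he := DetMax.pair_lt e i
  unfold num encode
  rw [List.getD_append _ _ _ _ (by simp; omega),
    List.getD_append_right _ _ _ _ (by simp; omega), List.getD_eq_getElem _ _ (by simp; omega)]
  simp only [List.getElem_ofFn]
  congr <;> apply Fin.ext
  · rw [Fin.coe_divNat]
    simp
    rw [show 2 + I.n + (e * I.d + i) - (I.n + 1 + 1) = e * I.d + i by omega, DetMax.pair_div]
  · rw [Fin.coe_modNat]
    simp
    rw [show 2 + I.n + (e * I.d + i) - (I.n + 1 + 1) = e * I.d + i by omega, DetMax.pair_mod]

theorem den_eq (e : Fin I.n) (i : Fin I.d) : I.den (e * I.d + i) = ((I.vec e i).den : ℤ) := by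
  have he := DetMax.pair_lt e i
  unfold den encode
  rw [List.getD_append_right _ _ _ _ (by simp; omega), List.getD_eq_getElem _ _ (by simp; omega)]
  simp only [List.getElem_ofFn]
  congr <;> apply Fin.ext
  · rw [Fin.coe_divNat]
    simp
    rw [show 2 + I.n + I.n * I.d + (e * I.d + i) - (I.n + I.n * I.d + 1 + 1) = e * I.d + i by omega,
      DetMax.pair_div]
  · rw [Fin.coe_modNat]
    simp
    rw [show 2 + I.n + I.n * I.d + (e * I.d + i) - (I.n + I.n * I.d + 1 + 1) = e * I.d + i by omega,
      DetMax.pair_mod]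

/-- The product of the denominators. -/
def commonDen (k : ℕ) : ℤ := ∏ y ∈ range k, I.den y

/-- The coordinates multiplied by all denominators. -/
def scaled (y : ℕ) : ℤ := I.num y * (I.commonDen (I.n * I.d) / I.den y)

/-- A bound for the scaled coordinates. -/
def mass (k : ℕ) : ℕ := 1 + ∑ y ∈ range k, (I.scaled y).natAbs

/-- The factor that makes the input vectors long compared to the artificial ones. -/
def bonus (k : ℕ) : ℕ := (I.d * I.mass (I.n * I.d) + 1) ^ k

theorem den_pos {y : ℕ} (hy : y < I.n * I.d) : 0 < I.den y := by
  obtain ⟨e, i, rfl, -, -⟩ := DetMax.exists_fin_pair hy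
  rw [den_eq]
  exact_mod_cast (I.vec e i).den_pos

theorem commonDen_pos {k : ℕ} (hk : k ≤ I.n * I.d) : 0 < I.commonDen k :=
  prod_pos fun _ hy => I.den_pos ((mem_range.1 hy).trans_le hk)

theorem scaled_eq (e : Fin I.n) (i : Fin I.d) :
    (I.scaled (e * I.d + i) : ℚ) = I.commonDen (I.n * I.d) * I.vec e i := by
  have h1 : I.den (e * I.d + i) ∣ I.commonDen (I.n * I.d) :=
    dvd_prod_of_mem _ (mem_range.2 (DetMax.pair_lt e i))
  have h2 := I.den_pos (DetMax.pair_lt e i)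
  unfold scaled
  rw [Int.cast_mul, Int.cast_div h1 (by exact_mod_cast h2.ne'), I.num_eq, I.den_eq]
  conv_rhs => rw [← Rat.num_div_den (I.vec e i)]
  push_cast
  ring

theorem natAbs_scaled_le_mass {k y : ℕ} (hy : y < k) : (I.scaled y).natAbs ≤ I.mass k := by
  unfold mass
  have := single_le_sum (f := fun y => (I.scaled y).natAbs) (fun _ _ => Nat.zero_le _)
    (mem_range.2 hy)
  omega

/-- The encoding length. -/
abbrev size : ℕ := inputSize I.encode

theorem length_le_size : 2 + I.n + I.n * I.d + I.n * I.d ≤ I.size :=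
  I.encode_length ▸ length_le_inputSize _

theorem d_le_n : I.d ≤ I.n := by
  simpa using Fintype.card_le_of_surjective _ I.part_surjective

theorem abs_num_le (y : ℕ) : |I.num y| ≤ 2 ^ I.size := abs_getD_le _ _

theorem abs_den_le (y : ℕ) : |I.den y| ≤ 2 ^ I.size := abs_getD_le _ _

theorem abs_commonDen_le {k : ℕ} (hk : k ≤ I.n * I.d) :
    |I.commonDen k| ≤ (2 ^ I.size) ^ I.size := by
  unfold commonDen
  rw [abs_prod]
  calc _ ≤ ∏ _y ∈ range k, (2 : ℤ) ^ I.size :=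
        prod_le_prod (fun _ _ => abs_nonneg _) fun y _ => I.abs_den_le y
    _ = (2 ^ I.size) ^ k := by simp
    _ ≤ _ := pow_le_pow_right₀ (one_le_pow₀ (by norm_num)) (by have := I.length_le_size; omega)

theorem natAbs_scaled_le (y : ℕ) : (I.scaled y).natAbs ≤ (2 ^ I.size) ^ (I.size + 1) := by
  have h1 : (I.commonDen (I.n * I.d) / I.den y).natAbs ≤ (2 ^ I.size) ^ I.size := by
    have h2 := I.abs_commonDen_le le_rfl
    rw [Int.abs_eq_natAbs] at h2
    exact (Int.natAbs_ediv_le_natAbs _ _).trans (by exact_mod_cast h2)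
  have h3 := I.abs_num_le y
  rw [Int.abs_eq_natAbs] at h3
  unfold scaled
  rw [Int.natAbs_mul, pow_succ, mul_comm]
  exact Nat.mul_le_mul h1 (by exact_mod_cast h3)

theorem two_le_size : 2 ≤ I.size := by
  have := I.length_le_size
  omega

theorem mass_le {k : ℕ} (hk : k ≤ I.n * I.d) : I.mass k ≤ (2 ^ I.size) ^ (I.size + 2) := by
  have h1 : ∑ y ∈ range k, (I.scaled y).natAbs ≤ k * (2 ^ I.size) ^ (I.size + 1) := by
    calc _ ≤ ∑ _y ∈ range k, (2 ^ I.size) ^ (I.size + 1) :=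
          sum_le_sum fun y _ => I.natAbs_scaled_le y
      _ = _ := by simp
  have h2 : I.size < 2 ^ I.size := Nat.lt_two_pow_self
  have h3 := I.length_le_size
  have h4 : 1 ≤ (2 ^ I.size) ^ (I.size + 1) := Nat.one_le_pow _ _ (by positivity)
  unfold mass
  calc _ ≤ (2 ^ I.size) ^ (I.size + 1) + k * (2 ^ I.size) ^ (I.size + 1) := by omega
    _ = (k + 1) * (2 ^ I.size) ^ (I.size + 1) := by ring
    _ ≤ 2 ^ I.size * (2 ^ I.size) ^ (I.size + 1) := Nat.mul_le_mul_right _ (by omega)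
    _ = _ := by ring

theorem bonus_le (k : ℕ) : I.bonus k ≤ (2 ^ I.size) ^ ((I.size + 3) * k) := by
  have h1 := I.mass_le le_rfl
  have h2 : I.size < 2 ^ I.size := Nat.lt_two_pow_self
  have h3 := I.length_le_size
  have h4 := I.d_le_n
  have h5 : 1 ≤ (2 ^ I.size) ^ (I.size + 2) := Nat.one_le_pow _ _ (by positivity)
  unfold bonus
  rw [pow_mul]
  refine Nat.pow_le_pow_left ?_ _
  calc I.d * I.mass (I.n * I.d) + 1
      ≤ I.d * (2 ^ I.size) ^ (I.size + 2) + (2 ^ I.size) ^ (I.size + 2) :=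
        Nat.add_le_add (Nat.mul_le_mul_left _ h1) h5
    _ = (I.d + 1) * (2 ^ I.size) ^ (I.size + 2) := by ring
    _ ≤ 2 ^ I.size * (2 ^ I.size) ^ (I.size + 2) := Nat.mul_le_mul_right _ (by omega)
    _ = _ := by ring

end PartitionInstance

/-! ### The integer vectors with artificial unit vectors, and their bit lengths -/

namespace PartitionInstance

open RAM Finset Polynomial

variable (I : PartitionInstance)

/-- The bound on the bit lengths of the algorithm's numbers in terms of the encoding length. -/
noncomputable def bitPoly : ℕ[X] :=
  (4 * X) ^ 4 + X * (1 + (4 + X + X * ((X + 3) * (6 * X + 1) + (X + 2))) * (X + 1))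

theorem bitPoly_eval (z : ℕ) : bitPoly.eval z =
    (4 * z) ^ 4 + z * (1 + (4 + z + z * ((z + 3) * (6 * z + 1) + (z + 2))) * (z + 1)) := by
  simp [bitPoly]

/-- The number of extra factors that the artificial vectors cost. -/
abbrev level : ℕ := 6 * I.d + 1

/-- The integer vectors of the search: the scaled input vectors followed by the unit vectors. -/
def vectors : Fin (I.n + I.d) → Fin I.d → ℤ :=
  Fin.addCases (fun e i => I.bonus I.level * I.scaled (e * I.d + i))
    (fun r i => if r = i then 1 else 0)

/-- The parts of the search; each part contains one unit vector. -/
def parts : Fin (I.n + I.d) → Fin I.d := Fin.addCases I.part id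

theorem one_le_bonus (k : ℕ) : 1 ≤ I.bonus k := Nat.one_le_pow _ _ (by omega)

theorem one_le_mass (k : ℕ) : 1 ≤ I.mass k := by
  unfold mass
  omega

theorem abs_vectors_le (e : Fin (I.n + I.d)) (j : Fin I.d) :
    |I.vectors e j| ≤ (I.bonus I.level * I.mass (I.n * I.d) : ℕ) := by
  have h1 := I.one_le_bonus I.level
  have h2 := I.one_le_mass (I.n * I.d)
  have h3 : 1 ≤ I.bonus I.level * I.mass (I.n * I.d) := Nat.mul_le_mul h1 h2
  unfold vectors
  refine Fin.addCases (fun e => ?_) (fun r => ?_) e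
  · rw [Fin.addCases_left, Int.abs_eq_natAbs, Int.natAbs_mul, Int.natAbs_natCast]
    exact_mod_cast Nat.mul_le_mul_left _ (I.natAbs_scaled_le_mass (DetMax.pair_lt e j))
  · rw [Fin.addCases_right]
    split_ifs
    · rw [abs_one]
      exact_mod_cast h3
    · rw [abs_zero]
      positivity

/-- With `B = 2 ^ size`, every factor is bounded by a power of `B`: `4 ≤ B`, `(d+1)⁴ ≤ B⁴`, `d! ≤ B
^ size`, and the coordinates are at most `B ^ h` for the quadratic polynomial `h` occurring in
`bitPoly`. Adding the exponents gives its second summand; the first summand accounts for the loop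
lengths. -/
theorem bits_le_bitPoly : 4 * ((I.d + 1) ^ 4 * (I.d.factorial *
      (I.bonus I.level * I.mass (I.n * I.d)) ^ I.d)) ^ (I.d + 1) ≤ 2 ^ bitPoly.eval I.size := by
  have h1 := I.length_le_size
  have h2 := I.d_le_n
  have h3 := I.mass_le le_rfl
  have h4 := I.bonus_le I.level
  generalize hz : I.size = z at *
  have hd : I.d ≤ z := by omega
  set B := 2 ^ z with hB
  have hB1 : 1 ≤ B := Nat.one_le_two_pow
  have hzB : z + 1 ≤ B := Nat.lt_two_pow_self
  set h := (z + 3) * (6 * z + 1) + (z + 2)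
  have hH : I.bonus I.level * I.mass (I.n * I.d) ≤ B ^ h := by
    rw [pow_add]
    refine Nat.mul_le_mul (h4.trans (Nat.pow_le_pow_right hB1 ?_)) h3
    gcongr
    unfold level
    omega
  have hfac : I.d.factorial ≤ B ^ z :=
    calc I.d.factorial ≤ I.d ^ I.d := Nat.factorial_le_pow _
      _ ≤ B ^ I.d := Nat.pow_le_pow_left (by omega) _
      _ ≤ B ^ z := Nat.pow_le_pow_right hB1 hd
  have hpow : (I.bonus I.level * I.mass (I.n * I.d)) ^ I.d ≤ (B ^ h) ^ z :=
    (Nat.pow_le_pow_left hH _).trans (Nat.pow_le_pow_right (Nat.one_le_pow _ _ hB1) hd)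
  have h5 : (I.d + 1) ^ 4 ≤ B ^ 4 := Nat.pow_le_pow_left (by omega) _
  have h6 : (I.d + 1) ^ 4 * (I.d.factorial * (I.bonus I.level * I.mass (I.n * I.d)) ^ I.d)
      ≤ B ^ (4 + z + z * h) := by
    calc _ ≤ B ^ 4 * (B ^ z * (B ^ h) ^ z) := Nat.mul_le_mul h5 (Nat.mul_le_mul hfac hpow)
      _ = _ := by rw [← pow_mul B h z, ← pow_add, ← pow_add, mul_comm h z, add_assoc]
  have h7 : 4 ≤ B :=
    calc 4 = 2 ^ 2 := rfl
      _ ≤ 2 ^ z := Nat.pow_le_pow_right (by norm_num) (by omega)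
  calc _ ≤ B * (B ^ (4 + z + z * h)) ^ (z + 1) := by
        refine Nat.mul_le_mul h7 ((Nat.pow_le_pow_left h6 _).trans ?_)
        exact Nat.pow_le_pow_right (Nat.one_le_pow _ _ hB1) (by omega)
    _ = B ^ (1 + (4 + z + z * h) * (z + 1)) := by rw [← pow_mul, pow_add, pow_one]
    _ = 2 ^ (z * (1 + (4 + z + z * h) * (z + 1))) := by rw [hB, ← pow_mul]
    _ ≤ _ := by
      refine Nat.pow_le_pow_right (by norm_num) ?_
      rw [bitPoly_eval]
      exact Nat.le_add_left _ _

theorem size_pow_le : (4 * I.size) ^ 4 ≤ bitPoly.eval I.size := by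
  rw [bitPoly_eval]
  exact Nat.le_add_right _ _

/-- The data of the local search. -/
noncomputable def ctx : DetMax.Ctx where
  d := I.d
  m := I.n + I.d
  X := I.vectors
  part := I.parts
  H := I.bonus I.level * I.mass (I.n * I.d)
  L := bitPoly.eval I.size
  one_le_H := Nat.mul_le_mul (I.one_le_bonus _) (I.one_le_mass _)
  abs_X_le := I.abs_vectors_le
  size_le := by
    refine le_trans (Nat.pow_le_pow_left ?_ 4) I.size_pow_le
    have h1 := I.length_le_size
    have h2 := I.d_le_n
    omega
  bits_le := I.bits_le_bitPoly

theorem size_le_bitPoly : I.size ≤ bitPoly.eval I.size :=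
  le_trans (by
    calc I.size ≤ (4 * I.size) ^ 1 := by rw [pow_one]; omega
      _ ≤ (4 * I.size) ^ 4 := Nat.pow_le_pow_right (by have := I.two_le_size; omega) (by norm_num))
    I.size_pow_le

/-- The initial basis consists of the unit vectors. -/
def startBasis (r : Fin I.d) : Fin (I.n + I.d) := Fin.natAdd I.n r

theorem vectors_startBasis (r : Fin I.d) :
    I.vectors (I.startBasis r) = (1 : Matrix (Fin I.d) (Fin I.d) ℤ) r := by
  ext i
  simp [vectors, startBasis, Matrix.one_apply]

theorem bdet_startBasis : DetMax.bdet I.vectors I.startBasis = 1 := by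
  rw [DetMax.bdet, ← Matrix.det_one (n := Fin I.d)]
  congr 1
  ext r i
  rw [Matrix.of_apply, vectors_startBasis]

/-- For the identity matrix Cramer's rule just reads off coordinates, so the first tableau is the
transposed table of vectors and no determinant has to be computed. -/
theorem tab_startBasis (i : Fin I.d) (e : Fin (I.n + I.d)) :
    DetMax.tab I.vectors I.startBasis i e = I.vectors e i := by
  have h := Matrix.cramer_transpose_apply (1 : Matrix (Fin I.d) (Fin I.d) ℤ) (I.vectors e) i
  rw [Matrix.transpose_one, Matrix.cramer_one, Module.End.one_apply] at h
  rw [h, DetMax.tab, DetMax.bdet]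
  congr 1
  ext r j
  rw [Matrix.of_apply, Matrix.updateRow_apply]
  by_cases hr : r = i
  · rw [if_pos hr, hr, Function.update_self]
  · rw [if_neg hr, Function.update_of_ne hr, vectors_startBasis]

end PartitionInstance

/-! ### Setting up the local search -/

namespace RAM

theorem Op.eval_lt_of_lt {x y : ℤ} (h : x < y) : Op.eval .lt x y = 1 := if_pos h

theorem Op.eval_lt_of_le {x y : ℤ} (h : y ≤ x) : Op.eval .lt x y = 0 := if_neg (not_lt.2 h)

theorem Op.eval_eq_of_eq {x y : ℤ} (h : x = y) : Op.eval .eq x y = 1 := if_pos h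

theorem Op.eval_eq_of_ne {x y : ℤ} (h : x ≠ y) : Op.eval .eq x y = 0 := if_neg h

/-- Accumulating in a variable that is first set to a constant. -/
theorem Runs.accumulate {ι : Type} {sz : ι → ℕ} {P : ι → State → Prop} {a c : ℕ} (hac : a ≠ c)
    {bound e : Expr} {z : ℤ} (N : ι → ℕ) (V : ι → ℕ → ℤ) (hN : ∀ i, N i ≤ sz i)
    (hP : ∀ i s s', P i s → (∀ x, x ≠ a → s' x = s x) → P i s') (h0 : ∀ i, z = V i 0)
    (hb : ∀ i s (s' : State), P i s → (∀ x, x ≠ a → x ≠ c → s' x = s x) → bound.eval s' = N i)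
    (hstep : ∀ i s (s' : State) (k : ℕ), P i s → (∀ x, x ≠ a → x ≠ c → s' x = s x) →
      s' a 0 = V i k → s' c 0 = k → k < N i → e.eval s' = V i (k + 1))
    (hV : ∀ i k, k ≤ N i → |V i k| ≤ 2 ^ sz i) :
    Runs sz P (.seq (.set a (.const z)) (.for c bound (.set a e)))
      (fun i _ s' => s' a 0 = V i (N i)) := by
  have h1 : Runs sz P (.set a (.const z)) (fun i s s' => s' a 0 = V i 0) := by
    refine Runs.straight trivial fun i s _ hs => ⟨?_, hs.write _ _ ?_⟩
    · rw [← h0]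
      exact State.write_same _ _ _ _
    · rw [Expr.eval_const, h0 i]
      exact hV i 0 (Nat.zero_le _)
  refine h1.seq_post ((Runs.fold hac N V hN
    (P := fun i s => P i s ∧ s a 0 = V i 0) (fun i s h => h.2)
    (fun i s s' h => hb i s s' h.1) (fun i s s' k h => hstep i s s' k h.1) hV)) ?_
  intro i s s' h h' hf _
  exact ⟨hP i s s' h fun x hx => hf x (by simpa [Prog.set, Prog.writes] using hx), h'⟩

end RAM

/-! ### Reading the input, clearing denominators and computing the scaling factor -/

namespace PartitionInstance

open RAM Finset DetMax

variable (I : PartitionInstance)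

/-- The bound on the bit lengths of the algorithm's numbers. -/
noncomputable abbrev bits : ℕ := bitPoly.eval I.size

theorem bonus_mul_mass_le : I.bonus I.level * I.mass (I.n * I.d) ≤
    (2 ^ I.size) ^ ((I.size + 3) * (6 * I.size + 1) + (I.size + 2)) := by
  rw [pow_add]
  refine Nat.mul_le_mul ((I.bonus_le I.level).trans (Nat.pow_le_pow_right Nat.one_le_two_pow ?_))
    (I.mass_le le_rfl)
  have h1 := I.length_le_size
  have h2 := I.d_le_n
  gcongr
  unfold level
  omega

theorem pow_le_two_pow_bits {k : ℕ}
    (hk : k ≤ (I.size + 3) * (6 * I.size + 1) + (I.size + 2)) :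
    (2 ^ I.size) ^ k ≤ 2 ^ I.bits := by
  rw [← pow_mul]
  refine Nat.pow_le_pow_right (by norm_num) ?_
  have h2 := I.two_le_size
  unfold bits
  rw [bitPoly_eval]
  refine le_trans (Nat.mul_le_mul_left _ (hk.trans ?_)) (Nat.le_add_left _ _)
  generalize (I.size + 3) * (6 * I.size + 1) + (I.size + 2) = h
  nlinarith [Nat.zero_le (I.size * h), Nat.zero_le (I.size * h * I.size)]

theorem mass_le_two_pow {k : ℕ} (hk : k ≤ I.n * I.d) : |(I.mass k : ℤ)| ≤ 2 ^ I.bits := by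
  rw [Nat.abs_cast]
  exact_mod_cast (I.mass_le hk).trans (I.pow_le_two_pow_bits (by omega))

theorem commonDen_le_two_pow {k : ℕ} (hk : k ≤ I.n * I.d) : |I.commonDen k| ≤ 2 ^ I.bits :=
  (I.abs_commonDen_le hk).trans (by exact_mod_cast I.pow_le_two_pow_bits (by omega))

theorem scaled_le_two_pow (k : ℕ) : |I.scaled k| ≤ 2 ^ I.bits := by
  rw [Int.abs_eq_natAbs]
  exact_mod_cast (I.natAbs_scaled_le k).trans (I.pow_le_two_pow_bits (by omega))

theorem bonus_le_two_pow {k : ℕ} (hk : k ≤ I.level) : |(I.bonus k : ℤ)| ≤ 2 ^ I.bits := by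
  have h1 := I.length_le_size
  have h2 := I.d_le_n
  rw [Nat.abs_cast]
  refine mod_cast (I.bonus_le k).trans (I.pow_le_two_pow_bits ?_)
  refine le_trans (Nat.mul_le_mul_left _ (hk.trans ?_)) (Nat.le_add_right _ _)
  unfold level
  omega

theorem vectors_le_two_pow (e : Fin (I.n + I.d)) (j : Fin I.d) : |I.vectors e j| ≤ 2 ^ I.bits :=
  (I.abs_vectors_le e j).trans
    (by exact_mod_cast I.bonus_mul_mass_le.trans (I.pow_le_two_pow_bits le_rfl))

theorem four_mul_sq_le_bits : (4 * I.size) ^ 2 ≤ I.bits :=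
  (Nat.pow_le_pow_right (by have := I.two_le_size; omega) (by norm_num)).trans I.size_pow_le

theorem natCast_le_two_pow {k : ℕ} (hk : k ≤ (4 * I.size) ^ 2) : |(k : ℤ)| ≤ 2 ^ I.bits := by
  rw [Nat.abs_cast]
  exact_mod_cast (hk.trans I.four_mul_sq_le_bits).trans Nat.lt_two_pow_self.le

/-! Further arrays, used before and after the search. -/

@[simp] abbrev vN : ℕ := 22
@[simp] abbrev aRep : ℕ := 23
@[simp] abbrev vDen : ℕ := 24
@[simp] abbrev vMass : ℕ := 25
@[simp] abbrev vBonus : ℕ := 26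
@[simp] abbrev aScaled : ℕ := 27

/-- The input is intact and the dimensions are stored. -/
def Loaded (s : State) : Prop :=
  s 0 = State.init I.encode 0 ∧ s vD 0 = I.d ∧ s vN 0 = I.n ∧ s vM 0 = (I.n + I.d : ℕ)

variable {I}

theorem Loaded.congr {s s' : State} (h : I.Loaded s) (h0 : s' 0 = s 0) (h1 : s' vD = s vD)
    (h2 : s' vN = s vN) (h3 : s' vM = s vM) : I.Loaded s' := by
  unfold Loaded
  rw [h0, h1, h2, h3]
  exact h

/-- Read the dimensions. -/
def loadProg : Prog :=
  .seq (.set vD (.read 0 (.const 0))) (.seq (.set vN (.read 0 (.const 1)))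
    (.set vM (.var vN + .var vD)))

theorem runs_load : Runs bits (fun I s => s 0 = State.init I.encode 0) loadProg
    (fun I _ s' => I.Loaded s') := by
  refine Runs.straight ⟨trivial, trivial, trivial⟩ ?_
  intro I s h hs
  have h1 := I.length_le_size
  have h2 := I.d_le_n
  have h3 : 2 * I.size ≤ (4 * I.size) ^ 2 := by nlinarith
  have e0 : (Expr.read 0 (.const 0)).eval s = I.d := by
    rw [Expr.eval_read, h]
    exact State.init_natCast I.encode 0
  have e1 : (Expr.read 0 (.const 1)).eval (s.write vD 0 I.d) = I.n := by
    rw [Expr.eval_read, State.write_of_ne _ _ _ (by decide), h]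
    exact State.init_natCast I.encode 1
  have e2 : (Expr.var vN + .var vD).eval ((s.write vD 0 I.d).write vN 0 I.n)
      = (I.n + I.d : ℕ) := by
    rw [Expr.eval_add, Expr.eval_var, Expr.eval_var, State.write_same,
      State.write_of_ne _ _ _ (by decide), State.write_same]
    push_cast
    rfl
  rw [loadProg, Prog.run_seq, Prog.run_seq, Prog.run_set, Prog.run_set, Prog.run_set, e0, e1, e2]
  refine ⟨⟨?_, ?_, ?_, State.write_same _ _ _ _⟩, ((hs.write _ _ (I.natCast_le_two_pow ?_)).write
    _ _ (I.natCast_le_two_pow ?_)).write _ _ (I.natCast_le_two_pow ?_)⟩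
  · rw [State.write_of_ne _ _ _ (by decide), State.write_of_ne _ _ _ (by decide),
      State.write_of_ne _ _ _ (by decide), h]
  · rw [State.write_of_ne _ _ _ (by decide), State.write_of_ne _ _ _ (by decide),
      State.write_same]
  · rw [State.write_of_ne _ _ _ (by decide), State.write_same]
  all_goals omega

/-- The numerator at the position of the counter. -/
abbrev numExpr : Expr := .read 0 (.const 2 + .var vN + .var cX)

/-- The denominator at the position of the counter. -/
abbrev denExpr : Expr := .read 0 (.const 2 + .var vN + .var vN * .var vD + .var cX)

theorem Loaded.numExpr_eval {s : State} (h : I.Loaded s) {k : ℕ} (hk : s cX 0 = k) :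
    numExpr.eval s = I.num k := by
  simp only [Expr.eval_read, Expr.eval_add, Expr.eval_const, Expr.eval_var]
  rw [h.1, h.2.2.1, hk, num, ← State.init_natCast]
  push_cast
  rfl

theorem Loaded.denExpr_eval {s : State} (h : I.Loaded s) {k : ℕ} (hk : s cX 0 = k) :
    denExpr.eval s = I.den k := by
  simp only [Expr.eval_read, Expr.eval_add, Expr.eval_const, Expr.eval_var, Expr.eval_mul]
  rw [h.1, h.2.1, h.2.2.1, hk, den, ← State.init_natCast]
  push_cast
  rfl

theorem Loaded.of_agree {s s' : State} {a : ℕ} (h : I.Loaded s) (ha : a ∉ [0, vD, vN, vM])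
    (hf : ∀ x, x ≠ a → x ≠ cX → s' x = s x) : I.Loaded s' := by
  simp only [List.mem_cons, List.not_mem_nil, or_false, not_or] at ha
  exact h.congr (hf _ (Ne.symm ha.1) (by decide)) (hf _ (Ne.symm ha.2.1) (by decide))
    (hf _ (Ne.symm ha.2.2.1) (by decide)) (hf _ (Ne.symm ha.2.2.2) (by decide))

theorem nd_le_bits (I : PartitionInstance) : I.n * I.d ≤ I.bits :=
  le_trans (by have := I.length_le_size; omega) I.size_le_bitPoly

/-- Multiply the denominators. -/
def commonDenProg : Prog :=
  .seq (.set vDen (.const 1)) (.for cX (.var vN * .var vD) (.set vDen (.var vDen * denExpr)))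

theorem runs_commonDen : Runs bits Loaded commonDenProg
    (fun I _ s' => s' vDen 0 = I.commonDen (I.n * I.d)) := by
  refine Runs.accumulate (a := vDen) (c := cX) (by decide)
    (fun I : PartitionInstance => I.n * I.d) commonDen nd_le_bits ?_ ?_ ?_ ?_ ?_
  · exact fun I s s' h hf => h.of_agree (a := vDen) (by decide) fun x hx _ => hf x hx
  · exact fun I => rfl
  · intro I s s' h hf
    have h' := h.of_agree (by decide) hf
    rw [Expr.eval_mul, Expr.eval_var, Expr.eval_var, h'.2.1, h'.2.2.1]
    push_cast
    rfl
  · intro I s s' k h hf hv hc _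
    have h' := h.of_agree (by decide) hf
    rw [Expr.eval_mul, h'.denExpr_eval hc, Expr.eval_var, hv, commonDen, commonDen, prod_range_succ]
  · exact fun I k hk => I.commonDen_le_two_pow hk

/-- Clear the denominators. -/
def scaledProg : Prog :=
  .for cX (.var vN * .var vD) (.assign aScaled (.var cX) (numExpr * (.var vDen / denExpr)))

theorem runs_scaled : Runs bits (fun I s => I.Loaded s ∧ s vDen 0 = I.commonDen (I.n * I.d))
    scaledProg (fun I _ s' => ∀ k < I.n * I.d, s' aScaled k = I.scaled k) := by
  refine Runs.fill (a := aScaled) (c := cX) (by decide)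
    (fun I : PartitionInstance => I.n * I.d) scaled nd_le_bits ?_ ?_ ?_
  · rintro I s s' ⟨h, -⟩ hf
    have h' := h.of_agree (by decide) hf
    rw [Expr.eval_mul, Expr.eval_var, Expr.eval_var, h'.2.1, h'.2.2.1]
    push_cast
    rfl
  · rintro I s s' k ⟨h, hD⟩ hf hc _
    have h' := h.of_agree (by decide) hf
    rw [Expr.eval_mul, Expr.eval_div, h'.denExpr_eval hc, h'.numExpr_eval hc, Expr.eval_var,
      hf vDen (by decide) (by decide), hD, scaled]
  · exact fun I k _ => I.scaled_le_two_pow k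

/-- Add up the absolute values. -/
def massProg : Prog :=
  .seq (.set vMass (.const 1)) (.for cX (.var vN * .var vD)
    (.set vMass (.var vMass + .abs (.read aScaled (.var cX)))))

theorem runs_mass : Runs bits
    (fun I s => I.Loaded s ∧ ∀ k < I.n * I.d, s aScaled k = I.scaled k) massProg
    (fun I _ s' => s' vMass 0 = I.mass (I.n * I.d)) := by
  refine Runs.accumulate (a := vMass) (c := cX) (by decide)
    (fun I : PartitionInstance => I.n * I.d) (fun (I : PartitionInstance) k => (I.mass k : ℤ)) nd_le_bits
    ?_ ?_ ?_ ?_ ?_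
  · rintro I s s' ⟨h, h2⟩ hf
    refine ⟨h.of_agree (a := vMass) (by decide) fun x hx _ => hf x hx, ?_⟩
    rw [hf aScaled (by decide)]
    exact h2
  · intro I
    simp [mass]
  · rintro I s s' ⟨h, -⟩ hf
    have h' := h.of_agree (by decide) hf
    rw [Expr.eval_mul, Expr.eval_var, Expr.eval_var, h'.2.1, h'.2.2.1]
    push_cast
    rfl
  · rintro I s s' k ⟨h, h2⟩ hf hv hc hk
    rw [Expr.eval_add, Expr.eval_abs, Expr.eval_read, Expr.eval_var, Expr.eval_var, hv, hc,
      hf aScaled (by decide) (by decide), h2 k hk, mass, mass, sum_range_succ, Int.abs_eq_natAbs]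
    push_cast
    ring
  · exact fun I k hk => I.mass_le_two_pow hk

/-- Compute the factor for the input vectors. -/
def bonusProg : Prog :=
  .seq (.set vBonus (.const 1)) (.for cX (.const 6 * .var vD + .const 1)
    (.set vBonus (.var vBonus * (.var vD * .var vMass + .const 1))))

theorem level_le_bits (I : PartitionInstance) : I.level ≤ I.bits := by
  refine le_trans ?_ I.four_mul_sq_le_bits
  have h1 := I.length_le_size
  have h2 := I.d_le_n
  have h3 : I.d ≤ I.size := by omega
  have h4 := I.two_le_size
  unfold level
  nlinarith

theorem runs_bonus : Runs bits
    (fun I s => I.Loaded s ∧ s vMass 0 = I.mass (I.n * I.d)) bonusProg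
    (fun I _ s' => s' vBonus 0 = I.bonus I.level) := by
  refine Runs.accumulate (a := vBonus) (c := cX) (by decide) level
    (fun (I : PartitionInstance) k => (I.bonus k : ℤ)) level_le_bits
    ?_ ?_ ?_ ?_ ?_
  · rintro I s s' ⟨h, h2⟩ hf
    refine ⟨h.of_agree (a := vBonus) (by decide) fun x hx _ => hf x hx, ?_⟩
    rw [hf vMass (by decide)]
    exact h2
  · intro I
    simp [bonus]
  · rintro I s s' ⟨h, -⟩ hf
    have h' := h.of_agree (by decide) hf
    rw [Expr.eval_add, Expr.eval_mul, Expr.eval_var, h'.2.1, Expr.eval_const, Expr.eval_const]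
    push_cast
    rfl
  · rintro I s s' k ⟨h, h2⟩ hf hv hc hk
    have h' := h.of_agree (by decide) hf
    rw [Expr.eval_mul, Expr.eval_add, Expr.eval_mul, Expr.eval_var, Expr.eval_var, Expr.eval_var,
      hv, h'.2.1, hf vMass (by decide) (by decide), h2, Expr.eval_const, bonus, bonus, pow_succ]
    push_cast
    ring
  · exact fun I k hk => I.bonus_le_two_pow hk

end PartitionInstance

/-! ### The memory at the start of the search -/

namespace PartitionInstance

open RAM Finset DetMax

/-- The entries of the vectors of the search, indexed by natural numbers. -/
def vectorsNat (I : PartitionInstance) (e i : ℕ) : ℤ :=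
  if e < I.n then I.bonus I.level * I.scaled (e * I.d + i) else if e = I.n + i then 1 else 0

theorem vectorsNat_eq (I : PartitionInstance) (e : Fin (I.n + I.d)) (i : Fin I.d) :
    I.vectorsNat e i = I.vectors e i := by
  unfold vectorsNat vectors
  refine Fin.addCases (fun e => ?_) (fun r => ?_) e
  · rw [Fin.addCases_left, Fin.val_castAdd, if_pos e.2]
  · rw [Fin.addCases_right, Fin.val_natAdd, if_neg (by omega)]
    by_cases h : r = i
    · rw [if_pos h, if_pos (by rw [h])]
    · rw [if_neg h, if_neg fun h' => h (Fin.ext (by omega))]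

/-- The parts of the search, indexed by natural numbers. -/
def partsNat (I : PartitionInstance) (e : ℕ) : ℤ :=
  if e < I.n then I.encode.getD (2 + e) 0 else e - I.n

theorem partsNat_eq (I : PartitionInstance) (e : Fin (I.n + I.d)) :
    I.partsNat e = (I.parts e : ℕ) := by
  unfold partsNat parts
  refine Fin.addCases (fun e => ?_) (fun r => ?_) e
  · rw [Fin.addCases_left, Fin.val_castAdd, if_pos e.2, encode_getD_part]
  · rw [Fin.addCases_right, Fin.val_natAdd, if_neg (by omega)]
    push_cast
    simp

variable {I : PartitionInstance}

/-- Store the initial tableau. -/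
def startTableauProg : Prog :=
  .for cX (.var vD * .var vM) (.assign aT (.var cX)
    (.op .lt (.var cX - .var cX / .var vM * .var vM) (.var vN) *
      (.var vBonus * .read aScaled ((.var cX - .var cX / .var vM * .var vM) * .var vD
        + .var cX / .var vM))
      + .op .eq (.var cX - .var cX / .var vM * .var vM) (.var vN + .var cX / .var vM)))

theorem dm_le_sq (I : PartitionInstance) : I.d * (I.n + I.d) ≤ (4 * I.size) ^ 2 := by
  have h1 := I.length_le_size
  have h2 := I.d_le_n
  have h3 : I.d ≤ I.size := by omega
  have h4 : I.n + I.d ≤ 2 * I.size := by omega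
  nlinarith [Nat.mul_le_mul h3 h4]

theorem dm_le_bits (I : PartitionInstance) : I.d * (I.n + I.d) ≤ I.bits :=
  I.dm_le_sq.trans I.four_mul_sq_le_bits

theorem m_le_sq (I : PartitionInstance) : I.n + I.d ≤ (4 * I.size) ^ 2 := by
  have h1 := I.length_le_size
  have h2 := I.d_le_n
  nlinarith [I.two_le_size]

theorem runs_startTableau : Runs bits (fun I s => I.Loaded s ∧
      (∀ k < I.n * I.d, s aScaled k = I.scaled k) ∧ s vBonus 0 = I.bonus I.level)
    startTableauProg
    (fun I _ s' => ∀ (r : Fin I.d) (e : Fin (I.n + I.d)),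
      s' aT ((r : ℕ) * (I.n + I.d : ℕ) + (e : ℕ)) = tab I.vectors I.startBasis r e) := by
  refine (Runs.fill (a := aT) (c := cX) (by decide)
    (fun I : PartitionInstance => I.d * (I.n + I.d))
    (fun I k => I.vectorsNat (k % (I.n + I.d)) (k / (I.n + I.d))) dm_le_bits ?_ ?_ ?_).conseq
    (fun _ _ h => h) ?_
  · rintro I s s' ⟨h, -⟩ hf
    have h' := h.of_agree (by decide) hf
    rw [Expr.eval_mul, Expr.eval_var, Expr.eval_var, h'.2.1, h'.2.2.2]
    push_cast
    rfl
  · rintro I s s' k ⟨h, h2, h3⟩ hf hc hk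
    have h' := h.of_agree (by decide) hf
    obtain ⟨i, e, -, ei, ee⟩ := exists_fin_pair hk
    have ed : s' cX 0 / s' vM 0 = (i : ℕ) := by
      rw [hc, h'.2.2.2, ← ei]
      push_cast
      rfl
    have em : s' cX 0 - s' cX 0 / s' vM 0 * s' vM 0 = (e : ℕ) := by
      rw [hc, h'.2.2.2, natCast_sub_div_mul, ee]
    simp only [Expr.eval_add, Expr.eval_mul, Expr.eval_op, Expr.eval_read, Expr.eval_var,
      Expr.eval_sub, Expr.eval_div]
    rw [em, ed, h'.2.1, h'.2.2.1, hf vBonus (by decide) (by decide), h3,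
      hf aScaled (by decide) (by decide), ei, ee, vectorsNat]
    by_cases he : (e : ℕ) < I.n
    · have hs := h2 (e * I.d + i) (pair_lt (⟨e, he⟩ : Fin I.n) i)
      push_cast at hs
      rw [Op.eval_lt_of_lt (by exact_mod_cast he), Op.eval_eq_of_ne (by norm_cast; omega), hs,
        if_pos he]
      ring
    -- For an artificial vector the table of scaled coordinates is read beyond its end; the value is
    -- irrelevant because it is multiplied by the failed comparison.
    · rw [Op.eval_lt_of_le (by exact_mod_cast not_lt.1 he), if_neg he]
      by_cases h1 : (e : ℕ) = I.n + i
      · rw [if_pos h1, Op.eval_eq_of_eq (by exact_mod_cast h1)]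
        ring
      · rw [if_neg h1, Op.eval_eq_of_ne (by exact_mod_cast h1)]
        ring
  · intro I k hk
    obtain ⟨i, e, -, ei, ee⟩ := exists_fin_pair hk
    rw [ei, ee, vectorsNat_eq]
    exact I.vectors_le_two_pow e i
  · rintro I s s' - h - - r e
    have := h (r * (I.n + I.d) + e) (pair_lt r e)
    rw [pair_div, pair_mod, vectorsNat_eq] at this
    rw [tab_startBasis, ← this]
    push_cast
    rfl

/-- Store the parts. -/
def partsProg : Prog :=
  .for cX (.var vM) (.assign aPart (.var cX)
    (.op .lt (.var cX) (.var vN) * .read 0 (.const 2 + .var cX)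
      + (.const 1 - .op .lt (.var cX) (.var vN)) * (.var cX - .var vN)))

theorem runs_parts : Runs bits (fun I s => I.Loaded s) partsProg
    (fun I _ s' => ∀ e : Fin (I.n + I.d), s' aPart (e : ℕ) = (I.parts e : ℕ)) := by
  refine (Runs.fill (a := aPart) (c := cX) (by decide)
    (fun I : PartitionInstance => I.n + I.d) partsNat
    (fun I => I.m_le_sq.trans I.four_mul_sq_le_bits) ?_ ?_ ?_).conseq (fun _ _ h => h) ?_
  · rintro I s s' h hf
    exact (h.of_agree (by decide) hf).2.2.2
  · rintro I s s' k h hf hc hk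
    have h' := h.of_agree (by decide) hf
    simp only [Expr.eval_add, Expr.eval_mul, Expr.eval_op, Expr.eval_read, Expr.eval_var,
      Expr.eval_sub, Expr.eval_const]
    rw [hc, h'.2.2.1, partsNat]
    by_cases he : k < I.n
    · rw [Op.eval_lt_of_lt (by exact_mod_cast he), if_pos he, h'.1, ← State.init_natCast]
      push_cast
      ring
    · rw [Op.eval_lt_of_le (by exact_mod_cast not_lt.1 he), if_neg he]
      ring
  · intro I k hk
    rw [I.partsNat_eq ⟨k, hk⟩]
    refine I.natCast_le_two_pow ((I.parts ⟨k, hk⟩).2.le.trans (le_trans ?_ I.m_le_sq))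
    omega
  · rintro I s s' - h - - e
    rw [h e e.2, partsNat_eq]

/-- Store the initial basis. -/
def startBasisProg : Prog := .for cX (.var vD) (.assign aB (.var cX) (.var vN + .var cX))

theorem runs_startBasis : Runs bits (fun I s => I.Loaded s) startBasisProg
    (fun I _ s' => ∀ r : Fin I.d, s' aB (r : ℕ) = (I.startBasis r : ℕ)) := by
  refine (Runs.fill (a := aB) (c := cX) (by decide) d (fun I k => (I.n + k : ℕ))
    (fun I => (le_trans (by omega) I.m_le_sq).trans I.four_mul_sq_le_bits) ?_ ?_ ?_).conseq
    (fun _ _ h => h) ?_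
  · rintro I s s' h hf
    exact (h.of_agree (by decide) hf).2.1
  · rintro I s s' k h hf hc hk
    rw [Expr.eval_add, Expr.eval_var, Expr.eval_var, (h.of_agree (by decide) hf).2.2.1, hc]
    push_cast
    rfl
  · intro I k hk
    exact I.natCast_le_two_pow (le_trans (by omega) I.m_le_sq)
  · rintro I s s' - h - - r
    rw [h r r.2, startBasis, Fin.val_natAdd]

/-- Set up the local search. -/
def initProg : Prog :=
  .seq loadProg (.seq commonDenProg (.seq scaledProg (.seq massProg (.seq bonusProg
    (.seq startTableauProg (.seq partsProg (.seq startBasisProg (.set vDet (.const 1)))))))))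

/-- The state at the start of the search. -/
def Initialized (I : PartitionInstance) (s : State) : Prop :=
  I.Loaded s ∧ SearchInv I.ctx I.startBasis s

theorem injective_parts_startBasis (I : PartitionInstance) :
    Function.Injective fun r => I.parts (I.startBasis r) := by
  intro r t h
  simpa [parts, startBasis] using h

/-- The content of the memory after the initial tableau has been stored. -/
def HasTableau (I : PartitionInstance) (s : State) : Prop :=
  ∀ (r : Fin I.d) (e : Fin (I.n + I.d)),
    s aT ((r : ℕ) * (I.n + I.d : ℕ) + (e : ℕ)) = tab I.vectors I.startBasis r e

/-- The content of the memory after the parts have been stored. -/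
def HasParts (I : PartitionInstance) (s : State) : Prop :=
  ∀ e : Fin (I.n + I.d), s aPart (e : ℕ) = (I.parts e : ℕ)

theorem runs_initDet : Runs bits (fun I s => I.Loaded s ∧ I.HasTableau s ∧ I.HasParts s ∧
      ∀ r : Fin I.d, s aB (r : ℕ) = (I.startBasis r : ℕ)) (.set vDet (.const 1))
    (fun I _ => I.Initialized) := by
  refine Runs.straight trivial ?_
  rintro I s ⟨h, hT, hp, hb⟩ hs
  refine ⟨⟨h.congr rfl rfl rfl rfl, ⟨⟨h.2.1, h.2.2.2, hp⟩, ⟨hb, hT, ?_⟩, ?_⟩,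
    I.injective_parts_startBasis⟩, hs.write _ _ ?_⟩
  · exact (State.write_same _ _ _ _).trans I.bdet_startBasis.symm
  · exact I.bdet_startBasis ▸ one_ne_zero
  · simpa using one_le_pow₀ (by norm_num)

theorem runs_initBasis : Runs bits (fun I s => I.Loaded s ∧ I.HasTableau s ∧ I.HasParts s)
    (.seq startBasisProg (.set vDet (.const 1))) (fun I _ => I.Initialized) := by
  refine (runs_startBasis.pre fun I s h => h.1).seq_post runs_initDet ?_
  rintro I s s' ⟨h, hT, hp⟩ hQ hf -
  refine ⟨h.congr (hf _ (by decide)) (hf _ (by decide)) (hf _ (by decide)) (hf _ (by decide)),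
    ?_, ?_, hQ⟩
  · unfold HasTableau
    rw [hf aT (by decide)]
    exact hT
  · unfold HasParts
    rw [hf aPart (by decide)]
    exact hp

theorem runs_initParts : Runs bits (fun I s => I.Loaded s ∧ I.HasTableau s)
    (.seq partsProg (.seq startBasisProg (.set vDet (.const 1)))) (fun I _ => I.Initialized) := by
  refine (runs_parts.pre fun I s h => h.1).seq_post runs_initBasis ?_
  rintro I s s' ⟨h, hT⟩ hQ hf -
  refine ⟨h.congr (hf _ (by decide)) (hf _ (by decide)) (hf _ (by decide)) (hf _ (by decide)),
    ?_, hQ⟩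
  unfold HasTableau
  rw [hf aT (by decide)]
  exact hT

theorem runs_initTableau : Runs bits (fun I s => I.Loaded s ∧
      (∀ k < I.n * I.d, s aScaled k = I.scaled k) ∧ s vBonus 0 = I.bonus I.level)
    (.seq startTableauProg (.seq partsProg (.seq startBasisProg (.set vDet (.const 1)))))
    (fun I _ => I.Initialized) := by
  refine runs_startTableau.seq_post runs_initParts ?_
  rintro I s s' ⟨h, -⟩ hQ hf -
  exact ⟨h.congr (hf _ (by decide)) (hf _ (by decide)) (hf _ (by decide)) (hf _ (by decide)), hQ⟩

theorem runs_initBonus : Runs bits (fun I s => I.Loaded s ∧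
      (∀ k < I.n * I.d, s aScaled k = I.scaled k) ∧ s vMass 0 = I.mass (I.n * I.d))
    (.seq bonusProg (.seq startTableauProg (.seq partsProg (.seq startBasisProg
      (.set vDet (.const 1)))))) (fun I _ => I.Initialized) := by
  refine (runs_bonus.pre fun I s h => ⟨h.1, h.2.2⟩).seq_post runs_initTableau ?_
  rintro I s s' ⟨h, hS, -⟩ hQ hf -
  refine ⟨h.congr (hf _ (by decide)) (hf _ (by decide)) (hf _ (by decide)) (hf _ (by decide)), ?_,
    hQ⟩
  rw [hf aScaled (by decide)]
  exact hS

theorem runs_initMass : Runs bits (fun I s => I.Loaded s ∧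
      ∀ k < I.n * I.d, s aScaled k = I.scaled k)
    (.seq massProg (.seq bonusProg (.seq startTableauProg (.seq partsProg (.seq startBasisProg
      (.set vDet (.const 1))))))) (fun I _ => I.Initialized) := by
  refine runs_mass.seq_post runs_initBonus ?_
  rintro I s s' ⟨h, hS⟩ hQ hf -
  refine ⟨h.congr (hf _ (by decide)) (hf _ (by decide)) (hf _ (by decide)) (hf _ (by decide)), ?_,
    hQ⟩
  rw [hf aScaled (by decide)]
  exact hS

theorem runs_initScaled : Runs bits
    (fun I s => I.Loaded s ∧ s vDen 0 = I.commonDen (I.n * I.d))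
    (.seq scaledProg (.seq massProg (.seq bonusProg (.seq startTableauProg (.seq partsProg
      (.seq startBasisProg (.set vDet (.const 1)))))))) (fun I _ => I.Initialized) := by
  refine runs_scaled.seq_post runs_initMass ?_
  rintro I s s' ⟨h, -⟩ hQ hf -
  exact ⟨h.congr (hf _ (by decide)) (hf _ (by decide)) (hf _ (by decide)) (hf _ (by decide)), hQ⟩

theorem runs_init : Runs bits (fun I s => s 0 = State.init I.encode 0) initProg
    (fun I _ => I.Initialized) := by
  refine runs_load.seq_post (runs_commonDen.seq_post runs_initScaled ?_) fun _ _ _ _ h _ _ => h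
  rintro I s s' h hQ hf -
  exact ⟨h.congr (hf _ (by decide)) (hf _ (by decide)) (hf _ (by decide)) (hf _ (by decide)), hQ⟩

end PartitionInstance

/-! ### The output -/

namespace PartitionInstance

open RAM Finset DetMax

/-- An instance with a basis of the extended vectors. -/
abbrev WithBasis : Type := (I : PartitionInstance) × (Fin I.d → Fin (I.n + I.d))

/-- The data that the output depends on. -/
def Solved (j : WithBasis) (s : State) : Prop :=
  j.1.Loaded s ∧ j.1.HasParts s ∧ (∀ r : Fin j.1.d, s aB (r : ℕ) = (j.2 r : ℕ)) ∧ s 1 = 0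

theorem Solved.congr {j : WithBasis} {s s' : State} (h : Solved j s)
    (hf : ∀ x, x ≠ aRep → x ≠ cX → s' x = s x) : Solved j s' := by
  refine ⟨h.1.of_agree (a := aRep) (by decide) hf, ?_, ?_, ?_⟩
  · unfold HasParts
    rw [hf aPart (by decide) (by decide)]
    exact h.2.1
  · rw [hf aB (by decide) (by decide)]
    exact h.2.2.1
  · rw [hf 1 (by decide) (by decide), h.2.2.2]

/-- Choose an element of each part. -/
def anyProg : Prog := .for cX (.var vN) (.assign aRep (.read aPart (.var cX)) (.var cX))

/-- Later elements overwrite earlier ones of the same part, and since the partition map is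
surjective every cell is eventually filled. -/
theorem runs_any : Runs (fun j : WithBasis => j.1.bits) Solved anyProg
    (fun j _ s' => ∃ ρ : Fin j.1.d → Fin j.1.n, (∀ i, j.1.part (ρ i) = i) ∧
      ∀ i : Fin j.1.d, s' aRep (i : ℕ) = (ρ i : ℕ)) := by
  refine (Runs.for_assign (a := aRep) (c := cX) (by decide) (fun j : WithBasis => j.1.n)
    (fun j _ k v => ∀ e : Fin j.1.n, (e : ℕ) < k → ∃ f : Fin j.1.n, j.1.part f = j.1.part e ∧
      v (j.1.part e : ℕ) = (f : ℕ)) ?_ ?_ ?_ ?_).conseq (fun _ _ h => h) ?_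
  · exact fun j => (le_trans (by omega) j.1.m_le_sq).trans j.1.four_mul_sq_le_bits
  · intro j s _ e he
    omega
  · exact fun j s s' h hf => (h.congr hf).1.2.2.1
  · rintro ⟨I, b⟩ s s' k h hf hG hc hk
    simp only at h hG hk ⊢
    obtain ⟨-, hp, -⟩ := h.congr hf
    have ha : (Expr.read aPart (.var cX)).eval s' = (I.part ⟨k, hk⟩ : ℕ) := by
      rw [Expr.eval_read, Expr.eval_var, hc]
      exact (hp (Fin.castAdd I.d ⟨k, hk⟩)).trans (by rw [parts, Fin.addCases_left])
    rw [ha, Expr.eval_var, hc]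
    refine ⟨fun e he => ?_, I.natCast_le_two_pow (le_trans (by omega) I.m_le_sq)⟩
    by_cases hpe : I.part e = I.part ⟨k, hk⟩
    · refine ⟨⟨k, hk⟩, hpe.symm, ?_⟩
      rw [hpe, State.write_same]
    · obtain ⟨f, hf1, hf2⟩ := hG e (by
        have : (e : ℕ) ≠ k := fun h => hpe (by rw [show e = ⟨k, hk⟩ from Fin.ext h])
        omega)
      refine ⟨f, hf1, ?_⟩
      rw [State.write_apply, if_neg fun h => hpe (Fin.ext (by exact_mod_cast h.2)), hf2]
  · rintro ⟨I, b⟩ s s' - h - -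
    simp only at h
    choose e he using I.part_surjective
    choose f hf1 hf2 using h
    refine ⟨fun i => f (e i) (e i).2, fun i => by rw [hf1, he], fun i => ?_⟩
    rw [← hf2, he]

/-- A transversal of the parts that contains the input vectors of the basis is stored. -/
def HasTransversal (j : WithBasis) (k : ℕ) (v : ℤ → ℤ) : Prop :=
  ∃ ρ : Fin j.1.d → Fin j.1.n, (∀ i, j.1.part (ρ i) = i) ∧
    (∀ i : Fin j.1.d, v (i : ℕ) = (ρ i : ℕ)) ∧
    ∀ r : Fin j.1.d, (r : ℕ) < k → (j.2 r : ℕ) < j.1.n → (ρ (j.1.parts (j.2 r)) : ℕ) = j.2 r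

/-- Use the elements of the basis. -/
def repProg : Prog := .for cX (.var vD)
  (.assign aRep (.read aPart (.read aB (.var cX)))
    (.op .lt (.read aB (.var cX)) (.var vN) * .read aB (.var cX)
      + (.const 1 - .op .lt (.read aB (.var cX)) (.var vN))
        * .read aRep (.read aPart (.read aB (.var cX)))))

/-- Rows have distinct parts, so an entry written for one row survives the later rows. A row holding
an artificial vector rewrites the old entry, that is, it keeps the arbitrary choice. -/
theorem runs_rep : Runs (fun j : WithBasis => j.1.bits)
    (fun j s => (Solved j s ∧ Function.Injective fun r => j.1.parts (j.2 r)) ∧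
      HasTransversal j 0 (s aRep)) repProg
    (fun j _ s' => HasTransversal j j.1.d (s' aRep)) := by
  refine Runs.for_assign (a := aRep) (c := cX) (by decide) (fun j : WithBasis => j.1.d)
    (fun j _ k v => HasTransversal j k v) ?_ ?_ ?_ ?_
  · exact fun j => (le_trans (by omega) j.1.m_le_sq).trans j.1.four_mul_sq_le_bits
  · exact fun j s h => h.2
  · exact fun j s s' h hf => (h.1.1.congr hf).1.2.1
  · rintro ⟨I, b⟩ s s' k ⟨⟨h, hinj⟩, -⟩ hf ⟨ρ, h1, h2, h3⟩ hc hk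
    simp only at h hk hinj h1 h2 h3 ⊢
    obtain ⟨hL, hp, hb, -⟩ := h.congr hf
    have e1 : s' aB (s' cX 0) = (b ⟨k, hk⟩ : ℕ) := by
      rw [hc]
      exact hb ⟨k, hk⟩
    have e2 : (Expr.read aPart (.read aB (.var cX))).eval s' = (I.parts (b ⟨k, hk⟩) : ℕ) := by
      rw [Expr.eval_read, Expr.eval_read, Expr.eval_var, e1]
      exact hp _
    have e3 : (Expr.op .lt (.read aB (.var cX)) (.var vN) * .read aB (.var cX)
        + (.const 1 - .op .lt (.read aB (.var cX)) (.var vN))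
          * .read aRep (.read aPart (.read aB (.var cX)))).eval s' =
        Op.eval .lt (b ⟨k, hk⟩ : ℕ) I.n * (b ⟨k, hk⟩ : ℕ) +
          (1 - Op.eval .lt (b ⟨k, hk⟩ : ℕ) I.n) * (ρ (I.parts (b ⟨k, hk⟩)) : ℕ) := by
      rw [Expr.eval_add, Expr.eval_mul, Expr.eval_mul, Expr.eval_sub, Expr.eval_op, Expr.eval_read,
        Expr.eval_var, Expr.eval_var, e1, hL.2.2.1, Expr.eval_read, e2, h2, Expr.eval_const]
    rw [e2, e3]
    by_cases hlt : (b ⟨k, hk⟩ : ℕ) < I.n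
    · rw [Op.eval_lt_of_lt (by exact_mod_cast hlt), one_mul, sub_self, zero_mul, add_zero]
      refine ⟨⟨Function.update ρ (I.parts (b ⟨k, hk⟩)) ⟨b ⟨k, hk⟩, hlt⟩, fun i => ?_, fun i => ?_,
        fun r hr hbr => ?_⟩, I.natCast_le_two_pow (le_trans (by omega) I.m_le_sq)⟩
      · by_cases hi : i = I.parts (b ⟨k, hk⟩)
        · rw [hi, Function.update_self]
          exact (Fin.addCases_left (motive := fun _ => Fin I.d) (left := I.part) (right := id)
            (⟨b ⟨k, hk⟩, hlt⟩ : Fin I.n)).symm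
        · rw [Function.update_of_ne hi, h1]
      · by_cases hi : i = I.parts (b ⟨k, hk⟩)
        · rw [hi, Function.update_self, State.write_same]
        · rw [Function.update_of_ne hi, State.write_apply,
            if_neg fun h => hi (Fin.ext (by exact_mod_cast h.2)), h2]
      · rcases Nat.lt_succ_iff_lt_or_eq.1 hr with h | rfl
        · rw [Function.update_of_ne fun h' => h.ne (congrArg Fin.val (hinj h'))]
          exact h3 r h hbr
        · rw [Function.update_self]
    · rw [Op.eval_lt_of_le (by exact_mod_cast not_lt.1 hlt), zero_mul, sub_zero, one_mul, zero_add]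
      refine ⟨⟨ρ, h1, fun i => ?_, fun r hr hbr => ?_⟩, I.natCast_le_two_pow
        ((ρ _).2.le.trans (le_trans (Nat.le_add_right I.n I.d) I.m_le_sq))⟩
      · by_cases hi : i = I.parts (b ⟨k, hk⟩)
        · rw [hi, State.write_same]
        · rw [State.write_apply, if_neg fun h => hi (Fin.ext (by exact_mod_cast h.2)), h2]
      · rcases Nat.lt_succ_iff_lt_or_eq.1 hr with h | rfl
        · exact h3 r h hbr
        · exact (hlt hbr).elim

/-- Mark the chosen elements. -/
def markProg : Prog := .for cX (.var vD) (.assign 1 (.read aRep (.var cX)) (.const 1))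

/-- The transversal is the output. -/
def OutputsTransversal (j : WithBasis) (s : State) : Prop :=
  ∃ ρ : Fin j.1.d → Fin j.1.n, (∀ i, j.1.part (ρ i) = i) ∧ j.1.output s = univ.image ρ ∧
    ∀ r : Fin j.1.d, (j.2 r : ℕ) < j.1.n → (ρ (j.1.parts (j.2 r)) : ℕ) = j.2 r

/-- Array `1` is still identically zero at this point, so the marked cells are exactly the chosen
elements. -/
theorem runs_mark : Runs (fun j : WithBasis => j.1.bits)
    (fun j s => Solved j s ∧ HasTransversal j j.1.d (s aRep)) markProg
    (fun j _ => OutputsTransversal j) := by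
  refine (Runs.for_assign (a := 1) (c := cX) (by decide) (fun j : WithBasis => j.1.d)
    (fun j s k v => ∀ y : ℤ, v y = 1 ↔ ∃ r : ℕ, r < k ∧ s aRep r = y) ?_ ?_ ?_ ?_).conseq
    (fun _ _ h => h) ?_
  · exact fun j => (le_trans (by omega) j.1.m_le_sq).trans j.1.four_mul_sq_le_bits
  · rintro j s ⟨h, -⟩ y
    rw [h.2.2.2]
    simp
  · rintro j s s' ⟨h, -⟩ hf
    rw [Expr.eval_var, hf vD (by decide) (by decide), h.1.2.1]
  · rintro j s s' k ⟨h, -⟩ hf hG hc hk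
    rw [Expr.eval_read, Expr.eval_var, hc, hf aRep (by decide) (by decide), Expr.eval_const]
    refine ⟨fun y => ?_, by simpa using one_le_pow₀ (by norm_num)⟩
    by_cases hy : y = s aRep k
    · rw [hy, State.write_same]
      simp only [true_iff]
      exact ⟨k, by omega, rfl⟩
    · rw [State.write_apply, if_neg fun h => hy h.2, hG y]
      constructor
      · rintro ⟨r, hr, h⟩
        exact ⟨r, by omega, h⟩
      · rintro ⟨r, hr, h⟩
        refine ⟨r, ?_, h⟩
        rcases Nat.lt_succ_iff_lt_or_eq.1 hr with h' | rfl
        · exact h'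
        · exact (hy h.symm).elim
  · rintro ⟨I, b⟩ s s' ⟨-, ρ, h1, h2, h3⟩ hG - -
    simp only at h1 h2 h3 hG
    refine ⟨ρ, h1, ?_, fun r => h3 r r.2⟩
    ext e
    rw [output, mem_filter, mem_image, hG]
    simp only [mem_univ, true_and]
    constructor
    · rintro ⟨r, hr, h⟩
      have := h2 ⟨r, hr⟩
      refine ⟨⟨r, hr⟩, Fin.ext ?_⟩
      rw [h] at this
      exact_mod_cast this.symm
    · rintro ⟨i, rfl⟩
      exact ⟨i, i.2, h2 i⟩

/-- Output a transversal of the parts. -/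
def outputProg : Prog := .seq anyProg (.seq repProg markProg)

theorem runs_output : Runs (fun j : WithBasis => j.1.bits)
    (fun j s => Solved j s ∧ Function.Injective fun r => j.1.parts (j.2 r)) outputProg
    (fun j _ => OutputsTransversal j) := by
  have h1 := runs_rep.seq_post runs_mark (by
    rintro j s s' ⟨⟨h, -⟩, -⟩ hQ hf -
    refine ⟨h.congr fun x h1 h2 => hf x ?_, hQ⟩
    simp only [repProg, Prog.for, Prog.set, Prog.writes, List.mem_append, List.mem_singleton]
    tauto)
  refine (runs_any.pre fun j s h => h.1).seq_post h1 ?_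
  rintro j s s' ⟨h, hinj⟩ ⟨ρ, h1, h2⟩ hf -
  refine ⟨⟨h.congr fun x h1 h2 => hf x ?_, hinj⟩, ρ, h1, h2, fun r hr => by omega⟩
  simp only [anyProg, Prog.for, Prog.set, Prog.writes, List.mem_append, List.mem_singleton]
  tauto

end PartitionInstance

/-! ### The approximation guarantee -/

namespace PartitionInstance

open RAM Finset DetMax Function

variable (I : PartitionInstance)

theorem isFeasible_image {ρ : Fin I.d → Fin I.n} (h : ∀ i, I.part (ρ i) = i) :
    I.IsFeasible (univ.image ρ) := by
  intro i
  rw [card_eq_one]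
  refine ⟨ρ i, ?_⟩
  ext e
  simp only [mem_filter, mem_image, mem_univ, true_and, mem_singleton]
  constructor
  · rintro ⟨⟨j, rfl⟩, hj⟩
    rw [← hj, h]
  · rintro rfl
    exact ⟨⟨i, rfl⟩, h i⟩

variable {I}

theorem IsFeasible.exists_eq_image {S : Finset (Fin I.n)} (hS : I.IsFeasible S) :
    ∃ τ : Fin I.d → Fin I.n, (∀ i, I.part (τ i) = i) ∧ S = univ.image τ := by
  have h : ∀ i, ∃ e, (S.filter fun e => I.part e = i) = {e} := fun i => card_eq_one.1 (hS i)
  choose τ hτ using h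
  have hm : ∀ i e, (e ∈ S ∧ I.part e = i) ↔ e = τ i := by
    intro i e
    have := Finset.ext_iff.1 (hτ i) e
    rwa [mem_filter, mem_singleton] at this
  refine ⟨τ, fun i => ((hm i _).2 rfl).2, ?_⟩
  ext e
  rw [mem_image]
  constructor
  · intro he
    exact ⟨I.part e, mem_univ _, ((hm _ e).1 ⟨he, rfl⟩).symm⟩
  · rintro ⟨i, -, rfl⟩
    exact ((hm i _).2 rfl).1

/-- The sum of the `v vᵀ` is `Aᵀ A` for the square matrix `A` whose rows are the selected vectors.
-/
theorem objective_image {σ : Fin I.d → Fin I.n} (hσ : Injective σ) :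
    I.objective (univ.image σ) = (Matrix.of fun r => I.vec (σ r)).det ^ 2 := by
  unfold objective
  rw [sum_image fun _ _ _ _ h => hσ h]
  rw [show (Matrix.of fun r => I.vec (σ r)).det ^ 2 =
    ((Matrix.of fun r => I.vec (σ r)).transpose * Matrix.of fun r => I.vec (σ r)).det by
      rw [Matrix.det_mul, Matrix.det_transpose, sq]]
  congr 1
  ext i j
  rw [Matrix.sum_apply, Matrix.mul_apply]
  simp [Matrix.vecMulVec_apply]

variable (I)

/-- The factors of the vectors of the search. -/
def factor : Fin (I.n + I.d) → ℤ := Fin.addCases (fun _ => I.bonus I.level) fun _ => 1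

/-- The vectors of the search without their factors. -/
def plain : Fin (I.n + I.d) → Fin I.d → ℤ :=
  Fin.addCases (fun e i => I.scaled (e * I.d + i)) (fun r i => if r = i then 1 else 0)

theorem vectors_eq (e : Fin (I.n + I.d)) (i : Fin I.d) :
    I.vectors e i = I.factor e * I.plain e i := by
  unfold vectors factor plain
  refine Fin.addCases (fun e => ?_) (fun r => ?_) e
  · simp only [Fin.addCases_left]
  · simp only [Fin.addCases_right, one_mul]

theorem bdet_vectors (b : Fin I.d → Fin (I.n + I.d)) :
    bdet I.vectors b = (∏ r, I.factor (b r)) * bdet I.plain b := by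
  unfold bdet
  rw [← Matrix.det_mul_column]
  congr 1
  ext r i
  simp [vectors_eq]

theorem abs_plain_le (e : Fin (I.n + I.d)) (i : Fin I.d) :
    |I.plain e i| ≤ I.mass (I.n * I.d) := by
  unfold plain
  refine Fin.addCases (fun e => ?_) (fun r => ?_) e
  · rw [Fin.addCases_left, Int.abs_eq_natAbs]
    exact_mod_cast I.natAbs_scaled_le_mass (pair_lt e i)
  · rw [Fin.addCases_right]
    split_ifs
    · rw [abs_one]
      exact_mod_cast I.one_le_mass _
    · simp

theorem factor_nonneg (e : Fin (I.n + I.d)) : 0 ≤ I.factor e := by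
  unfold factor
  refine Fin.addCases (fun e => ?_) (fun r => ?_) e
  · simp
  · simp

theorem factor_le (e : Fin (I.n + I.d)) : I.factor e ≤ I.bonus I.level := by
  unfold factor
  refine Fin.addCases (fun e => ?_) (fun r => ?_) e
  · simp
  · rw [Fin.addCases_right]
    exact_mod_cast I.one_le_bonus _

theorem bdet_plain (σ : Fin I.d → Fin I.n) :
    (bdet I.plain (fun r => Fin.castAdd I.d (σ r)) : ℚ)
      = (I.commonDen (I.n * I.d)) ^ I.d * (Matrix.of fun r => I.vec (σ r)).det := by
  unfold bdet
  have h := Matrix.det_smul (Matrix.of fun r => I.vec (σ r)) (I.commonDen (I.n * I.d) : ℚ)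
  rw [Fintype.card_fin] at h
  rw [← h]
  refine (RingHom.map_det (Int.castRingHom ℚ) _).trans ?_
  congr 1
  ext r i
  simp only [RingHom.mapMatrix_apply, Matrix.map_apply, Matrix.of_apply, Int.coe_castRingHom,
    Matrix.smul_apply, smul_eq_mul, plain, Fin.addCases_left]
  exact I.scaled_eq _ _

theorem factor_castAdd (e : Fin I.n) : I.factor (Fin.castAdd I.d e) = I.bonus I.level := by
  simp [factor]

theorem bdet_castAdd (σ : Fin I.d → Fin I.n) :
    bdet I.vectors (fun r => Fin.castAdd I.d (σ r))
      = (I.bonus I.level : ℤ) ^ I.d * bdet I.plain (fun r => Fin.castAdd I.d (σ r)) := by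
  rw [bdet_vectors]
  simp [factor_castAdd]

/-- The factor makes artificial vectors too expensive. -/
theorem pow_mul_lt_bonus (hd : 1 ≤ I.d) :
    I.d ^ (5 * I.d) * (I.d.factorial * I.mass (I.n * I.d) ^ I.d) < I.bonus I.level := by
  have hM := I.one_le_mass (I.n * I.d)
  unfold bonus level
  generalize I.mass (I.n * I.d) = M at hM
  have h1 : I.d.factorial ≤ I.d ^ I.d := Nat.factorial_le_pow _
  have h2 : M ^ I.d ≤ M ^ (6 * I.d) := Nat.pow_le_pow_right hM (by omega)
  have h3 : 1 ≤ (I.d * M + 1) ^ (6 * I.d) := Nat.one_le_pow _ _ (by omega)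
  have h4 : 1 ≤ I.d * M := Nat.mul_le_mul hd hM
  -- This explains the exponent `6 * d + 1`: the approximation factor takes `5 * d` powers of `d`,
  -- the factorial another `d`, and one more factor makes the inequality strict.
  calc _ ≤ I.d ^ (5 * I.d) * (I.d ^ I.d * M ^ (6 * I.d)) := by gcongr
    _ = (I.d * M) ^ (6 * I.d) := by rw [mul_pow, ← mul_assoc, ← pow_add]; congr 2; omega
    _ ≤ (I.d * M + 1) ^ (6 * I.d) := Nat.pow_le_pow_left (by omega) _
    _ < (I.d * M + 1) ^ (6 * I.d) * (I.d * M + 1) := by nlinarith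
    _ = _ := by rw [pow_succ]

/-- An artificial row has factor one instead of the bonus, so at most `d - 1` bonus factors can be
pulled out; the rest is the crude bound on a determinant with entries at most `mass`. -/
theorem natAbs_bdet_le_of_artificial {b : Fin I.d → Fin (I.n + I.d)} {r : Fin I.d}
    (hr : I.n ≤ b r) : (bdet I.vectors b).natAbs ≤
      I.bonus I.level ^ (I.d - 1) * (I.d.factorial * I.mass (I.n * I.d) ^ I.d) := by
  have h1 := abs_bdet_le _ I.abs_plain_le b
  have hr1 : I.factor (b r) = 1 := by
    have : b r = Fin.natAdd I.n ⟨b r - I.n, by omega⟩ := Fin.ext (by simp; omega)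
    rw [this, factor, Fin.addCases_right]
  have h2 : ∏ t, I.factor (b t) ≤ (I.bonus I.level : ℤ) ^ (I.d - 1) := by
    rw [← mul_prod_erase univ (fun t => I.factor (b t)) (mem_univ r), hr1, one_mul]
    calc _ ≤ ∏ _t ∈ univ.erase r, (I.bonus I.level : ℤ) :=
          prod_le_prod (fun t _ => I.factor_nonneg _) fun t _ => I.factor_le _
      _ = _ := by simp
  have h3 : |bdet I.vectors b| ≤
      (I.bonus I.level : ℤ) ^ (I.d - 1) * (I.d.factorial * I.mass (I.n * I.d) ^ I.d) := by
    rw [bdet_vectors, abs_mul, abs_of_nonneg (prod_nonneg fun t _ => I.factor_nonneg _)]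
    exact mul_le_mul h2 h1 (abs_nonneg _) (by positivity)
  rw [Int.abs_eq_natAbs] at h3
  exact_mod_cast h3

variable {I}

/-- Local optima are approximately optimal. -/
theorem objective_le_of_locallyOptimal {b : Fin I.d → Fin (I.n + I.d)} (hb : bdet I.vectors b ≠ 0)
    (hinj : Injective fun r => I.parts (b r)) (hopt : LocallyOptimal I.vectors I.parts b)
    {S OPT : Finset (Fin I.n)} {ρ : Fin I.d → Fin I.n} (h1 : ∀ i, I.part (ρ i) = i)
    (h2 : S = univ.image ρ)
    (h3 : ∀ r : Fin I.d, (b r : ℕ) < I.n → (ρ (I.parts (b r)) : ℕ) = b r)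
    (hfeas : I.IsFeasible OPT) :
    I.objective OPT ≤ I.d ^ (10 * I.d) * I.objective S := by
  obtain ⟨τ, hτ, rfl⟩ := hfeas.exists_eq_image
  have hπ : Bijective fun r => I.parts (b r) := Finite.injective_iff_bijective.1 hinj
  -- The rows of `b` may carry the parts in permuted order. Transversals are reindexed accordingly,
  -- so that row `r` of the competitor has the part of `b r`; as sets they do not change.
  have himage : ∀ σ : Fin I.d → Fin I.n, univ.image σ = univ.image fun r => σ (I.parts (b r)) := by
    intro σ
    rw [show (fun r => σ (I.parts (b r))) = σ ∘ fun r => I.parts (b r) from rfl, ← image_image,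
      image_univ_of_surjective hπ.2]
  have hinj' : ∀ σ : Fin I.d → Fin I.n, (∀ i, I.part (σ i) = i) →
      Injective fun r => σ (I.parts (b r)) := fun σ hσ =>
    (LeftInverse.injective hσ).comp hinj
  rw [h2, himage τ, himage ρ, objective_image (hinj' τ hτ), objective_image (hinj' ρ h1)]
  -- If the competitor has determinant zero, the claim holds because objectives are squares; only
  -- otherwise must the basis be free of artificial vectors.
  by_cases h0 : (Matrix.of fun r => I.vec (τ (I.parts (b r)))).det = 0
  · rw [h0]
    positivity
  have hD := I.commonDen_pos le_rfl
  have hK := I.one_le_bonus I.level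
  have hle := hopt.natAbs_bdet_le hb (c := fun r => Fin.castAdd I.d (τ (I.parts (b r)))) fun r => by
    simp [parts, hτ]
  have hplain : 1 ≤ (bdet I.plain fun r => Fin.castAdd I.d (τ (I.parts (b r)))).natAbs := by
    rw [Nat.one_le_iff_ne_zero, ne_eq, Int.natAbs_eq_zero]
    intro h
    have h' := I.bdet_plain fun r => τ (I.parts (b r))
    rw [h, Int.cast_zero, eq_comm, mul_eq_zero] at h'
    rcases h' with h' | h'
    · exact pow_ne_zero _ (by exact_mod_cast hD.ne') h'
    · exact h0 h'
  -- The competitor's unscaled integer determinant is nonzero, so its scaled one is at least the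
  -- `d`-th power of the bonus, which a basis with an artificial vector cannot reach even after
  -- multiplication by `d ^ (5 * d)`.
  have hinput : ∀ r, (b r : ℕ) < I.n := by
    intro r
    by_contra hr
    have hd : 1 ≤ I.d := r.pos
    have hart := I.natAbs_bdet_le_of_artificial (not_lt.1 hr)
    rw [bdet_castAdd, Int.natAbs_mul, Int.natAbs_pow, Int.natAbs_natCast] at hle
    have hlt := I.pow_mul_lt_bonus hd
    have hpos : 0 < I.bonus I.level ^ (I.d - 1) := Nat.pow_pos hK
    have : I.bonus I.level ^ I.d < I.bonus I.level ^ I.d := by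
      calc I.bonus I.level ^ I.d ≤ I.bonus I.level ^ I.d *
            (bdet I.plain fun r => Fin.castAdd I.d (τ (I.parts (b r)))).natAbs :=
            Nat.le_mul_of_pos_right _ hplain
        _ ≤ I.d ^ (5 * I.d) * (I.bonus I.level ^ (I.d - 1) *
            (I.d.factorial * I.mass (I.n * I.d) ^ I.d)) :=
            hle.trans (Nat.mul_le_mul_left _ hart)
        _ = I.bonus I.level ^ (I.d - 1) *
            (I.d ^ (5 * I.d) * (I.d.factorial * I.mass (I.n * I.d) ^ I.d)) := by ring
        _ < I.bonus I.level ^ (I.d - 1) * I.bonus I.level := Nat.mul_lt_mul_of_pos_left hlt hpos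
        _ = I.bonus I.level ^ I.d := by rw [← pow_succ, Nat.sub_add_cancel hd]
    exact lt_irrefl _ this
  -- Since no artificial vector is left, the transversal that is output agrees with the basis row by
  -- row, and the common factors of bonus and denominators cancel.
  have hbeq : b = fun r => Fin.castAdd I.d (ρ (I.parts (b r))) := by
    funext r
    exact Fin.ext (h3 r (hinput r)).symm
  have hle' : |(bdet I.vectors fun r => Fin.castAdd I.d (τ (I.parts (b r))) : ℚ)| ≤
      I.d ^ (5 * I.d) * |(bdet I.vectors fun r => Fin.castAdd I.d (ρ (I.parts (b r))) : ℚ)| := by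
    rw [← hbeq, ← Int.cast_abs, ← Int.cast_abs, Int.abs_eq_natAbs, Int.abs_eq_natAbs]
    exact_mod_cast hle
  rw [bdet_castAdd, bdet_castAdd] at hle'
  push_cast at hle'
  rw [bdet_plain I fun r => τ (I.parts (b r)), bdet_plain I fun r => ρ (I.parts (b r)), ← mul_assoc,
    ← mul_assoc, ← mul_pow, abs_mul, abs_mul _ (Matrix.det _)] at hle'
  have hpos : (0 : ℚ) < |((I.bonus I.level : ℚ) * I.commonDen (I.n * I.d)) ^ I.d| := by
    have : (0 : ℚ) < I.bonus I.level := by exact_mod_cast hK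
    have : (0 : ℚ) < I.commonDen (I.n * I.d) := by exact_mod_cast hD
    positivity
  have hfin : |(Matrix.of fun r => I.vec (τ (I.parts (b r)))).det| ≤
      I.d ^ (5 * I.d) * |(Matrix.of fun r => I.vec (ρ (I.parts (b r)))).det| := by
    refine le_of_mul_le_mul_left (hle'.trans_eq ?_) hpos
    ring
  rw [← sq_abs, ← sq_abs (Matrix.det (Matrix.of fun r => I.vec (ρ (I.parts (b r)))))]
  calc _ ≤ ((I.d : ℚ) ^ (5 * I.d) * |(Matrix.of fun r => I.vec (ρ (I.parts (b r)))).det|) ^ 2 :=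
        pow_le_pow_left₀ (abs_nonneg _) hfin 2
    _ = _ := by rw [mul_pow, ← pow_mul]; congr 2; ring

theorem exp_neg_mul_pow (d : ℕ) :
    Real.exp (-10 * (d : ℝ) * Real.log d) * (d : ℝ) ^ (10 * d) = 1 := by
  rcases Nat.eq_zero_or_pos d with rfl | hd
  · simp
  · have h : (d : ℝ) ^ (10 * d) = Real.exp ((10 * d : ℕ) * Real.log d) := by
      rw [Real.exp_nat_mul, Real.exp_log (by exact_mod_cast hd)]
    rw [h, ← Real.exp_add]
    push_cast
    ring_nf
    simp

/-- The algorithm. -/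
def algorithm : Prog := .seq initProg (.seq searchProg outputProg)

/-- The output comes from a local optimum. -/
def Succeeded (I : PartitionInstance) (s : State) : Prop :=
  ∃ b : Fin I.d → Fin (I.n + I.d), bdet I.vectors b ≠ 0 ∧ (Injective fun r => I.parts (b r)) ∧
    LocallyOptimal I.vectors I.parts b ∧ OutputsTransversal ⟨I, b⟩ s

theorem runs_algorithm : Runs bits (fun I s => s 0 = State.init I.encode 0 ∧ s 1 = 0) algorithm
    (fun I _ => I.Succeeded) := by
  have h1 : Runs bits (fun I s => ∃ b, (Solved ⟨I, b⟩ s ∧ Injective fun r => I.parts (b r)) ∧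
      bdet I.vectors b ≠ 0 ∧ LocallyOptimal I.vectors I.parts b) outputProg
      (fun I _ => I.Succeeded) := by
    refine runs_output.choose_index ?_
    rintro I s ⟨b, h, hb, hopt⟩
    exact ⟨⟨I, b⟩, rfl, h, fun s' hs' _ _ => ⟨b, hb, h.2, hopt, hs'⟩⟩
  have h2 : Runs bits (fun I s => I.Initialized s ∧ s 1 = 0) (.seq searchProg outputProg)
      (fun I _ => I.Succeeded) := by
    refine ((runs_search.comap ctx).pre fun I s h => ⟨I.startBasis, h.1.2⟩).seq_post h1 ?_
    rintro I s s' ⟨⟨hL, -⟩, h0⟩ ⟨b, ⟨⟨hE, hT, hb⟩, hinj⟩, hopt⟩ hf -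
    refine ⟨b, ⟨⟨?_, hE.2.2, hT.1, ?_⟩, hinj⟩, hb, hopt⟩
    · exact hL.congr (hf _ (by decide)) (hf _ (by decide)) (hf _ (by decide)) (hf _ (by decide))
    · rw [hf 1 (by decide), h0]
  refine (runs_init.pre fun I s h => h.1).seq_post h2 ?_
  rintro I s s' ⟨-, h0⟩ hQ hf -
  exact ⟨hQ, by rw [hf 1 (by decide), h0]⟩

end PartitionInstance

theorem theorem3 :
    ∃ (prog : RAM.Prog) (p : Polynomial ℕ), ∀ I : PartitionInstance,
      ∃ (s : RAM.State) (t : ℕ),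
        RAM.Exec prog (RAM.State.init I.encode) s t ∧
        t ≤ p.eval (RAM.inputSize I.encode) ∧
        I.IsFeasible (I.output s) ∧
        ∀ OPT : Finset (Fin I.n), I.IsOptimal OPT →
          Real.exp (-10 * (I.d : ℝ) * Real.log (I.d : ℝ)) * (I.objective OPT : ℝ)
            ≤ (I.objective (I.output s) : ℝ) := by
  obtain ⟨N, hN⟩ := PartitionInstance.runs_algorithm
  refine ⟨PartitionInstance.algorithm, N.comp PartitionInstance.bitPoly, fun I => ?_⟩
  obtain ⟨s, t, hexec, ht, ⟨b, hb, hinj, hopt, ρ, h1, h2, h3⟩, -⟩ := hN I (RAM.State.init I.encode)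
    ⟨rfl, rfl⟩ ((RAM.Bdd.init _).mono I.size_le_bitPoly)
  refine ⟨s, t, hexec, by rwa [Polynomial.eval_comp], h2 ▸ I.isFeasible_image h1, ?_⟩
  intro OPT hOPT
  have h := PartitionInstance.objective_le_of_locallyOptimal hb hinj hopt h1 h2 h3 hOPT.1
  have h' : (I.objective OPT : ℝ) ≤ (I.d : ℝ) ^ (10 * I.d) * (I.objective (I.output s) : ℝ) := by
    exact_mod_cast h
  calc _ ≤ Real.exp (-10 * (I.d : ℝ) * Real.log (I.d : ℝ)) *
        ((I.d : ℝ) ^ (10 * I.d) * (I.objective (I.output s) : ℝ)) :=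
        mul_le_mul_of_nonneg_left h' (Real.exp_nonneg _)
    _ = _ := by rw [← mul_assoc, PartitionInstance.exp_neg_mul_pow, one_mul]
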